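/- Let $n\ge 3$ and let $p>1$ be real. Let $\mathcal P^n$ be the set of convex polytopes in $\mathbb R^n$ (convex hulls of nonempty finite sets), let $h(K,u)=\max_{x\in K}\langle x,u\rangle$ be the support function of a convex body $K$, and let $C_p$ be the vector space of continuous functions $f:\mathbb R^n\to\mathbb R$ with $f(sx)=s^pf(x)$ for all $s>0$ and $x\in\mathbb R^n$. For $P\in\mathcal P^n$ and a unit vector $v$ put $F(P,v)=P\cap\{x:\langle x,v\rangle=h(P,v)\}$, and let $\mathcal N(P)$ be the set of unit vectors $v$ for which $F(P,v)$ has dimension $n-1$ (so if $\dim P=n-1$, both unit normals of the affine hull of $P$ belong to $\mathcal N(P)$). With $t_+=\max\{t,0\}$ and $t_-=\max\{-t,0\}$, let $\Pi_p^{\pm,>}P$ and $\Pi_p^{\pm,<}P$ be the convex bodies containing the origin that are determined by $$h(\Pi_p^{\pm,>}P,u)^p=\sum_{v\in\mathcal N(P),\ h(P,v)>0}\mathrm{vol}_{n-1}(F(P,v))\,h(P,v)^{1-p}\,\langle v,u\rangle_\pm^p ,$$ $$h(\Pi_p^{\pm,<}P,u)^p=\sum_{v\in\mathcal N(P),\ h(P,v)<0}\mathrm{vol}_{n-1}(F(P,v))\,|h(P,v)|^{1-p}\,\langle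 v,u\rangle_\pm^p$$ for all $u\in\mathbb R^n$. Let $\Phi:\mathcal P^n\to C_p$ be a valuation, i.e. $\Phi(K\cup L)+\Phi(K\cap L)=\Phi(K)+\Phi(L)$ whenever $K,L,K\cup L,K\cap L\in\mathcal P^n$, and let $\Phi$ be $SL(n)$-contravariant, i.e. $\Phi(\phi P)=\Phi(P)\circ\phi^{-1}$ for all $P\in\mathcal P^n$ and $\phi\in SL(n)$. Let $T^n=\mathrm{conv}\{0,e_1,\dots,e_n\}$ and $T^{n-1}=\mathrm{conv}\{e_1,\dots,e_n\}$. Assume that for every $y\in\mathbb R^n$ there are nonempty bounded open intervals $I_y,J_y\subseteq(0,\infty)$ such that neither $\{\Phi(sT^n)(y):s\in I_y\}$ nor $\{\Phi(sT^{n-1})(y):s\in J_y\}$ is dense in $\mathbb R$. Then there exist constants $c_1,c_2,c_3,c_4\in\mathbb R$ such that for all $P\in\mathcal P^n$ $$\Phi P=c_1\,h(\Pi_p^{+,>}P,\cdot)^p+c_2\,h(\Pi_p^{-,>}P,\cdot)^p+c_3\,h(\Pi_p^{+,<}P,\cdot)^p+c_4\,h(\Pi_p^{-,<}P,\cdot)^p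 .$$ -/

import Mathlib

open MeasureTheory Set

noncomputable section

namespace LpVal

/-- Euclidean space `ℝⁿ`. -/
abbrev E (n : ℕ) : Type := EuclideanSpace ℝ (Fin n)

/-! ### Support functions and convex bodies with a given support function -/

/-- The support function `h(K, u) = max_{x ∈ K} ⟨x, u⟩`. -/
def supportFn {n : ℕ} (K : Set (E n)) (u : E n) : ℝ :=
  sSup ((fun x : E n => inner ℝ x u) '' K)

/-- Sublinear functions: subadditive and positively homogeneous. -/
structure Sublinear {n : ℕ} (h : E n → ℝ) : Prop where
  add_le : ∀ u v, h (u + v) ≤ h u + h v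
  smul_eq : ∀ s : ℝ, 0 < s → ∀ u, h (s • u) = s * h u

theorem Sublinear.zero {n : ℕ} {h : E n → ℝ} (hh : Sublinear h) : h 0 = 0 := by
  have := hh.smul_eq 2 (by norm_num) 0
  rw [smul_zero] at this
  linarith

/-- Every value of a sublinear function is attained by a linear functional below it. -/
theorem Sublinear.exists_touching {n : ℕ} {h : E n → ℝ} (hh : Sublinear h) (u : E n) :
    ∃ x : E n, (∀ w, inner ℝ x w ≤ h w) ∧ inner ℝ x u = h u := by
  have key : ∃ g : E n →ₗ[ℝ] ℝ, g u = h u ∧ ∀ w, g w ≤ h w := by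
    by_cases hu : u = 0
    · obtain ⟨g, -, hg⟩ := exists_extension_of_le_sublinear
        (⟨⊥, 0⟩ : E n →ₗ.[ℝ] ℝ) h hh.smul_eq hh.add_le (by
          rintro ⟨x, hx⟩
          have hx0 : x = 0 := by simpa using hx
          subst hx0
          simp [hh.zero])
      exact ⟨g, by simp [hu, hh.zero], hg⟩
    · obtain ⟨g, hg1, hg⟩ := exists_extension_of_le_sublinear
        (LinearPMap.mkSpanSingleton u (h u) hu) h hh.smul_eq hh.add_le (by
          rintro ⟨x, hx⟩
          obtain ⟨t, rfl⟩ := Submodule.mem_span_singleton.1 hx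
          rw [LinearPMap.mkSpanSingleton'_apply, smul_eq_mul]
          change t * h u ≤ h (t • u)
          rcases lt_trichotomy t 0 with ht | rfl | ht
          · have h1 := hh.add_le (t • u) ((-t) • u)
            rw [← add_smul, hh.smul_eq (-t) (by linarith)] at h1
            simp only [add_neg_cancel, zero_smul, hh.zero] at h1
            linarith
          · simp [hh.zero]
          · rw [hh.smul_eq t ht])
      refine ⟨g, ?_, hg⟩
      have := hg1 ⟨u, Submodule.mem_span_singleton_self u⟩
      rw [LinearPMap.mkSpanSingleton_apply] at this
      exact this
  obtain ⟨g, hgu, hg⟩ := key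
  refine ⟨(InnerProductSpace.toDual ℝ (E n)).symm (LinearMap.toContinuousLinearMap g), ?_, ?_⟩
  · intro w
    rw [InnerProductSpace.toDual_symm_apply]
    exact hg w
  · rw [InnerProductSpace.toDual_symm_apply]
    exact hgu

/-- The convex body whose support function is the sublinear function `h`. -/
def bodyOfSublinear {n : ℕ} (h : E n → ℝ) (hh : Sublinear h) : ConvexBody (E n) where
  carrier := {x | ∀ u, inner ℝ x u ≤ h u}
  convex' := by
    intro x hx y hy a b ha hb hab u
    rw [inner_add_left, real_inner_smul_left, real_inner_smul_left]
    calc a * inner ℝ x u + b * inner ℝ y u ≤ a * h u + b * h u :=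
          add_le_add (mul_le_mul_of_nonneg_left (hx u) ha) (mul_le_mul_of_nonneg_left (hy u) hb)
      _ = h u := by rw [← add_mul, hab, one_mul]
  isCompact' := by
    refine Metric.isCompact_of_isClosed_isBounded ?_ ?_
    · simp only [ofPred_forall]
      exact isClosed_iInter fun u =>
        isClosed_le (continuous_id.inner continuous_const) continuous_const
    · have hb : BddAbove (Set.range fun i : Fin n => max (h (EuclideanSpace.single i 1))
          (h (-EuclideanSpace.single i 1))) := (Set.finite_range _).bddAbove
      obtain ⟨M, hM⟩ := hb
      refine (Metric.isBounded_closedBall (x := (0 : E n)) (r := √(n * M ^ 2))).subset ?_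
      intro x hx
      have hxi : ∀ i, |x i| ≤ M := by
        intro i
        have h1 := hx (EuclideanSpace.single i 1)
        have h2 := hx (-EuclideanSpace.single i 1)
        have h3 := hM ⟨i, rfl⟩
        simp only [inner_neg_right, EuclideanSpace.inner_single_right, one_mul,
          conj_trivial] at h1 h2
        have h4 := max_le_iff.1 h3
        exact abs_le.2 ⟨by linarith [h4.2], by linarith [h4.1]⟩
      rw [mem_closedBall_zero_iff, EuclideanSpace.norm_eq]
      refine Real.sqrt_le_sqrt ?_
      calc ∑ i, ‖x i‖ ^ 2 ≤ ∑ _i : Fin n, M ^ 2 := by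
            refine Finset.sum_le_sum fun i _ => ?_
            rw [Real.norm_eq_abs]
            exact pow_le_pow_left₀ (abs_nonneg _) (hxi i) 2
        _ = n * M ^ 2 := by simp
  nonempty' := by
    obtain ⟨x, hx, -⟩ := hh.exists_touching 0
    exact ⟨x, hx⟩

theorem supportFn_bodyOfSublinear {n : ℕ} (h : E n → ℝ) (hh : Sublinear h) (u : E n) :
    supportFn (bodyOfSublinear h hh : Set (E n)) u = h u := by
  obtain ⟨x, hx, hxu⟩ := hh.exists_touching u
  refine IsGreatest.csSup_eq ⟨⟨x, hx, hxu⟩, ?_⟩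
  rintro _ ⟨y, hy, rfl⟩
  exact hy u

/-! ### Polytopes -/

/-- `𝒫ⁿ`: convex hulls of nonempty finite subsets of `ℝⁿ`. -/
structure Polytope (n : ℕ) where
  carrier : Set (E n)
  exists_finite' : ∃ S : Set (E n), S.Finite ∧ S.Nonempty ∧ carrier = convexHull ℝ S

instance (n : ℕ) : Coe (Polytope n) (Set (E n)) := ⟨Polytope.carrier⟩

/-- The convex hull of a nonempty finite set, as a polytope. -/
def Polytope.hull {n : ℕ} (S : Set (E n)) (hfin : S.Finite) (hne : S.Nonempty) : Polytope n :=
  ⟨convexHull ℝ S, S, hfin, hne, rfl⟩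

/-- The image of a polytope under a linear map. -/
def Polytope.map {n : ℕ} (f : E n →ₗ[ℝ] E n) (P : Polytope n) : Polytope n where
  carrier := f '' P.carrier
  exists_finite' := by
    obtain ⟨S, hfin, hne, hS⟩ := P.exists_finite'
    exact ⟨f '' S, hfin.image f, hne.image f, by rw [hS, LinearMap.image_convexHull]⟩

/-- The dilate `sP = {s x : x ∈ P}`. -/
def Polytope.scale {n : ℕ} (s : ℝ) (P : Polytope n) : Polytope n :=
  P.map (s • LinearMap.id)

/-- `Tⁿ = conv {o, e₁, …, eₙ}`. -/
def cornerSimplex (n : ℕ) : Polytope n :=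
  Polytope.hull (insert 0 (Set.range fun i : Fin n => EuclideanSpace.single i (1 : ℝ)))
    ((Set.finite_range _).insert 0) (Set.insert_nonempty _ _)

/-- `Tⁿ⁻¹ = conv {e₁, …, eₙ}`. -/
def faceSimplex (n : ℕ) (hn : 0 < n) : Polytope n :=
  Polytope.hull (Set.range fun i : Fin n => EuclideanSpace.single i (1 : ℝ))
    (Set.finite_range _) ⟨_, ⟨⟨0, hn⟩, rfl⟩⟩

/-! ### Facets -/

/-- `F(P, v) = P ∩ {x : ⟨x, v⟩ = h(P, v)}`. -/
def face {n : ℕ} (P : Set (E n)) (v : E n) : Set (E n) :=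
  P ∩ {x | inner ℝ x v = supportFn P v}

/-- `𝒩(P)`: the unit vectors `v` such that `F(P, v)` is a facet, i.e. has dimension `n - 1`.
An `(n-1)`-dimensional `P` is a facet of itself, with both of its unit normals. -/
def facetNormals {n : ℕ} (P : Set (E n)) : Set (E n) :=
  {v | ‖v‖ = 1 ∧ Module.finrank ℝ (vectorSpan ℝ (face P v)) + 1 = n}

/-- `vol_{n-1}(F(P, v))`. -/
def faceVol {n : ℕ} (P : Set (E n)) (v : E n) : ℝ :=
  (μHE[n - 1] : Measure (E n)).real (face P v)

/-- A polytope has finitely many facet normals, so the sums over them below are finite. -/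
theorem facetNormals_finite {n : ℕ} (P : Polytope n) : (facetNormals (P : Set (E n))).Finite := by
  obtain ⟨S, hfin, -, hS⟩ := P.exists_finite'
  refine Set.Finite.of_finite_fibers (face (P : Set (E n))) ?_ ?_
  · refine (hfin.finite_subsets.image fun A => closure (convexHull ℝ A)).subset ?_
    rintro _ ⟨v, -, rfl⟩
    have hPc : IsCompact (P : Set (E n)) := by rw [hS]; exact hfin.isCompact_convexHull ℝ
    have hPx : Convex ℝ (P : Set (E n)) := by rw [hS]; exact convex_convexHull ℝ S
    have hcl : IsClosed {x : E n | inner ℝ x v = supportFn (P : Set (E n)) v} :=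
      isClosed_eq (continuous_id.inner continuous_const) continuous_const
    have hcv : Convex ℝ {x : E n | inner ℝ x v = supportFn (P : Set (E n)) v} := by
      intro x hx y hy a b _ _ hab
      simp only [mem_ofPred_eq] at hx hy ⊢
      rw [inner_add_left, real_inner_smul_left, real_inner_smul_left, hx, hy, ← add_mul, hab,
        one_mul]
    have hbdd : BddAbove ((fun x : E n => inner ℝ x v) '' (P : Set (E n))) :=
      (hPc.image (continuous_id.inner continuous_const)).bddAbove
    have hext : IsExtreme ℝ (P : Set (E n)) (face (P : Set (E n)) v) := by
      refine ⟨inter_subset_left, ?_⟩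
      rintro x hx y hy z ⟨_, hz⟩ ⟨a, b, ha, hb, hab, rfl⟩
      refine ⟨hx, ?_⟩
      have h1 : inner ℝ x v ≤ supportFn (P : Set (E n)) v := le_csSup hbdd ⟨x, hx, rfl⟩
      have h2 : inner ℝ y v ≤ supportFn (P : Set (E n)) v := le_csSup hbdd ⟨y, hy, rfl⟩
      simp only [mem_ofPred_eq] at hz ⊢
      rw [inner_add_left, real_inner_smul_left, real_inner_smul_left] at hz
      refine le_antisymm h1 ?_
      by_contra hlt
      push Not at hlt
      have h3 := mul_lt_mul_of_pos_left hlt ha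
      have h4 := mul_le_mul_of_nonneg_left h2 hb.le
      have h5 : a * supportFn (P : Set (E n)) v + b * supportFn (P : Set (E n)) v
          = supportFn (P : Set (E n)) v := by rw [← add_mul, hab, one_mul]
      linarith
    refine ⟨(face (P : Set (E n)) v).extremePoints ℝ, ?_, ?_⟩
    · refine (hext.extremePoints_subset_extremePoints).trans ?_
      rw [hS]
      exact extremePoints_convexHull_subset
    · exact closure_convexHull_extremePoints (hPc.inter_right hcl) (hPx.inter hcv)
  · rintro _ ⟨v₀, hv₀, rfl⟩
    set W := vectorSpan ℝ (face (P : Set (E n)) v₀) with hW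
    have hperp : ∀ v, face (P : Set (E n)) v = face (P : Set (E n)) v₀ → v ∈ Wᗮ := by
      intro v hv
      rw [Submodule.mem_orthogonal]
      intro w hw
      rw [hW, ← hv] at hw
      induction hw using Submodule.span_induction with
      | mem w hw =>
        obtain ⟨x, hx, y, hy, rfl⟩ := hw
        have hx2 : inner ℝ x v = supportFn (P : Set (E n)) v := hx.2
        have hy2 : inner ℝ y v = supportFn (P : Set (E n)) v := hy.2
        change inner ℝ (x - y) v = 0
        rw [inner_sub_left, hx2, hy2, sub_self]
      | zero => simp
      | add a b _ _ ha hb => rw [inner_add_left, ha, hb, add_zero]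
      | smul t a _ ha => rw [real_inner_smul_left, ha, mul_zero]
    have hdim : Module.finrank ℝ Wᗮ = 1 := by
      have h1 := Submodule.finrank_add_finrank_orthogonal W
      have h2 : Module.finrank ℝ W + 1 = n := hv₀.2
      rw [finrank_euclideanSpace_fin] at h1
      omega
    have hv0 : v₀ ≠ 0 := by
      intro h0
      have := hv₀.1
      rw [h0, norm_zero] at this
      exact zero_ne_one this
    refine (Set.toFinite {v₀, -v₀}).subset ?_
    rintro v ⟨hvN, hv⟩
    obtain ⟨t, ht⟩ := (finrank_eq_one_iff_of_nonzero' (⟨v₀, hperp v₀ rfl⟩ : Wᗮ)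
      (by simpa [Subtype.ext_iff] using hv0)).1 hdim ⟨v, hperp v hv⟩
    have ht' : t • v₀ = v := congrArg Subtype.val ht
    have habs : |t| = 1 := by
      have := hvN.1
      rw [← ht', norm_smul, hv₀.1, mul_one] at this
      exact this
    rcases (abs_eq (by norm_num)).1 habs with h | h
    · left; rw [← ht', h, one_smul]
    · right; rw [mem_singleton_iff, ← ht', h, neg_one_smul]

/-! ### The asymmetric `L_p` projection body operators on `𝒫ⁿ` -/

/-- `⟨v, u⟩₊ = max {⟨v, u⟩, 0}`. -/
def innerPos {n : ℕ} (v u : E n) : ℝ := max (inner ℝ v u) 0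

/-- `⟨v, u⟩₋ = max {-⟨v, u⟩, 0}`. -/
def innerNeg {n : ℕ} (v u : E n) : ℝ := max (-inner ℝ v u) 0

/-- The sum `∑_{v ∈ 𝒩(P) ∩ I} vol_{n-1}(F(P, v)) |h(P, v)|^{1-p} g(v, u)^p`. -/
def facetSum {n : ℕ} (p : ℝ) (I : Set (E n)) (g : E n → E n → ℝ) (P : Polytope n) (u : E n) : ℝ :=
  ∑ᶠ v ∈ facetNormals (P : Set (E n)) ∩ I,
    faceVol (P : Set (E n)) v * |supportFn (P : Set (E n)) v| ^ (1 - p) * g v u ^ p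

theorem sublinear_innerPos {n : ℕ} (v : E n) : Sublinear (innerPos v) where
  add_le u w := by
    unfold innerPos
    rw [inner_add_right]
    exact max_le (add_le_add (le_max_left _ _) (le_max_left _ _))
      (add_nonneg (le_max_right _ _) (le_max_right _ _))
  smul_eq s hs u := by
    unfold innerPos
    rw [real_inner_smul_right, mul_max_of_nonneg _ _ hs.le, mul_zero]

theorem sublinear_innerNeg {n : ℕ} (v : E n) : Sublinear (innerNeg v) where
  add_le u w := by
    unfold innerNeg
    rw [inner_add_right, neg_add]
    exact max_le (add_le_add (le_max_left _ _) (le_max_left _ _))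
      (add_nonneg (le_max_right _ _) (le_max_right _ _))
  smul_eq s hs u := by
    unfold innerNeg
    rw [real_inner_smul_right, ← mul_neg, mul_max_of_nonneg _ _ hs.le, mul_zero]

theorem facetSum_nonneg {n : ℕ} (p : ℝ) (I : Set (E n)) {g : E n → E n → ℝ}
    (hg0 : ∀ v u, 0 ≤ g v u) (P : Polytope n) (u : E n) : 0 ≤ facetSum p I g P u :=
  finsum_nonneg fun v => finsum_nonneg fun _ => mul_nonneg
    (mul_nonneg measureReal_nonneg (Real.rpow_nonneg (abs_nonneg _) _))
    (Real.rpow_nonneg (hg0 v u) _)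

/-- The `p`-th root of the facet sum is sublinear, so it is a support function. -/
theorem sublinear_facetSum {n : ℕ} {p : ℝ} (hp : 1 < p) (I : Set (E n)) {g : E n → E n → ℝ}
    (hg : ∀ v, Sublinear (g v)) (hg0 : ∀ v u, 0 ≤ g v u) (P : Polytope n) :
    Sublinear fun u => facetSum p I g P u ^ (1 / p) := by
  have hp0 : p ≠ 0 := by linarith
  have hfin := (facetNormals_finite P).inter_of_left I
  set c : E n → ℝ := fun v =>
    faceVol (P : Set (E n)) v * |supportFn (P : Set (E n)) v| ^ (1 - p) with hc
  have hc0 : ∀ v, 0 ≤ c v := fun v =>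
    mul_nonneg measureReal_nonneg (Real.rpow_nonneg (abs_nonneg _) _)
  have hd0 : ∀ v, 0 ≤ c v ^ (1 / p) := fun v => Real.rpow_nonneg (hc0 v) _
  have heq : ∀ u, facetSum p I g P u = ∑ v ∈ hfin.toFinset, (c v ^ (1 / p) * g v u) ^ p := by
    intro u
    unfold facetSum
    rw [finsum_mem_eq_finite_toFinset_sum _ hfin]
    refine Finset.sum_congr rfl fun v _ => ?_
    rw [Real.mul_rpow (hd0 v) (hg0 v u), ← Real.rpow_mul (hc0 v), one_div_mul_cancel hp0,
      Real.rpow_one]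
  refine ⟨fun u w => ?_, fun s hs u => ?_⟩
  · simp only [heq]
    refine le_trans ?_ (Real.Lp_add_le_of_nonneg hfin.toFinset hp.le
      (fun v _ => mul_nonneg (hd0 v) (hg0 v u)) (fun v _ => mul_nonneg (hd0 v) (hg0 v w)))
    refine Real.rpow_le_rpow (Finset.sum_nonneg fun v _ =>
      Real.rpow_nonneg (mul_nonneg (hd0 v) (hg0 v _)) _) ?_ (by positivity)
    refine Finset.sum_le_sum fun v _ => Real.rpow_le_rpow (mul_nonneg (hd0 v) (hg0 v _)) ?_
      (by linarith)
    rw [← mul_add]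
    exact mul_le_mul_of_nonneg_left ((hg v).add_le u w) (hd0 v)
  · have h1 : facetSum p I g P (s • u) = s ^ p * facetSum p I g P u := by
      simp only [heq, Finset.mul_sum]
      refine Finset.sum_congr rfl fun v _ => ?_
      rw [(hg v).smul_eq s hs, mul_left_comm, Real.mul_rpow hs.le (mul_nonneg (hd0 v) (hg0 v u))]
    simp only [h1]
    rw [Real.mul_rpow (Real.rpow_nonneg hs.le _) (facetSum_nonneg p I hg0 P u),
      ← Real.rpow_mul hs.le, mul_one_div_cancel hp0, Real.rpow_one]

/-- The convex body `K` with `h(K, ·)^p` equal to the facet sum. -/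
def facetSumBody {n : ℕ} {p : ℝ} (hp : 1 < p) (I : Set (E n)) (g : E n → E n → ℝ)
    (hg : ∀ v, Sublinear (g v)) (hg0 : ∀ v u, 0 ≤ g v u) (P : Polytope n) : ConvexBody (E n) :=
  bodyOfSublinear (fun u => facetSum p I g P u ^ (1 / p)) (sublinear_facetSum hp I hg hg0 P)

theorem supportFn_facetSumBody_rpow {n : ℕ} {p : ℝ} (hp : 1 < p) (I : Set (E n))
    (g : E n → E n → ℝ) (hg : ∀ v, Sublinear (g v)) (hg0 : ∀ v u, 0 ≤ g v u) (P : Polytope n)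
    (u : E n) :
    supportFn (facetSumBody hp I g hg hg0 P : Set (E n)) u ^ p = facetSum p I g P u := by
  have hp0 : p ≠ 0 := by linarith
  unfold facetSumBody
  rw [supportFn_bodyOfSublinear, ← Real.rpow_mul (facetSum_nonneg p I hg0 P u),
    one_div_mul_cancel hp0, Real.rpow_one]

/-- `Π_p^{+,>}`: sum over the facet normals `v` with `h(P, v) > 0`, with `⟨v, ·⟩₊`. -/
def projBodyPosGt {n : ℕ} {p : ℝ} (hp : 1 < p) (P : Polytope n) : ConvexBody (E n) :=
  facetSumBody hp {v | 0 < supportFn (P : Set (E n)) v} innerPos sublinear_innerPos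
    (fun _ _ => le_max_right _ _) P

/-- `Π_p^{-,>}`: sum over the facet normals `v` with `h(P, v) > 0`, with `⟨v, ·⟩₋`. -/
def projBodyNegGt {n : ℕ} {p : ℝ} (hp : 1 < p) (P : Polytope n) : ConvexBody (E n) :=
  facetSumBody hp {v | 0 < supportFn (P : Set (E n)) v} innerNeg sublinear_innerNeg
    (fun _ _ => le_max_right _ _) P

/-- `Π_p^{+,<}`: sum over the facet normals `v` with `h(P, v) < 0`, with `⟨v, ·⟩₊`. -/
def projBodyPosLt {n : ℕ} {p : ℝ} (hp : 1 < p) (P : Polytope n) : ConvexBody (E n) :=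
  facetSumBody hp {v | supportFn (P : Set (E n)) v < 0} innerPos sublinear_innerPos
    (fun _ _ => le_max_right _ _) P

/-- `Π_p^{-,<}`: sum over the facet normals `v` with `h(P, v) < 0`, with `⟨v, ·⟩₋`. -/
def projBodyNegLt {n : ℕ} {p : ℝ} (hp : 1 < p) (P : Polytope n) : ConvexBody (E n) :=
  facetSumBody hp {v | supportFn (P : Set (E n)) v < 0} innerNeg sublinear_innerNeg
    (fun _ _ => le_max_right _ _) P

/-! ### Valuations and contravariance -/

/-- `C_p`: the continuous functions on `ℝⁿ` that are `p`-homogeneous. -/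
def Cp (n : ℕ) (p : ℝ) : Submodule ℝ C(E n, ℝ) where
  carrier := {f | ∀ s : ℝ, 0 < s → ∀ x, f (s • x) = s ^ p * f x}
  add_mem' := by
    intro f g hf hg s hs x
    simp only [ContinuousMap.add_apply, hf s hs x, hg s hs x, mul_add]
  zero_mem' := by
    intro s hs x
    simp
  smul_mem' := by
    intro c f hf s hs x
    simp only [ContinuousMap.smul_apply, hf s hs x, smul_eq_mul]
    ring

/-- `Φ(K ∪ L) + Φ(K ∩ L) = Φ(K) + Φ(L)` whenever `K`, `L`, `K ∪ L` and `K ∩ L` are polytopes. -/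
def IsValuation {n : ℕ} {A : Type*} [AddCommMonoid A] (Φ : Polytope n → A) : Prop :=
  ∀ K L U I : Polytope n, (U : Set (E n)) = (K : Set (E n)) ∪ (L : Set (E n)) →
    (I : Set (E n)) = (K : Set (E n)) ∩ (L : Set (E n)) → Φ U + Φ I = Φ K + Φ L

/-- `Φ(φ P) = Φ(P) ∘ φ⁻¹` for all polytopes `P` and all `φ ∈ SL(n)`. -/
def IsSLContravariant {n : ℕ} {p : ℝ} (Φ : Polytope n → Cp n p) : Prop :=
  ∀ (φ : Matrix.SpecialLinearGroup (Fin n) ℝ) (P : Polytope n) (x : E n),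
    (Φ (P.map (Matrix.toEuclideanLin (φ : Matrix (Fin n) (Fin n) ℝ))) : C(E n, ℝ)) x =
      (Φ P : C(E n, ℝ)) (Matrix.toEuclideanLin ((φ⁻¹ : Matrix.SpecialLinearGroup (Fin n) ℝ) :
        Matrix (Fin n) (Fin n) ℝ) x)

end LpVal

end

open LpVal

/-! Two valuations coincide once they agree on a family of polytopes that generates all others by
cutting. A polytope is a simplex cut by finitely many half-spaces, and such a cut can be followed by
bisecting edges, so a valuation that vanishes on simplices vanishes. Bisecting further, according to
the barycentric coordinates of the origin, leaves only hulls of linearly independent vectors, with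
or without the origin as an extra vertex (`IsValuation.eq_zero_of_linearIndependent`). The facet
sums are valuations because the faces of K, L, K ∪ L and K ∩ L can be compared one normal at a time.

Fewer than n vectors contribute nothing: suitable maps of determinant 1 double u while fixing or
halving the simplex, and homogeneity of degree p > 1 then forces the value 0
(`ContraValuation.pointedHull_eq_zero`). With n vectors the simplex is the image of the standard
one, pointed or not, under a map A with d = det A > 0, and by contravariance its value at A u is a
function G d u. Bisecting an edge splits d as sd + td and gives a functional equation for G. If two
coordinates of u vanish, it is Cauchy's equation in d; a nonlinear additive function has a dense
graph, which the density hypothesis excludes. For other u the equation merges two coordinates into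
their sum, so that G d u = d (a (∑ u)₊ᵖ + b (∑ u)₋ᵖ) by induction on the number of nonzero
coordinates (`BisectionEquation.exists_eq`).

This leaves two constants for each of the two kinds of simplices. On these simplices only the
hyperplane through the n vectors has nonzero support number ±h, and h times the facet volume is det
A times a universal constant. So the facet sums have the same form as G, and c₁, …, c₄ can be chosen
to match. -/

namespace LpVal

/-! ### Polytopes are finite intersections of half-spaces -/

section HalfSpaces

variable {V : Type*} [AddCommGroup V] [Module ℝ V]

/-- Fourier–Motzkin elimination: the sum of a ray and a polyhedral cone is polyhedral. -/
theorem exists_finite_cone_add_ray {L : Set (V →ₗ[ℝ] ℝ)} (hL : L.Finite) (x : V) :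
    ∃ L' : Set (V →ₗ[ℝ] ℝ), L'.Finite ∧
      ∀ y, (∀ f ∈ L', 0 ≤ f y) ↔ ∃ t : ℝ, 0 ≤ t ∧ ∀ f ∈ L, 0 ≤ f (y - t • x) := by
  -- For fixed y, a functional f bounds t from above by f y / f x if f x > 0 and from below if f x <
  -- 0. A suitable t exists iff each lower bound, 0 included, is at most each upper bound, and f y ≥
  -- 0 whenever f x = 0. Clearing denominators gives these functionals.
  refine ⟨{f ∈ L | 0 ≤ f x} ∪
    (fun q : (V →ₗ[ℝ] ℝ) × (V →ₗ[ℝ] ℝ) => q.1 x • q.2 - q.2 x • q.1) ''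
      ({f ∈ L | 0 < f x} ×ˢ {f ∈ L | f x < 0}),
    (hL.sep _).union (((hL.sep _).prod (hL.sep _)).image _), fun y => ⟨fun h => ?_, ?_⟩⟩
  -- `Lo` collects the lower bounds on t; its largest element serves as t.
  · set Lo : Set ℝ := insert 0 ((fun f : V →ₗ[ℝ] ℝ => f y / f x) '' {f ∈ L | f x < 0}) with hLo
    have hfin : Lo.Finite := ((hL.sep _).image _).insert 0
    obtain ⟨t, ht, hmax⟩ := hfin.exists_maximalFor id Lo ⟨0, mem_insert _ _⟩
    have hle : ∀ a ∈ Lo, a ≤ t := fun a ha => by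
      by_contra hlt
      exact hlt (hmax ha (not_le.1 hlt).le)
    refine ⟨t, hle 0 (mem_insert _ _), fun f hf => ?_⟩
    rw [map_sub, map_smul, smul_eq_mul]
    rcases lt_trichotomy (f x) 0 with h0 | h0 | h0
    · have := hle (f y / f x) (mem_insert_of_mem _ ⟨f, ⟨hf, h0⟩, rfl⟩)
      rw [div_le_iff_of_neg h0] at this
      linarith
    · rw [h0]
      have := h f (Or.inl ⟨hf, h0.ge⟩)
      linarith
    · rcases ht with rfl | ⟨g, ⟨hg, hg0⟩, rfl⟩
      · have := h f (Or.inl ⟨hf, h0.le⟩)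
        linarith
      · have := h _ (Or.inr ⟨(f, g), ⟨⟨hf, h0⟩, ⟨hg, hg0⟩⟩, rfl⟩)
        simp only [LinearMap.sub_apply, LinearMap.smul_apply, smul_eq_mul] at this
        have h1 : g y / g x * g x = g y := div_mul_cancel₀ _ hg0.ne
        have h2 : g x * (f y - g y / g x * f x) ≤ 0 := by
          calc g x * (f y - g y / g x * f x) = g x * f y - (g y / g x * g x) * f x := by ring
            _ ≤ 0 := by rw [h1]; linarith
        simp only
        by_contra hneg
        push Not at hneg
        have := mul_pos_of_neg_of_neg hg0 hneg
        linarith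
  · rintro ⟨t, ht, h⟩ f (⟨hf, hfx⟩ | ⟨⟨f, g⟩, ⟨⟨hf, hfx⟩, ⟨hg, hgx⟩⟩, rfl⟩)
    · have := h f hf
      rw [map_sub, map_smul, smul_eq_mul] at this
      have := mul_nonneg ht hfx
      linarith
    · have h1 := h f hf
      have h2 := h g hg
      rw [map_sub, map_smul, smul_eq_mul] at h1 h2
      simp only at hfx hgx
      simp only [LinearMap.sub_apply, LinearMap.smul_apply, smul_eq_mul]
      nlinarith [mul_nonneg hfx.le h2, mul_nonneg (neg_nonneg.2 hgx.le) h1]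

/-- A finitely generated cone is polyhedral. -/
theorem exists_finite_forall_nonneg_iff [FiniteDimensional ℝ V] (S : Finset V) :
    ∃ L : Set (V →ₗ[ℝ] ℝ), L.Finite ∧
      ∀ y, (∀ f ∈ L, 0 ≤ f y) ↔ ∃ c : V → ℝ, (∀ v ∈ S, 0 ≤ c v) ∧ ∑ v ∈ S, c v • v = y := by
  classical
  induction S using Finset.induction_on with
  | empty =>
    set b := Module.finBasis ℝ V
    refine ⟨Set.range b.coord ∪ Set.range (fun i => -b.coord i),
      (Set.finite_range _).union (Set.finite_range _), fun y => ⟨fun h => ?_, ?_⟩⟩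
    · refine ⟨0, by simp, ?_⟩
      rw [Finset.sum_empty, eq_comm, ← b.forall_coord_eq_zero_iff]
      intro i
      have h1 := h _ (Or.inl ⟨i, rfl⟩)
      have h2 := h _ (Or.inr ⟨i, rfl⟩)
      rw [LinearMap.neg_apply] at h2
      linarith
    · rintro ⟨c, -, rfl⟩ f -
      simp
  | insert x S hx ih =>
    obtain ⟨L, hL, hiff⟩ := ih
    obtain ⟨L', hL', hiff'⟩ := exists_finite_cone_add_ray hL x
    refine ⟨L', hL', fun y => (hiff' y).trans ⟨?_, ?_⟩⟩
    · rintro ⟨t, ht, h⟩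
      obtain ⟨c, hc, hsum⟩ := (hiff _).1 h
      refine ⟨Function.update c x t, ?_, ?_⟩
      · intro v hv
        rcases eq_or_ne v x with rfl | hvx
        · simpa using ht
        · rw [Function.update_of_ne hvx]
          exact hc v (Finset.mem_of_mem_insert_of_ne hv hvx)
      · rw [Finset.sum_insert hx, Function.update_self]
        have : ∑ v ∈ S, Function.update c x t v • v = ∑ v ∈ S, c v • v :=
          Finset.sum_congr rfl fun v hv => by
            rw [Function.update_of_ne (ne_of_mem_of_not_mem hv hx)]
        rw [this, hsum]
        abel
    · rintro ⟨c, hc, rfl⟩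
      refine ⟨c x, hc x (Finset.mem_insert_self _ _), (hiff _).2
        ⟨c, fun v hv => hc v (Finset.mem_insert_of_mem hv), ?_⟩⟩
      rw [Finset.sum_insert hx, add_sub_cancel_left]

/-- The convex hull of a finite set is a finite intersection of half-spaces. -/
theorem exists_finite_convexHull_eq [FiniteDimensional ℝ V] (S : Set V) (hS : S.Finite) :
    ∃ L : Set (V →ᵃ[ℝ] ℝ), L.Finite ∧ convexHull ℝ S = {x | ∀ f ∈ L, 0 ≤ f x} := by
  classical
  lift S to Finset V using hS
  -- Homogenization: x lies in the hull of S iff (x, 1) lies in the cone generated by the points (s,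
  -- 1).
  obtain ⟨L, hL, hiff⟩ := exists_finite_forall_nonneg_iff
    (S.image fun x : V => (x, (1 : ℝ)))
  refine ⟨(fun f : V × ℝ →ₗ[ℝ] ℝ =>
    (f ∘ₗ LinearMap.inl ℝ V ℝ).toAffineMap + AffineMap.const ℝ V (f (0, 1))) '' L,
    hL.image _, ?_⟩
  ext x
  have h1 : (∀ f ∈ (fun f : V × ℝ →ₗ[ℝ] ℝ =>
    (f ∘ₗ LinearMap.inl ℝ V ℝ).toAffineMap + AffineMap.const ℝ V (f (0, 1))) '' L, 0 ≤ f x) ↔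
      ∀ f ∈ L, 0 ≤ f (x, 1) := by
    rw [Set.forall_mem_image]
    refine forall₂_congr fun f _ => ?_
    have : f (x, 1) = f (x, 0) + f (0, 1) := by rw [← map_add]; simp
    rw [this]
    rfl
  rw [Set.mem_ofPred_eq, h1, hiff, Finset.mem_convexHull']
  have hinj : Set.InjOn (fun x : V => (x, (1 : ℝ))) S := fun a _ b _ h => by
    simpa using h
  constructor
  · rintro ⟨w, hw, hw1, hwx⟩
    refine ⟨fun q => w q.1, ?_, ?_⟩
    · simpa using hw
    · rw [Finset.sum_image hinj, Prod.ext_iff]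
      simp [Prod.fst_sum, Prod.snd_sum, hw1, hwx]
  · rintro ⟨c, hc, hsum⟩
    rw [Finset.sum_image hinj, Prod.ext_iff] at hsum
    simp only [Prod.smul_mk, smul_eq_mul, mul_one, Prod.fst_sum, Prod.snd_sum] at hsum
    exact ⟨fun v => c (v, 1), fun y hy => hc _ (Finset.mem_image_of_mem _ hy), hsum.2, hsum.1⟩

end HalfSpaces

/-! ### Bisecting an edge of a simplex -/

section Bisect

variable {V : Type*} [AddCommGroup V] [Module ℝ V]

theorem segment_union_segment {a b y : V} (hy : y ∈ segment ℝ a b) :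
    segment ℝ a b = segment ℝ y b ∪ segment ℝ a y := by
  apply Subset.antisymm
  · rw [segment_eq_image_lineMap] at hy
    obtain ⟨t, ht, rfl⟩ := hy
    intro z hz
    rw [segment_eq_image_lineMap] at hz
    obtain ⟨s, hs, rfl⟩ := hz
    rcases le_total t s with h | h
    · left
      have h1 : (AffineMap.lineMap a b s : V) ∈ AffineMap.lineMap a b '' segment ℝ t 1 :=
        ⟨s, by rw [segment_eq_Icc ht.2]; exact ⟨h, hs.2⟩, rfl⟩
      simpa [image_segment] using h1
    · right
      have h1 : (AffineMap.lineMap a b s : V) ∈ AffineMap.lineMap a b '' segment ℝ 0 t :=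
        ⟨s, by rw [segment_eq_Icc ht.1]; exact ⟨hs.1, h⟩, rfl⟩
      simpa [image_segment] using h1
  · exact union_subset ((convex_segment a b).segment_subset hy (right_mem_segment _ _ _))
      ((convex_segment a b).segment_subset (left_mem_segment _ _ _) hy)

/-- The hull is the join of the segment from a to b with the hull of R, and joins distribute over
unions. -/
theorem convexHull_insert_insert_eq_union {a b y : V} (hy : y ∈ segment ℝ a b) (R : Set V) :
    convexHull ℝ (insert a (insert b R)) =
      convexHull ℝ (insert y (insert b R)) ∪ convexHull ℝ (insert a (insert y R)) := by
  have key : ∀ c d : V, insert c (insert d R) = {c, d} ∪ R := fun c d => by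
    rw [insert_union, singleton_union]
  simp only [key]
  rcases R.eq_empty_or_nonempty with rfl | hR
  · simp only [union_empty, convexHull_pair]
    exact segment_union_segment hy
  · simp only [convexHull_union (insert_nonempty _ _) hR, convexHull_pair]
    rw [segment_union_segment hy, convexJoin_union_left]

theorem convexHull_insert_inter_nonneg_subset {b : V} {S : Set V} (g : V →ᵃ[ℝ] ℝ)
    (hb : g b < 0) (hS : ∀ s ∈ S, g s ≤ 0) :
    convexHull ℝ (insert b S) ∩ {z | 0 ≤ g z} ⊆ convexHull ℝ S := by
  rintro z ⟨hz, hgz⟩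
  rcases S.eq_empty_or_nonempty with rfl | hne
  · simp only [insert_empty_eq, convexHull_singleton, mem_singleton_iff] at hz
    rw [hz] at hgz
    exact absurd hgz (not_le.2 hb)
  · rw [convexHull_insert hne, convexJoin_singleton_left] at hz
    simp only [mem_iUnion] at hz
    obtain ⟨s, hs, a, c, ha, hc, hac, rfl⟩ := hz
    have hgs : g s ≤ 0 := (convexHull_min (t := g ⁻¹' Iic 0) (fun s hs => hS s hs)
      ((convex_Iic _).affine_preimage g)) hs
    rw [mem_ofPred_eq, Convex.combo_affine_apply hac, smul_eq_mul, smul_eq_mul] at hgz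
    have ha0 : a = 0 := by
      by_contra hne
      have h1 := mul_neg_of_pos_of_neg (lt_of_le_of_ne ha (Ne.symm hne)) hb
      have h2 := mul_nonpos_of_nonneg_of_nonpos hc hgs
      linarith
    rw [ha0, zero_add] at hac
    rwa [ha0, hac, zero_smul, zero_add, one_smul]

/-- The hyperplane g = 0 contains y and R and separates a from b. The piece containing a lies in g ≥
0, where the other piece can put no weight on b. -/
theorem convexHull_insert_insert_inter {a b y : V} {R : Set V} (g : V →ᵃ[ℝ] ℝ)
    (ha : 0 ≤ g a) (hb : g b < 0) (hy : g y = 0) (hR : ∀ r ∈ R, g r = 0) :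
    convexHull ℝ (insert y R) =
      convexHull ℝ (insert y (insert b R)) ∩ convexHull ℝ (insert a (insert y R)) := by
  apply Subset.antisymm
  · exact subset_inter (convexHull_mono (insert_subset_insert (subset_insert _ _)))
      (convexHull_mono (subset_insert _ _))
  · have hyR : ∀ r ∈ insert y R, g r = 0 := by
      rintro r (rfl | hr)
      exacts [hy, hR r hr]
    refine Subset.trans ?_ (convexHull_insert_inter_nonneg_subset (b := b) g hb
      fun r hr => (hyR r hr).le)
    rw [insert_comm y b]
    refine inter_subset_inter_right _ (convexHull_min (t := g ⁻¹' Ici 0) ?_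
      ((convex_Ici _).affine_preimage g))
    rintro r (rfl | hr)
    exacts [ha, (hyR r hr).ge]

theorem affineIndependent_iff_fintype {ι : Type*} [Fintype ι] {x : ι → V} :
    AffineIndependent ℝ x ↔
      ∀ w : ι → ℝ, ∑ i, w i = 0 → ∑ i, w i • x i = 0 → ∀ i, w i = 0 := by
  rw [affineIndependent_iff_of_fintype]
  refine forall₂_congr fun w hw => ?_
  rw [Finset.univ.weightedVSub_eq_linear_combination hw]

theorem range_eq_insert_insert {α ι : Type*} (x : ι → α) (i j : ι) :
    range x = insert (x i) (insert (x j) (x '' {k | k ≠ i ∧ k ≠ j})) := by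
  ext z
  simp only [mem_range, mem_insert_iff, mem_image, mem_ofPred_eq]
  constructor
  · rintro ⟨k, rfl⟩
    by_cases h1 : k = i
    · simp [h1]
    · by_cases h2 : k = j
      · simp [h2]
      · exact Or.inr (Or.inr ⟨k, ⟨h1, h2⟩, rfl⟩)
  · rintro (rfl | rfl | ⟨k, -, rfl⟩)
    exacts [⟨_, rfl⟩, ⟨_, rfl⟩, ⟨_, rfl⟩]

theorem image_update_of_notMem {α ι : Type*} [DecidableEq ι] (x : ι → α) {i : ι} {s : Set ι}
    (hi : i ∉ s) (y : α) : Function.update x i y '' s = x '' s :=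
  image_congr fun _ hk => Function.update_of_ne (ne_of_mem_of_not_mem hk hi) _ _

theorem range_update_left {α ι : Type*} [DecidableEq ι] (x : ι → α) {i j : ι} (hij : i ≠ j)
    (y : α) : range (Function.update x i y) =
      insert y (insert (x j) (x '' {k | k ≠ i ∧ k ≠ j})) := by
  rw [range_eq_insert_insert _ i j, Function.update_self, Function.update_of_ne hij.symm,
    image_update_of_notMem _ (by simp)]

theorem range_update_right {α ι : Type*} [DecidableEq ι] (x : ι → α) {i j : ι} (hij : i ≠ j)
    (y : α) : range (Function.update x j y) =
      insert (x i) (insert y (x '' {k | k ≠ i ∧ k ≠ j})) := by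
  rw [range_eq_insert_insert _ i j, Function.update_self, Function.update_of_ne hij,
    image_update_of_notMem _ (by simp)]

theorem range_update_subtype_ne {α ι : Type*} [DecidableEq ι] (x : ι → α) {i j : ι} (hij : i ≠ j)
    (y : α) : range (fun k : {k // k ≠ j} => Function.update x i y k) =
      insert y (x '' {k | k ≠ i ∧ k ≠ j}) := by
  ext z
  simp only [mem_range, mem_insert_iff, mem_image, mem_ofPred_eq, Subtype.exists]
  constructor
  · rintro ⟨k, hk, rfl⟩
    by_cases h1 : k = i
    · simp [h1]
    · exact Or.inr ⟨k, ⟨h1, hk⟩, by simp [h1]⟩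
  · rintro (rfl | ⟨k, ⟨h1, h2⟩, rfl⟩)
    exacts [⟨i, hij, by simp⟩, ⟨k, h2, by simp [h1]⟩]

theorem affineIndependent_update_edge {ι : Type*} [Fintype ι] [DecidableEq ι] {x : ι → V}
    (hx : AffineIndependent ℝ x) {i j : ι} (hij : i ≠ j) {s t : ℝ} (hs : s ≠ 0) (hst : s + t = 1) :
    AffineIndependent ℝ (Function.update x i (s • x i + t • x j)) := by
  rw [affineIndependent_iff_fintype] at hx ⊢
  intro w hw hwx
  -- The same combination, rewritten in the old vertices: the weight of the new vertex is split as s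
  -- to x i and t to x j.
  have key := hx (fun k => w k + w i * ((if k = i then s - 1 else 0) + if k = j then t else 0))
    ?_ ?_
  · have hi : w i = 0 := by
      have := key i
      rw [if_pos rfl, if_neg hij] at this
      have h2 : w i * s = 0 := by linarith
      exact (mul_eq_zero.1 h2).resolve_right hs
    intro k
    have := key k
    rwa [hi, zero_mul, add_zero] at this
  · rw [Finset.sum_add_distrib, hw, ← Finset.mul_sum, Finset.sum_add_distrib]
    simp only [Finset.sum_ite_eq', Finset.mem_univ, if_true]
    rw [show s - 1 + t = 0 by linarith]
    ring
  · rw [← hwx]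
    have h2 : ∀ k, (w k + w i * ((if k = i then s - 1 else 0) + if k = j then t else 0)) • x k =
        w k • x k + ((w i * (s - 1)) • (if k = i then x k else 0)
          + (w i * t) • (if k = j then x k else 0)) := by
      intro k
      by_cases h1 : k = i <;> by_cases h2 : k = j <;>
        simp [h1, h2, add_smul, mul_add]
    have h3 : ∀ k, w k • Function.update x i (s • x i + t • x j) k =
        w k • x k + (if k = i then w k • ((s - 1) • x i + t • x j) else 0) := by
      intro k
      rcases eq_or_ne k i with rfl | hk
      · simp only [Function.update_self, if_true]
        rw [← smul_add, sub_smul, one_smul]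
        congr 1
        abel
      · simp [hk]
    simp only [h2, h3, Finset.sum_add_distrib, ← Finset.smul_sum, Finset.sum_ite_eq',
      Finset.mem_univ, if_true]
    rw [smul_add, smul_smul, smul_smul]

/-- A barycentric coordinate, defined on the whole space after completing x to an affine basis. -/
theorem AffineIndependent.exists_affineMap [FiniteDimensional ℝ V] {ι : Type*}
    [DecidableEq ι] {x : ι → V} (hx : AffineIndependent ℝ x) (i : ι) :
    ∃ g : V →ᵃ[ℝ] ℝ, ∀ k, g (x k) = if k = i then 1 else 0 := by
  obtain ⟨T, hT, hTi, hspan⟩ := exists_subset_affineIndependent_affineSpan_eq_top hx.range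
  let B : AffineBasis T ℝ V := ⟨((↑) : T → V), hTi, by rwa [Subtype.range_coe]⟩
  classical
  refine ⟨B.coord ⟨x i, hT ⟨i, rfl⟩⟩, fun k => ?_⟩
  have h1 : x k = B ⟨x k, hT ⟨k, rfl⟩⟩ := rfl
  conv_lhs => rw [h1]
  rw [B.coord_apply]
  simp only [Subtype.mk.injEq, hx.injective.eq_iff, eq_comm]

/-- Cutting a simplex through a point of an edge and all the vertices off that edge. -/
theorem AffineIndependent.bisect [FiniteDimensional ℝ V] {ι : Type*} [Fintype ι] [DecidableEq ι]
    {x : ι → V} (hx : AffineIndependent ℝ x) {i j : ι} (hij : i ≠ j) {s t : ℝ} (hs : 0 < s)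
    (ht : 0 < t) (hst : s + t = 1) {y : V} (hy : y = s • x i + t • x j) :
    AffineIndependent ℝ (Function.update x i y) ∧ AffineIndependent ℝ (Function.update x j y) ∧
    convexHull ℝ (range x) = convexHull ℝ (range (Function.update x i y)) ∪
      convexHull ℝ (range (Function.update x j y)) ∧
    convexHull ℝ (range fun k : {k // k ≠ j} => Function.update x i y k) =
      convexHull ℝ (range (Function.update x i y)) ∩
        convexHull ℝ (range (Function.update x j y)) := by
  refine ⟨?_, ?_, ?_, ?_⟩
  · rw [hy]
    exact affineIndependent_update_edge hx hij hs.ne' hst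
  · rw [hy, add_comm]
    exact affineIndependent_update_edge hx hij.symm ht.ne' (by linarith)
  · rw [range_update_left x hij, range_update_right x hij, range_eq_insert_insert x i j]
    exact convexHull_insert_insert_eq_union ⟨s, t, hs.le, ht.le, hst, hy.symm⟩ _
  · rw [range_update_left x hij, range_update_right x hij, range_update_subtype_ne x hij]
    obtain ⟨g, hg⟩ := hx.exists_affineMap i
    obtain ⟨h, hh⟩ := hx.exists_affineMap j
    -- The cutting hyperplane: in barycentric coordinates this map is t at x i, -s at x j, and 0 at
    -- y and at the other vertices.
    refine convexHull_insert_insert_inter (t • g - s • h) ?_ ?_ ?_ ?_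
    · simp [hg, hh, hij, ht.le]
    · simp [hg, hh, hij.symm, hs]
    · have h1 : ∀ g : V →ᵃ[ℝ] ℝ, g y = s * g (x i) + t * g (x j) := fun g => by
        rw [hy, Convex.combo_affine_apply hst, smul_eq_mul, smul_eq_mul]
      rw [h1]
      simp [hg, hh, hij, hij.symm]
      ring
    · rintro _ ⟨k, ⟨hk1, hk2⟩, rfl⟩
      simp [hg, hh, hk1, hk2]

end Bisect

/-! ### Valuations are determined by their values on simplices -/

section Null

variable {n : ℕ}

theorem Polytope.ext_carrier {P Q : Polytope n} (h : P.carrier = Q.carrier) : P = Q := by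
  cases P
  cases Q
  cases h
  rfl

theorem Polytope.convex (P : Polytope n) : Convex ℝ P.carrier := by
  obtain ⟨S, -, -, hS⟩ := P.exists_finite'
  rw [hS]
  exact convex_convexHull ℝ S

theorem Polytope.isCompact (P : Polytope n) : IsCompact P.carrier := by
  obtain ⟨S, hfin, -, hS⟩ := P.exists_finite'
  rw [hS]
  exact hfin.isCompact_convexHull ℝ

theorem Polytope.nonempty (P : Polytope n) : P.carrier.Nonempty := by
  obtain ⟨S, -, hne, hS⟩ := P.exists_finite'
  rw [hS]
  exact hne.convexHull

/-- A convex set is connected, so it is not a disjoint union of two nonempty closed sets. Hence the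
intersection in the valuation identity is a legitimate argument. -/
theorem inter_nonempty_of_convex_union {K L : Set (E n)} (hK : IsClosed K) (hL : IsClosed L)
    (hKn : K.Nonempty) (hLn : L.Nonempty) (hU : Convex ℝ (K ∪ L)) : (K ∩ L).Nonempty := by
  obtain ⟨z, -, hz⟩ := isPreconnected_closed_iff.1 hU.isPreconnected K L hK hL Subset.rfl
    (hKn.mono fun x hx => ⟨Or.inl hx, hx⟩) (hLn.mono fun x hx => ⟨Or.inr hx, hx⟩)
  exact ⟨z, hz⟩

/-- The union of two polytopes, if convex, is a polytope. -/
theorem Polytope.exists_union (P Q : Polytope n) (h : Convex ℝ (P.carrier ∪ Q.carrier)) :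
    ∃ U : Polytope n, U.carrier = P.carrier ∪ Q.carrier := by
  obtain ⟨S, hS, hSn, hP⟩ := P.exists_finite'
  obtain ⟨T, hT, -, hQ⟩ := Q.exists_finite'
  refine ⟨Polytope.hull (S ∪ T) (hS.union hT) (hSn.mono subset_union_left), ?_⟩
  change convexHull ℝ (S ∪ T) = _
  apply Subset.antisymm
  · refine convexHull_min ?_ h
    rw [hP, hQ]
    exact union_subset_union (subset_convexHull ℝ S) (subset_convexHull ℝ T)
  · rw [hP, hQ]
    exact union_subset (convexHull_mono subset_union_left) (convexHull_mono subset_union_right)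

/-- `K` is empty, or a polytope at which `Z` vanishes. -/
def NullAt (Z : Polytope n → ℝ) (K : Set (E n)) : Prop :=
  K = ∅ ∨ ∃ P : Polytope n, P.carrier = K ∧ Z P = 0

theorem NullAt.isClosed {Z : Polytope n → ℝ} {K : Set (E n)} (h : NullAt Z K) : IsClosed K := by
  rcases h with rfl | ⟨P, rfl, -⟩
  exacts [isClosed_empty, P.isCompact.isClosed]

theorem NullAt.eq_zero {Z : Polytope n → ℝ} {P : Polytope n} (h : NullAt Z P.carrier) :
    Z P = 0 := by
  rcases h with h | ⟨Q, hQ, hZ⟩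
  · exact absurd h P.nonempty.ne_empty
  · rwa [← Polytope.ext_carrier hQ]

theorem NullAt.union {Z : Polytope n → ℝ} (hZ : IsValuation Z) {K L : Set (E n)}
    (hK : NullAt Z K) (hL : NullAt Z L) (hI : NullAt Z (K ∩ L)) (hU : Convex ℝ (K ∪ L)) :
    NullAt Z (K ∪ L) := by
  have hKc := hK.isClosed
  have hLc := hL.isClosed
  rcases hK with rfl | ⟨P, rfl, hP⟩
  · rwa [empty_union]
  rcases hL with rfl | ⟨Q, rfl, hQ⟩
  · rw [union_empty]
    exact Or.inr ⟨P, rfl, hP⟩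
  have hne := inter_nonempty_of_convex_union hKc hLc P.nonempty Q.nonempty hU
  rcases hI with h | ⟨I, hI, hI0⟩
  · exact absurd h hne.ne_empty
  obtain ⟨U, hU⟩ := P.exists_union Q hU
  refine Or.inr ⟨U, hU, ?_⟩
  have := hZ P Q U I hU hI
  linarith

open Classical in
/-- If `Z` vanishes at the intersections of all simplices with `C`, then so it does after cutting
`C` with a half-space. -/
theorem nullAt_simplex_inter_halfSpace {Z : Polytope n → ℝ} (hZ : IsValuation Z) {C : Set (E n)}
    (hC : Convex ℝ C)
    (h : ∀ (ι : Type) [Fintype ι] (x : ι → E n), AffineIndependent ℝ x →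
      NullAt Z (convexHull ℝ (range x) ∩ C)) (f : E n →ᵃ[ℝ] ℝ) (N : ℕ) :
    ∀ (ι : Type) [Fintype ι] (x : ι → E n), AffineIndependent ℝ x →
      Fintype.card ι + (Finset.univ.filter fun k => f (x k) ≠ 0).card ≤ N →
      NullAt Z (convexHull ℝ (range x) ∩ ({z | 0 ≤ f z} ∩ C)) := by
  -- If an edge crosses f = 0, it is bisected at the crossing point: each half has one more vertex
  -- on the hyperplane, and the common facet has one vertex fewer, so the bound drops. If no edge
  -- crosses, either the half-space is redundant or only the face of the simplex in f = 0 survives.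
  induction N with
  | zero =>
    intro ι _ x hx hN
    have : IsEmpty ι := Fintype.card_eq_zero_iff.1 (by omega)
    rw [range_eq_empty, convexHull_empty, empty_inter]
    exact Or.inl rfl
  | succ N ih =>
    intro ι _ x hx hN
    by_cases hpos : ∃ i, 0 < f (x i)
    swap
    · push Not at hpos
      have hsub : convexHull ℝ (range x) ∩ ({z | 0 ≤ f z} ∩ C) =
          convexHull ℝ (range fun k : {k // f (x k) = 0} => x k) ∩ C := by
        rw [← inter_assoc]
        congr 1
        apply Subset.antisymm
        -- The vertices with f < 0 are removed one at a time.
        · have key : ∀ s : Finset ι, (∀ k ∈ s, f (x k) < 0) →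
              convexHull ℝ (x '' s ∪ x '' {k | f (x k) = 0}) ∩ {z | 0 ≤ f z} ⊆
                convexHull ℝ (x '' {k | f (x k) = 0}) := by
            intro s
            induction s using Finset.induction_on with
            | empty => intro _; simp
            | insert b s _ ihs =>
              intro hs z hz
              refine ihs (fun k hk => hs k (Finset.mem_insert_of_mem hk)) ⟨?_, hz.2⟩
              refine convexHull_insert_inter_nonneg_subset f (hs b (Finset.mem_insert_self _ _)) ?_ ⟨?_, hz.2⟩
              · rintro _ (⟨k, -, rfl⟩ | ⟨k, -, rfl⟩) <;> exact hpos k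
              · rw [← insert_union, ← image_insert_eq, ← Finset.coe_insert]
                exact hz.1
          have h1 := key (Finset.univ.filter fun k => f (x k) < 0) (by simp)
          refine Subset.trans (inter_subset_inter_left _ (convexHull_mono ?_))
            (h1.trans (convexHull_mono ?_))
          · rintro _ ⟨k, rfl⟩
            rcases (hpos k).lt_or_eq with hk | hk
            · exact Or.inl ⟨k, by simpa using hk, rfl⟩
            · exact Or.inr ⟨k, hk, rfl⟩
          · rintro _ ⟨k, hk, rfl⟩
            exact ⟨⟨k, hk⟩, rfl⟩
        · refine subset_inter (convexHull_mono ?_) (convexHull_min (t := f ⁻¹' Ici 0) ?_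
            ((convex_Ici _).affine_preimage f))
          · rintro _ ⟨k, rfl⟩
            exact ⟨k, rfl⟩
          · rintro _ ⟨k, rfl⟩
            exact k.2.ge
      rw [hsub]
      exact h _ _ (hx.subtype {k | f (x k) = 0})
    by_cases hneg : ∃ j, f (x j) < 0
    swap
    · push Not at hneg
      have : convexHull ℝ (range x) ⊆ {z | 0 ≤ f z} :=
        convexHull_min (t := f ⁻¹' Ici 0) (by rintro _ ⟨k, rfl⟩; exact hneg k)
          ((convex_Ici _).affine_preimage f)
      rw [← inter_assoc, inter_eq_left.2 this]
      exact h ι x hx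
    obtain ⟨i, hi⟩ := hpos
    obtain ⟨j, hj⟩ := hneg
    have hij : i ≠ j := by
      rintro rfl
      exact lt_asymm hi hj
    have hd : 0 < f (x i) - f (x j) := by linarith
    set s := -f (x j) / (f (x i) - f (x j)) with hs
    set t := f (x i) / (f (x i) - f (x j)) with ht
    have hst : s + t = 1 := by rw [hs, ht]; field_simp; ring
    obtain ⟨h1, h2, hU, hI⟩ := hx.bisect hij (div_pos (neg_pos.2 hj) hd) (div_pos hi hd) hst rfl
    rw [← hs, ← ht] at h1 h2 hU hI
    set y := s • x i + t • x j with hy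
    have hfy : f y = 0 := by
      rw [hy, Convex.combo_affine_apply hst, smul_eq_mul, smul_eq_mul, hs, ht]
      field_simp
      ring
    have hcard : ∀ k, f (x k) ≠ 0 →
        (Finset.univ.filter fun l => f (Function.update x k y l) ≠ 0).card <
          (Finset.univ.filter fun l => f (x l) ≠ 0).card := by
      intro k hk
      refine Finset.card_lt_card ⟨fun l hl => ?_, fun hsub => ?_⟩
      · simp only [Finset.mem_filter, Finset.mem_univ, true_and] at hl ⊢
        rcases eq_or_ne l k with rfl | hlk
        · exact hk
        · rwa [Function.update_of_ne hlk] at hl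
      · have := hsub (Finset.mem_filter.2 ⟨Finset.mem_univ k, hk⟩)
        simp [hfy] at this
    have n1 := ih ι _ h1 (by have := hcard i hi.ne'; omega)
    have n2 := ih ι _ h2 (by have := hcard j hj.ne; omega)
    have n3 := ih {k // k ≠ j} _ (h1.subtype {k | k ≠ j}) (by
      have hc1 : Fintype.card {k // k ≠ j} < Fintype.card ι :=
        Fintype.card_subtype_lt (x := j) (by simp)
      have hc2 : (Finset.univ.filter fun k : {k // k ≠ j} =>
          f (Function.update x i y k) ≠ 0).card ≤
            (Finset.univ.filter fun l => f (Function.update x i y l) ≠ 0).card :=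
        Finset.card_le_card_of_injOn Subtype.val (fun k hk => by simpa using hk)
          Subtype.val_injective.injOn
      have := hcard i hi.ne'
      change Fintype.card {k // k ≠ j} + (Finset.univ.filter fun k : {k // k ≠ j} =>
        f (Function.update x i y k) ≠ 0).card ≤ N
      omega)
    have hconv : Convex ℝ (convexHull ℝ (range x) ∩ ({z | 0 ≤ f z} ∩ C)) :=
      (convex_convexHull ℝ _).inter (((convex_Ici (0 : ℝ)).affine_preimage f).inter hC)
    rw [hU, union_inter_distrib_right] at hconv ⊢
    refine n1.union hZ n2 ?_ hconv
    rw [← inter_inter_distrib_right, ← hI]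
    exact n3

-- A simplex with the origin in its interior contains a ball of radius ε; dilating it by R / ε makes
-- it swallow the ball of radius R around S.
open scoped Pointwise in
theorem exists_affineIndependent_subset_convexHull {S : Set (E n)} (hS : S.Finite) :
    ∃ (m : ℕ) (x : Fin m → E n), AffineIndependent ℝ x ∧ S ⊆ convexHull ℝ (range x) := by
  obtain ⟨b, hb, -⟩ :=
    exists_mem_interior_convexHull_affineBasis (Filter.univ_mem (f := nhds (0 : E n)))
  obtain ⟨ε, hε, hball⟩ := Metric.mem_nhds_iff.1 (mem_interior_iff_mem_nhds.1 hb)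
  obtain ⟨R, hR, hSR⟩ := hS.isBounded.subset_ball_lt 0 (0 : E n)
  have hr : 0 < R / ε := div_pos hR hε
  refine ⟨_, fun k => (R / ε) • b k, ?_, ?_⟩
  · have hb' := affineIndependent_iff_fintype.1 b.ind
    refine affineIndependent_iff_fintype.2 fun w hw hwx => hb' w hw ?_
    simp only [smul_comm (w _), ← Finset.smul_sum] at hwx
    exact (smul_eq_zero.1 hwx).resolve_left hr.ne'
  · have hrange : range (fun k => (R / ε) • b k) = (R / ε) • range b := by
      rw [← image_smul, ← range_comp]
      rfl
    rw [hrange, convexHull_smul]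
    intro z hz
    refine (mem_smul_set_iff_inv_smul_mem₀ hr.ne' _ _).2 (hball ?_)
    have := mem_ball_zero_iff.1 (hSR hz)
    rw [mem_ball_zero_iff, norm_smul, norm_inv, Real.norm_of_nonneg hr.le, inv_div, div_mul_eq_mul_div,
      div_lt_iff₀ hR]
    exact mul_lt_mul_of_pos_left this hε

/-- A valuation that vanishes at all simplices vanishes. -/
theorem IsValuation.eq_zero_of_simplices {Z : Polytope n → ℝ} (hZ : IsValuation Z)
    (h : ∀ (ι : Type) [Fintype ι] (x : ι → E n), AffineIndependent ℝ x →
      NullAt Z (convexHull ℝ (range x))) (P : Polytope n) : Z P = 0 := by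
  classical
  obtain ⟨S, hS, -, hP⟩ := P.exists_finite'
  obtain ⟨L, hL, hLS⟩ := exists_finite_convexHull_eq S hS
  -- The polytope is recovered from a large simplex by imposing its defining inequalities one after
  -- another.
  have key : ∀ (ι : Type) [Fintype ι] (x : ι → E n), AffineIndependent ℝ x →
      NullAt Z (convexHull ℝ (range x) ∩ {z | ∀ f ∈ L, 0 ≤ f z}) := by
    clear hLS
    induction L, hL using Set.Finite.induction_on with
    | empty => simpa using h
    | @insert f L _ _ ih =>
      have hset : {z : E n | ∀ g ∈ insert f L, 0 ≤ g z} =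
          {z | 0 ≤ f z} ∩ {z | ∀ g ∈ L, 0 ≤ g z} := by
        ext z
        simp
      intro ι _ x hx
      rw [hset]
      refine nullAt_simplex_inter_halfSpace hZ ?_ ih f _ ι x hx le_rfl
      simp only [ofPred_forall]
      exact convex_iInter₂ fun g _ => (convex_Ici (0 : ℝ)).affine_preimage g
  obtain ⟨m, x, hx, hSx⟩ := exists_affineIndependent_subset_convexHull hS
  have := key (Fin m) x hx
  rw [← hLS, inter_eq_right.2 (convexHull_min hSx (convex_convexHull ℝ _)), ← hP] at this
  exact this.eq_zero

end Null

/-! ### Reduction to simplices positioned relative to the origin. -/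

section Radial

variable {n : ℕ}

/-- Counterpart of `NullAt.union`: the valuation identity is solved for one of the pieces instead of
the union. -/
theorem NullAt.of_union {Z : Polytope n → ℝ} (hZ : IsValuation Z) {U K L : Set (E n)}
    (hU : NullAt Z U) (hL : NullAt Z L) (hI : NullAt Z (K ∩ L)) (hK : ∃ P : Polytope n, P.carrier = K)
    (hUKL : U = K ∪ L) : NullAt Z K := by
  obtain ⟨P, rfl⟩ := hK
  refine Or.inr ⟨P, rfl, ?_⟩
  have hconv : Convex ℝ (P.carrier ∪ L) := by
    rw [← hUKL]
    rcases hU with rfl | ⟨Q, rfl, -⟩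
    exacts [convex_empty, Q.convex]
  rcases hU with hU | ⟨U, rfl, hU0⟩
  · exact absurd (hUKL ▸ hU) (P.nonempty.mono subset_union_left).ne_empty
  rcases hL with rfl | ⟨Q, rfl, hQ⟩
  · rw [union_empty] at hUKL
    rwa [← Polytope.ext_carrier hUKL]
  have hne := inter_nonempty_of_convex_union P.isCompact.isClosed Q.isCompact.isClosed
    P.nonempty Q.nonempty hconv
  rcases hI with h | ⟨I, hI, hI0⟩
  · exact absurd h hne.ne_empty
  have := hZ P Q U I hUKL hI
  linarith

/-- A linear relation with nonzero coefficient sum could be normalized to write the origin as an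
affine combination; a relation with coefficient sum zero is excluded by affine independence. -/
theorem linearIndependent_of_affineIndependent {ι : Type*} [Fintype ι] {x : ι → E n}
    (hx : AffineIndependent ℝ x)
    (h : ¬ ∃ l : ι → ℝ, ∑ k, l k = 1 ∧ ∑ k, l k • x k = 0) : LinearIndependent ℝ x := by
  rw [Fintype.linearIndependent_iff]
  intro c hc
  refine affineIndependent_iff_fintype.1 hx c ?_ hc
  by_contra hne
  refine h ⟨fun k => (∑ k, c k)⁻¹ * c k, ?_, ?_⟩
  · rw [← Finset.mul_sum, inv_mul_cancel₀ hne]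
  · simp only [mul_smul, ← Finset.smul_sum, hc, smul_zero]

theorem exists_polytope_convexHull_range {ι : Type*} [Finite ι] (x : ι → E n) (i : ι) :
    ∃ P : Polytope n, P.carrier = convexHull ℝ (range x) :=
  ⟨Polytope.hull (range x) (finite_range x) ⟨_, i, rfl⟩, rfl⟩

theorem range_eq_insert {α ι : Type*} (x : ι → α) (i : ι) :
    range x = insert (x i) (range fun k : {k // k ≠ i} => x k) := by
  ext z
  simp only [mem_range, mem_insert_iff, Subtype.exists]
  constructor
  · rintro ⟨k, rfl⟩
    by_cases h1 : k = i
    · simp [h1]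
    · exact Or.inr ⟨k, h1, rfl⟩
  · rintro (rfl | ⟨k, -, rfl⟩)
    exacts [⟨_, rfl⟩, ⟨_, rfl⟩]

/-- Replacing a vertex `x i` by the origin, where the origin is an affine combination of the
vertices in which `x i` occurs. -/
theorem affineIndependent_update_zero {ι : Type*} [Fintype ι] [DecidableEq ι] {x : ι → E n}
    (hx : AffineIndependent ℝ x) {l : ι → ℝ} (hl : ∑ k, l k = 1) (hlx : ∑ k, l k • x k = 0) {i : ι}
    (hi : l i ≠ 0) : AffineIndependent ℝ (Function.update x i 0) := by
  rw [affineIndependent_iff_fintype] at hx ⊢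
  intro w hw hwx
  -- The weight of the new vertex 0 is distributed over the old vertices by 0 = ∑ l k • x k.
  have key := hx (fun k => (if k = i then 0 else w k) + w i * l k) ?_ ?_
  · have h1 : w i = 0 := by
      have := key i
      rw [if_pos rfl, zero_add] at this
      exact (mul_eq_zero.1 this).resolve_right hi
    intro k
    have := key k
    rw [h1, zero_mul, add_zero] at this
    split_ifs at this with hk
    exacts [hk ▸ h1, this]
  · have h1 : ∀ k, (if k = i then 0 else w k) = w k - if k = i then w k else 0 := by
      intro k
      split_ifs <;> simp
    simp only [h1, Finset.sum_add_distrib, Finset.sum_sub_distrib, hw, ← Finset.mul_sum, hl,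
      Finset.sum_ite_eq', Finset.mem_univ, if_true]
    ring
  · have h1 : ∀ k, (if k = i then 0 else w k) • x k = w k • Function.update x i 0 k := by
      intro k
      rcases eq_or_ne k i with rfl | hk
      · simp
      · simp [hk]
    simp only [add_smul, h1, mul_smul, Finset.sum_add_distrib, hwx, ← Finset.smul_sum, hlx,
      smul_zero, add_zero]

theorem linearIndependent_subtype_ne_of_zero {ι : Type*} [Fintype ι] {x : ι → E n}
    (hx : AffineIndependent ℝ x) {i : ι} (hi : x i = 0) :
    LinearIndependent ℝ (fun k : {k // k ≠ i} => x k) := by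
  have := (affineIndependent_iff_linearIndependent_vsub ℝ x i).1 hx
  simpa [hi] using this

open Classical in
/-- Merging two vertices with weights of the same sign in an affine combination. -/
theorem exists_merge_weights {ι : Type*} [Fintype ι] (x : ι → E n) {l : ι → ℝ}
    (hl : ∑ k, l k = 1) (hlx : ∑ k, l k • x k = 0) {i j : ι} (hij : i ≠ j) (hlij : 0 < l i * l j)
    {y : E n} (hy : (l i + l j) • y = l i • x i + l j • x j) :
    ∃ m : ι → ℝ, ∑ k, m k = 1 ∧ ∑ k, m k • Function.update x i y k = 0 ∧ m j = 0 ∧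
      (Finset.univ.filter fun k => m k ≠ 0).card < (Finset.univ.filter fun k => l k ≠ 0).card := by
  have hi : l i ≠ 0 := fun h => by simp [h] at hlij
  have hj : l j ≠ 0 := fun h => by simp [h] at hlij
  refine ⟨fun k => l k + ((if k = i then l j else 0) - if k = j then l j else 0), ?_, ?_, ?_, ?_⟩
  · simp [Finset.sum_add_distrib, Finset.sum_sub_distrib, hl]
  · have h1 : ∀ k, (l k + ((if k = i then l j else 0) - if k = j then l j else 0)) •
        Function.update x i y k = l k • x k +
          ((if k = i then (l i + l j) • y - l i • x i else 0) -
            if k = j then l j • x j else 0) := by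
      intro k
      by_cases hk : k = i
      · subst hk
        simp [hij]
      · by_cases hk' : k = j
        · subst hk'
          simp [hk]
        · simp [hk, hk']
    simp only [h1, Finset.sum_add_distrib, Finset.sum_sub_distrib, hlx, Finset.sum_ite_eq',
      Finset.mem_univ, if_true, hy]
    abel
  · simp [hij.symm]
  · refine Finset.card_lt_card ⟨fun k hk => ?_, fun hsub => ?_⟩
    · simp only [Finset.mem_filter, Finset.mem_univ, true_and] at hk ⊢
      by_cases hki : k = i
      · rwa [hki]
      · by_cases hkj : k = j
        · rwa [hkj]
        · simpa [hki, hkj] using hk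
    · have := hsub (Finset.mem_filter.2 ⟨Finset.mem_univ j, hj⟩)
      simp [hij.symm] at this

/-- The barycentric coordinates of the origin are unique, so a nonzero j-th one keeps it off the
affine hull of the facet opposite to x j. -/
theorem not_exists_weights_subtype_ne {ι : Type*} [Fintype ι] [DecidableEq ι] {x : ι → E n}
    (hx : AffineIndependent ℝ x) {l : ι → ℝ} (hl : ∑ k, l k = 1) (hlx : ∑ k, l k • x k = 0) {j : ι}
    (hj : l j ≠ 0) :
    ¬ ∃ m : {k // k ≠ j} → ℝ, ∑ k, m k = 1 ∧ ∑ k, m k • x k = 0 := by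
  rintro ⟨m, hm, hmx⟩
  have := affineIndependent_iff_fintype.1 hx
    (fun k => (if h : k ≠ j then m ⟨k, h⟩ else 0) - l k) ?_ ?_ j
  · simp [hj] at this
  · rw [Finset.sum_sub_distrib, hl, Fintype.sum_eq_add_sum_subtype_ne _ j,
      Finset.sum_congr rfl fun (k : {k // k ≠ j}) _ => dif_pos k.2]
    simp [hm]
  · simp only [sub_smul]
    rw [Finset.sum_sub_distrib, hlx, Fintype.sum_eq_add_sum_subtype_ne _ j,
      Finset.sum_congr rfl fun (k : {k // k ≠ j}) _ => by rw [dif_pos k.2]]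
    simp [hmx]

-- Induction on the number of vertices plus the number of nonzero barycentric coordinates l of the
-- origin. Two coordinates of the same sign are merged by bisecting their edge in the ratio they
-- prescribe. Otherwise there is one positive coordinate l i and at most one negative l j. If l j <
-- 0, the simplex is one half of the larger simplex with x i replaced by 0; the whole and the other
-- half have the origin as a vertex. With no negative coordinate the origin is itself a vertex.
open Classical in
theorem nullAt_simplex_of_sum_eq_zero {Z : Polytope n → ℝ} (hZ : IsValuation Z)
    (h : ∀ (ι : Type) [Fintype ι] (x : ι → E n), LinearIndependent ℝ x →
      ∀ O : Set (E n), O ⊆ {0} → NullAt Z (convexHull ℝ (O ∪ range x))) (N : ℕ) :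
    ∀ (ι : Type) [Fintype ι] (x : ι → E n), AffineIndependent ℝ x →
      ∀ l : ι → ℝ, ∑ k, l k = 1 → ∑ k, l k • x k = 0 →
      Fintype.card ι + (Finset.univ.filter fun k => l k ≠ 0).card ≤ N →
      NullAt Z (convexHull ℝ (range x)) := by
  induction N with
  | zero =>
    intro ι _ x hx l hl _ hN
    have : IsEmpty ι := Fintype.card_eq_zero_iff.1 (by omega)
    simp at hl
  | succ N ih =>
    intro ι _ x hx l hl hlx hN
    by_cases hpair : ∃ i j, i ≠ j ∧ 0 < l i * l j
    · obtain ⟨i, j, hij, hlij⟩ := hpair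
      have hne : l i + l j ≠ 0 := by
        intro h0
        have : l i = -l j := by linarith
        rw [this] at hlij
        nlinarith [mul_self_nonneg (l j)]
      have hs : 0 < l i / (l i + l j) := by
        rw [← mul_div_mul_right _ _ hne]
        exact div_pos (by nlinarith [mul_self_nonneg (l i)]) (mul_self_pos.2 hne)
      have ht : 0 < l j / (l i + l j) := by
        rw [← mul_div_mul_right _ _ hne]
        exact div_pos (by nlinarith [mul_self_nonneg (l j)]) (mul_self_pos.2 hne)
      obtain ⟨h1, h2, hU, hI⟩ := hx.bisect hij hs ht (by field_simp) rfl
      set y := (l i / (l i + l j)) • x i + (l j / (l i + l j)) • x j with hy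
      have hy' : (l i + l j) • y = l i • x i + l j • x j := by
        rw [hy, smul_add, smul_smul, smul_smul, mul_div_cancel₀ _ hne, mul_div_cancel₀ _ hne]
      obtain ⟨m, hm, hmx, hmj, hmc⟩ := exists_merge_weights x hl hlx hij hlij hy'
      obtain ⟨m', hm', hmx', -, hmc'⟩ := exists_merge_weights x hl hlx hij.symm
        (by rwa [mul_comm]) (y := y) (by rw [add_comm, hy', add_comm])
      rw [hU]
      refine (ih ι _ h1 m hm hmx (by omega)).union hZ (ih ι _ h2 m' hm' hmx' (by omega)) ?_ ?_
      · rw [← hI]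
        refine ih {k // k ≠ j} _ (h1.subtype {k | k ≠ j}) (fun k => m k) ?_ ?_ ?_
        · rw [← hm, Fintype.sum_eq_add_sum_subtype_ne _ j, hmj, zero_add]
        · rw [← hmx, Fintype.sum_eq_add_sum_subtype_ne _ j, hmj, zero_smul, zero_add]
        · have hc1 : Fintype.card {k // k ≠ j} < Fintype.card ι :=
            Fintype.card_subtype_lt (x := j) (by simp)
          have hc2 : (Finset.univ.filter fun k : {k // k ≠ j} => m k ≠ 0).card ≤
              (Finset.univ.filter fun k => m k ≠ 0).card :=
            Finset.card_le_card_of_injOn Subtype.val (fun k hk => by simpa using hk)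
              Subtype.val_injective.injOn
          omega
      · rw [← hU]
        exact convex_convexHull ℝ _
    push Not at hpair
    obtain ⟨i, hi⟩ : ∃ i, 0 < l i := by
      by_contra hcon
      push Not at hcon
      have := Finset.sum_nonpos fun k (_ : k ∈ Finset.univ) => hcon k
      linarith
    by_cases hneg : ∃ j, j ≠ i ∧ l j ≠ 0
    · obtain ⟨j, hji, hj⟩ := hneg
      have hj0 : l j < 0 := by
        refine lt_of_le_of_ne ?_ hj
        by_contra hcon
        have := hpair i j hji.symm
        nlinarith
      have hrest : ∀ k, k ≠ i → k ≠ j → l k = 0 := by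
        intro k hki hkj
        have h1 := hpair i k hki.symm
        have h2 := hpair j k hkj.symm
        nlinarith
      have hsum : l i + l j = 1 := by
        rw [← hl, Fintype.sum_eq_add i j hji.symm fun k hk => hrest k hk.1 hk.2]
      have hsumx : l i • x i + l j • x j = 0 := by
        rw [← hlx, Fintype.sum_eq_add i j hji.symm fun k hk => by
          rw [hrest k hk.1 hk.2, zero_smul]]
      have hz := affineIndependent_update_zero hx hl hlx hi.ne'
      -- Since l j < 0 and l i + l j = 1, the vertex x i lies strictly between 0 and x j, so it
      -- bisects an edge of the larger simplex.
      have hy : x i = (1 / l i) • Function.update x i 0 i + (-l j / l i) • Function.update x i 0 j := by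
        rw [Function.update_self, smul_zero, zero_add, Function.update_of_ne hji, neg_div, neg_smul,
          div_eq_inv_mul, mul_smul, ← smul_neg, eq_inv_smul_iff₀ hi.ne']
        exact eq_neg_of_add_eq_zero_left hsumx
      obtain ⟨-, h2, hU, hI⟩ := hz.bisect hji.symm (one_div_pos.2 hi)
        (div_pos (neg_pos.2 hj0) hi) (by rw [← add_div, div_eq_one_iff_eq hi.ne']; linarith) hy
      rw [Function.update_idem, Function.update_eq_self] at hU hI
      have hcount : (Finset.univ.filter fun k => (Pi.single i 1 : ι → ℝ) k ≠ 0).card <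
          (Finset.univ.filter fun k => l k ≠ 0).card := by
        refine Finset.card_lt_card ⟨fun k hk => ?_, fun hsub => ?_⟩
        · simp only [Finset.mem_filter, Finset.mem_univ, true_and] at hk ⊢
          rcases eq_or_ne k i with rfl | hki
          · exact hi.ne'
          · simp [hki] at hk
        · have := hsub (Finset.mem_filter.2 ⟨Finset.mem_univ j, hj⟩)
          simp [hji] at this
      have hvertex : ∀ z : ι → E n, AffineIndependent ℝ z → z i = 0 →
          NullAt Z (convexHull ℝ (range z)) := fun z hz hzi =>
        ih ι z hz (Pi.single i 1) (by simp) (by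
          rw [Fintype.sum_eq_single i fun k hk => by simp [hk], hzi, smul_zero]) (by omega)
      refine NullAt.of_union hZ (hvertex _ hz (Function.update_self ..))
        (hvertex _ h2 (by rw [Function.update_of_ne hji.symm, Function.update_self])) ?_
        (exists_polytope_convexHull_range x i) hU
      rw [← hI]
      have := h {k // k ≠ j} _ (linearIndependent_of_affineIndependent (hx.subtype {k | k ≠ j})
        (not_exists_weights_subtype_ne hx hl hlx hj)) ∅ (empty_subset _)
      rwa [empty_union] at this
    · push Not at hneg
      rw [Fintype.sum_eq_single i hneg] at hl
      rw [Fintype.sum_eq_single i fun k hk => by rw [hneg k hk, zero_smul], hl, one_smul] at hlx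
      have := h _ _ (linearIndependent_subtype_ne_of_zero hx hlx) {0} Subset.rfl
      rwa [singleton_union, ← hlx, ← range_eq_insert x i] at this

/-- A valuation vanishes if it does so at all simplices spanned by linearly independent
vectors, with or without the origin as an additional vertex. -/
theorem IsValuation.eq_zero_of_linearIndependent {Z : Polytope n → ℝ} (hZ : IsValuation Z)
    (h : ∀ (ι : Type) [Fintype ι] (x : ι → E n), LinearIndependent ℝ x →
      ∀ O : Set (E n), O ⊆ {0} → NullAt Z (convexHull ℝ (O ∪ range x))) (P : Polytope n) :
    Z P = 0 := by
  refine hZ.eq_zero_of_simplices (fun ι _ x hx => ?_) P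
  by_cases hl : ∃ l : ι → ℝ, ∑ k, l k = 1 ∧ ∑ k, l k • x k = 0
  · obtain ⟨l, hl, hlx⟩ := hl
    exact nullAt_simplex_of_sum_eq_zero hZ h _ ι x hx l hl hlx le_rfl
  · simpa using h ι x (linearIndependent_of_affineIndependent hx hl) ∅ (empty_subset _)

end Radial

/-! ### Simplices spanned by linearly independent vectors -/

section LinIndep

variable {n : ℕ}

theorem LinearIndependent.exists_dual {V : Type*} [AddCommGroup V] [Module ℝ V] {ι : Type*}
    [DecidableEq ι] {x : ι → V} (hx : LinearIndependent ℝ x) (i : ι) :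
    ∃ g : V →ₗ[ℝ] ℝ, ∀ k, g (x k) = if k = i then 1 else 0 := by
  obtain ⟨f, hf, hker⟩ := Submodule.exists_le_ker_of_notMem
    (hx.notMem_span_image (s := {i}ᶜ) (x := i) (by simp))
  refine ⟨(f (x i))⁻¹ • f, fun k => ?_⟩
  rcases eq_or_ne k i with rfl | hk
  · simp [hf]
  · have : f (x k) = 0 := hker (Submodule.subset_span ⟨k, hk, rfl⟩)
    simp [this, hk]

theorem exists_dual_of_notMem {V : Type*} [AddCommGroup V] [Module ℝ V] {p : Submodule ℝ V} {v : V}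
    (hv : v ∉ p) : ∃ f : V →ₗ[ℝ] ℝ, f v = 1 ∧ ∀ w ∈ p, f w = 0 := by
  obtain ⟨f, hf, hker⟩ := Submodule.exists_le_ker_of_notMem hv
  refine ⟨(f v)⁻¹ • f, by simp [hf], fun w hw => ?_⟩
  have : f w = 0 := hker hw
  simp [this]

/-- The convex hull of finitely many points and possibly the origin. -/
def pointedHull {ι : Type*} [Finite ι] [Nonempty ι] (O : Set (E n)) (hO : O ⊆ {0})
    (x : ι → E n) : Polytope n :=
  Polytope.hull (O ∪ range x) (((finite_singleton 0).subset hO).union (finite_range x))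
    ((range_nonempty x).mono subset_union_right)

variable {O : Set (E n)} {hO : O ⊆ {0}}

theorem pointedHull_carrier {ι : Type*} [Finite ι] [Nonempty ι] (x : ι → E n) :
    (pointedHull O hO x).carrier = convexHull ℝ (O ∪ range x) := rfl

theorem image_subset_zero (hO : O ⊆ {0}) (A : E n →ₗ[ℝ] E n) : A '' O = O := by
  rcases subset_singleton_iff_eq.1 hO with rfl | rfl <;> simp

theorem pointedHull_map {ι : Type*} [Finite ι] [Nonempty ι] (x : ι → E n)
    (A : E n →ₗ[ℝ] E n) : (pointedHull O hO x).map A = pointedHull O hO (A ∘ x) := by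
  apply Polytope.ext_carrier
  change A '' convexHull ℝ (O ∪ range x) = convexHull ℝ (O ∪ range (A ∘ x))
  rw [LinearMap.image_convexHull, image_union, image_subset_zero hO, range_comp]

/-- Moving one vertex is the action of a linear map of determinant 1 + g (y - x i) = g y. This ties
bisections to contravariance. -/
theorem transvection_comp_eq_update {ι : Type*} [DecidableEq ι] {x : ι → E n} {i : ι}
    {g : E n →ₗ[ℝ] ℝ} (hg : ∀ k, g (x k) = if k = i then 1 else 0) (y : E n) :
    LinearMap.transvection g (y - x i) ∘ x = Function.update x i y := by
  funext k
  rw [Function.comp_apply, LinearMap.transvection.apply, hg]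
  rcases eq_or_ne k i with rfl | hk
  · simp
  · simp [hk]

/-- Bisecting an edge of a simplex spanned by linearly independent vectors. -/
theorem IsValuation.pointedHull_bisect {Z : Polytope n → ℝ} (hZ : IsValuation Z) {ι : Type*}
    [Finite ι] [DecidableEq ι] {x : ι → E n} (hx : LinearIndependent ℝ x) {i j : ι} (hij : i ≠ j)
    {s t : ℝ} (hs : 0 < s) (ht : 0 < t) (hst : s + t = 1) {y : E n}
    (hy : y = s • x i + t • x j) :
    haveI : Nonempty ι := ⟨i⟩
    haveI : Nonempty {k // k ≠ j} := ⟨⟨i, hij⟩⟩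
    Z (pointedHull O hO x) +
        Z (pointedHull O hO fun k : {k // k ≠ j} => Function.update x i y k) =
      Z (pointedHull O hO (Function.update x i y)) +
        Z (pointedHull O hO (Function.update x j y)) := by
  obtain ⟨g, hg⟩ := LinearIndependent.exists_dual hx i
  obtain ⟨h, hh⟩ := LinearIndependent.exists_dual hx j
  have key : ∀ a b : E n, ∀ R : Set (E n), O ∪ insert a (insert b R) = insert a (insert b (O ∪ R)) :=
    fun a b R => by rw [union_insert, union_insert]
  refine hZ _ _ _ _ ?_ ?_
  · simp only [pointedHull_carrier]
    rw [range_update_left x hij, range_update_right x hij, range_eq_insert_insert x i j]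
    simp only [key]
    exact convexHull_insert_insert_eq_union ⟨s, t, hs.le, ht.le, hst, hy.symm⟩ _
  · simp only [pointedHull_carrier]
    rw [range_update_left x hij, range_update_right x hij, range_update_subtype_ne x hij]
    simp only [key, union_insert]
    -- The separating functional is linear, so the origin lies on the cutting hyperplane and may be
    -- a common vertex.
    refine convexHull_insert_insert_inter (t • g - s • h).toAffineMap ?_ ?_ ?_ ?_
    · simp [hg, hh, hij, ht.le]
    · simp [hg, hh, hij.symm, hs]
    · simp [hy, hg, hh, hij, hij.symm]
      ring
    · rintro _ (h0 | ⟨k, ⟨hk1, hk2⟩, rfl⟩)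
      · rw [hO h0]
        simp
      · simp [hg, hh, hk1, hk2]

end LinIndep

/-! ### Contravariant function-valued valuations -/

section Contra

variable {n : ℕ} {p : ℝ}

/-- An `SL(n)`-contravariant valuation whose values are `p`-homogeneous continuous functions. -/
structure ContraValuation (p : ℝ) (F : Polytope n → E n → ℝ) : Prop where
  valuation : ∀ u, IsValuation fun P => F P u
  contra : ∀ A : E n →ₗ[ℝ] E n, LinearMap.det A = 1 → ∀ P u, F (P.map A) (A u) = F P u
  homog : ∀ P s u, 0 < s → F P (s • u) = s ^ p * F P u
  cont : ∀ P, Continuous (F P)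

theorem contraValuation_of_isSLContravariant {Φ : Polytope n → Cp n p} (hval : IsValuation Φ)
    (hcontra : IsSLContravariant Φ) :
    ContraValuation p fun P u => (Φ P : C(E n, ℝ)) u where
  valuation u K L U I hU hI := by
    have := hval K L U I hU hI
    have h2 := congrArg (fun f : Cp n p => (f : C(E n, ℝ)) u) this
    simpa using h2
  contra A hA P u := by
    set M := Matrix.toEuclideanLin.symm A with hM
    have hMA : Matrix.toEuclideanLin M = A := LinearEquiv.apply_symm_apply _ _
    have hdet : M.det = 1 := by
      rw [← hA, ← hMA, Matrix.toEuclideanLin_eq_toLin_orthonormal, LinearMap.det_toLin]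
    let M' : Matrix.SpecialLinearGroup (Fin n) ℝ := ⟨M, hdet⟩
    have h := hcontra M' P (A u)
    have h1 : Matrix.toEuclideanLin ((M'⁻¹ : Matrix.SpecialLinearGroup (Fin n) ℝ) :
        Matrix (Fin n) (Fin n) ℝ) (A u) = u := by
      have h2 : ((M'⁻¹ : Matrix.SpecialLinearGroup (Fin n) ℝ) : Matrix (Fin n) (Fin n) ℝ) * M = 1 :=
        congrArg Subtype.val (inv_mul_cancel M')
      rw [← hMA, Matrix.toEuclideanLin_eq_toLin_orthonormal, ← LinearMap.comp_apply,
        ← Matrix.toLin_mul, h2, Matrix.toLin_one, LinearMap.id_apply]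
    rw [h1] at h
    rw [← h]
    change _ = (Φ (P.map (Matrix.toEuclideanLin M)) : C(E n, ℝ)) (A u)
    rw [hMA]
  homog P s u hs := (Φ P).2 s hs u
  cont P := (Φ P : C(E n, ℝ)).continuous

variable {F : Polytope n → E n → ℝ}

/-- The complement of a proper subspace is dense. -/
theorem eq_zero_of_forall_notMem {f : E n → ℝ} (hf : Continuous f) {p : Submodule ℝ (E n)}
    (hp : p ≠ ⊤) (h : ∀ u ∉ p, f u = 0) (u : E n) : f u = 0 := by
  have hd : Dense ((p : Set (E n))ᶜ) := by
    rw [← interior_eq_empty_iff_dense_compl]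
    by_contra hne
    exact hp (Submodule.eq_top_of_nonempty_interior' _ (nonempty_iff_ne_empty.2 hne))
  have := Continuous.ext_on hd hf (continuous_const (y := (0 : ℝ))) fun u hu => h u hu
  exact congrFun this u

theorem span_range_ne_top {ι : Type*} [Fintype ι] (x : ι → E n) (h : Fintype.card ι < n) :
    Submodule.span ℝ (range x) ≠ ⊤ := by
  intro htop
  have h1 := finrank_range_le_card (R := ℝ) x
  rw [Set.finrank, htop, finrank_top, finrank_euclideanSpace_fin] at h1
  omega

theorem rpow_ne_one_of_pos {a p : ℝ} (ha : 1 < a) (hp : 0 < p) : a ^ p ≠ 1 :=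
  (Real.one_lt_rpow ha hp).ne'

/-- For u outside the span of x there is still room for a vector v independent of x and u. Fixing x,
doubling u and halving v has determinant 1, so the value c at u satisfies 2ᵖ c = c. -/
theorem ContraValuation.pointedHull_eq_zero_of_card_add_one_lt (hF : ContraValuation p F)
    (hp : 1 < p) {O : Set (E n)} {hO : O ⊆ {0}} {ι : Type*} [Fintype ι] [Nonempty ι] (x : ι → E n)
    (hcard : Fintype.card ι + 1 < n) (u : E n) : F (pointedHull O hO x) u = 0 := by
  refine eq_zero_of_forall_notMem (hF.cont _) (span_range_ne_top x (by omega)) (fun u hu => ?_) u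
  obtain ⟨f, hfu, hf⟩ := exists_dual_of_notMem hu
  obtain ⟨v, -, hv⟩ := SetLike.exists_of_lt (lt_top_iff_ne_top.2 (span_range_ne_top
    (fun o : Option ι => o.elim u x) (by rw [Fintype.card_option]; omega)))
  obtain ⟨g, hgv, hg⟩ := exists_dual_of_notMem hv
  have hgu : g u = 0 := hg u (Submodule.subset_span ⟨none, rfl⟩)
  have hgx : ∀ k, g (x k) = 0 := fun k => hg _ (Submodule.subset_span ⟨some k, rfl⟩)
  have hfx : ∀ k, f (x k) = 0 := fun k => hf _ (Submodule.subset_span ⟨k, rfl⟩)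
  -- The right factor doubles u, the left one halves v; the determinants are 2 and 1/2.
  set A := LinearMap.transvection g ((-1 / 2 : ℝ) • v) ∘ₗ LinearMap.transvection f u with hA
  have hdet : LinearMap.det A = 1 := by
    rw [hA, LinearMap.det_comp, LinearMap.transvection.det, LinearMap.transvection.det, map_smul, hgv, hfu]
    norm_num
  have hAx : A ∘ x = x := by
    funext k
    simp [hA, LinearMap.transvection.apply, hgx, hfx]
  have hAu : A u = (2 : ℝ) • u := by
    simp [hA, LinearMap.transvection.apply, hgu, hfu, two_smul]
  have h1 := hF.contra A hdet (pointedHull O hO x) u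
  rw [pointedHull_map, hAx, hAu, hF.homog _ _ _ two_pos] at h1
  have h2 := rpow_ne_one_of_pos one_lt_two (by linarith : 0 < p)
  have h3 : ((2 : ℝ) ^ p - 1) * F (pointedHull O hO x) u = 0 := by linarith
  exact (mul_eq_zero.1 h3).resolve_left (sub_ne_zero.2 h2)

/-- `F` vanishes at simplices in hyperplanes through the origin. -/
theorem ContraValuation.pointedHull_eq_zero (hF : ContraValuation p F) (hn : 3 ≤ n)
    (hp : 1 < p) {O : Set (E n)} {hO : O ⊆ {0}} {ι : Type*} [Fintype ι] [Nonempty ι] {x : ι → E n}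
    (hx : LinearIndependent ℝ x) (hcard : Fintype.card ι < n) (u : E n) :
    F (pointedHull O hO x) u = 0 := by
  classical
  rcases (Nat.succ_le_of_lt hcard).lt_or_eq with hlt | hcard'
  · exact hF.pointedHull_eq_zero_of_card_add_one_lt hp x hlt u
  obtain ⟨i, j, hij⟩ := Fintype.exists_pair_of_one_lt_card (α := ι) (by omega)
  refine eq_zero_of_forall_notMem (hF.cont _) (span_range_ne_top x hcard) (fun u hu => ?_) u
  obtain ⟨f, hfu, hf⟩ := exists_dual_of_notMem hu
  have hfx : ∀ k, f (x k) = 0 := fun k => hf _ (Submodule.subset_span ⟨k, rfl⟩)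
  -- Moving x i to the midpoint of an edge has determinant 1/2, compensated by doubling u, so each
  -- half simplex has at 2u the value of the whole at u. The common facet of the halves contributes
  -- 0 by the previous lemma. Hence 2ᵖ c = 2 c for the value c at u, and p > 1 gives c = 0. The edge
  -- exists because the simplex has n - 1 ≥ 2 spanning vectors.
  have half : ∀ i j : ι, i ≠ j → F (pointedHull O hO
      (Function.update x i ((1 / 2 : ℝ) • x i + (1 / 2 : ℝ) • x j))) ((2 : ℝ) • u) =
        F (pointedHull O hO x) u := by
    intro i j hij
    obtain ⟨g, hg⟩ := LinearIndependent.exists_dual (hx.option hu) (some i)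
    have hgx : ∀ k, g (x k) = if k = i then 1 else 0 := fun k => by simpa using hg (some k)
    have hgu : g u = 0 := by simpa using hg none
    set y := (1 / 2 : ℝ) • x i + (1 / 2 : ℝ) • x j with hy
    set A := LinearMap.transvection g (y - x i) ∘ₗ LinearMap.transvection f u with hA
    have hdet : LinearMap.det A = 1 := by
      rw [hA, LinearMap.det_comp, LinearMap.transvection.det, LinearMap.transvection.det, hfu, hy]
      simp only [map_sub, map_add, map_smul, hgx, if_pos, if_neg hij.symm]
      norm_num
    have hAx : A ∘ x = Function.update x i y := by
      rw [← transvection_comp_eq_update hgx]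
      funext k
      simp only [hA, Function.comp_apply, LinearMap.comp_apply]
      rw [LinearMap.transvection.apply f, hfx, zero_smul, add_zero]
    have hAu : A u = (2 : ℝ) • u := by
      simp [hA, LinearMap.transvection.apply, hgu, hfu, two_smul]
    have h1 := hF.contra A hdet (pointedHull O hO x) u
    rwa [pointedHull_map, hAx, hAu] at h1
  have h1 := half i j hij
  have h2 := half j i hij.symm
  rw [hF.homog _ _ _ two_pos] at h1 h2
  have h3 := (hF.valuation u).pointedHull_bisect (O := O) (hO := hO) hx hij
    (by norm_num : (0 : ℝ) < 1 / 2) (by norm_num : (0 : ℝ) < 1 / 2) (by norm_num) rfl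
  have : Nonempty {k // k ≠ j} := ⟨⟨i, hij⟩⟩
  have hc1 : Fintype.card {k // k ≠ j} < Fintype.card ι :=
    Fintype.card_subtype_lt (x := j) (by simp)
  rw [hF.pointedHull_eq_zero_of_card_add_one_lt hp (fun k : {k // k ≠ j} =>
    Function.update x i ((1 / 2 : ℝ) • x i + (1 / 2 : ℝ) • x j) k) (by omega), add_zero] at h3
  rw [add_comm ((1 / 2 : ℝ) • x j)] at h2
  have h4 : (2 : ℝ) ^ p * F (pointedHull O hO x) u = 2 * F (pointedHull O hO x) u := by
    rw [h3, mul_add, h1, h2, ← h3]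
    ring
  have h5 : (2 : ℝ) ^ p ≠ 2 := by
    have := Real.rpow_lt_rpow_of_exponent_lt one_lt_two hp
    rw [Real.rpow_one] at this
    exact this.ne'
  have h6 : ((2 : ℝ) ^ p - 2) * F (pointedHull O hO x) u = 0 := by linarith
  exact (mul_eq_zero.1 h6).resolve_left (sub_ne_zero.2 h5)

end Contra

/-! ### The functional equation of an edge bisection -/

section FunctionalEquation

variable {n : ℕ}

/-- Moving the `j`-th coordinate of `u` to the `i`-th coordinate. -/
noncomputable def mergeCoord (i j : Fin n) (u : E n) : E n :=
  u + u j • (EuclideanSpace.single i (1 : ℝ) - EuclideanSpace.single j (1 : ℝ))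

theorem mergeCoord_apply (i j : Fin n) (u : E n) (k : Fin n) :
    mergeCoord i j u k = u k + u j * ((if k = i then 1 else 0) - if k = j then 1 else 0) := by
  simp [mergeCoord]

theorem sum_mergeCoord (i j : Fin n) (u : E n) : ∑ k, mergeCoord i j u k = ∑ k, u k := by
  simp only [mergeCoord_apply, Finset.sum_add_distrib, ← Finset.mul_sum, Finset.sum_sub_distrib,
    Finset.sum_ite_eq', Finset.mem_univ, if_true, sub_self, mul_zero, add_zero]

theorem card_support_mergeCoord_lt {i j : Fin n} (hij : i ≠ j) {u : E n} (hi : u i ≠ 0)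
    (hj : u j ≠ 0) : (Finset.univ.filter fun k => mergeCoord i j u k ≠ 0).card <
      (Finset.univ.filter fun k => u k ≠ 0).card := by
  refine Finset.card_lt_card ⟨fun k hk => ?_, fun hsub => ?_⟩
  · simp only [Finset.mem_filter, Finset.mem_univ, true_and, mergeCoord_apply] at hk ⊢
    by_cases hki : k = i
    · rwa [hki]
    · by_cases hkj : k = j
      · rwa [hkj]
      · simpa [hki, hkj] using hk
  · have := hsub (Finset.mem_filter.2 ⟨Finset.mem_univ j, hj⟩)
    simp [mergeCoord_apply, hij.symm] at this

/-- The equations satisfied by the values of a contravariant valuation at simplices of volume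
proportional to `d`. -/
structure BisectionEquation (p : ℝ) (G : ℝ → E n → ℝ) : Prop where
  cont : ∀ d, 0 < d → Continuous (G d)
  homog : ∀ d, 0 < d → ∀ s u, 0 < s → G d (s • u) = s ^ p * G d u
  -- Here u₁ and u₂ are the coordinates of the point u in the two half simplices, where s e_i + t
  -- e_j replaces e_i and e_j respectively.
  eq : ∀ d s t, 0 < d → 0 < s → 0 < t → s + t = 1 → ∀ i j : Fin n, i ≠ j → ∀ u u₁ u₂ : E n,
    u = u₁ + (t * u₁ i) • (EuclideanSpace.single j (1 : ℝ) - EuclideanSpace.single i (1 : ℝ)) →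
    u = u₂ + (s * u₂ j) • (EuclideanSpace.single i (1 : ℝ) - EuclideanSpace.single j (1 : ℝ)) →
    G d u = G (s * d) u₁ + G (t * d) u₂

variable {p : ℝ} {G : ℝ → E n → ℝ}

/-- Points with vanishing i-th and j-th coordinates have the same coordinates in both halves, so the
equation becomes Cauchy's equation in d. -/
theorem BisectionEquation.additive (hG : BisectionEquation p G) {i j : Fin n} (hij : i ≠ j)
    {u : E n} (hi : u i = 0) (hj : u j = 0) {a b : ℝ} (ha : 0 < a) (hb : 0 < b) :
    G (a + b) u = G a u + G b u := by
  have hab : 0 < a + b := by linarith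
  have := hG.eq (a + b) (a / (a + b)) (b / (a + b)) hab (by positivity) (by positivity)
    (by field_simp) i j hij u u u (by simp [hi]) (by simp [hj])
  rwa [div_mul_cancel₀ _ hab.ne', div_mul_cancel₀ _ hab.ne'] at this

/-- Cutting the edge in the ratio u i : u j makes one of the two coordinates vanish in each half. -/
theorem BisectionEquation.same_sign (hG : BisectionEquation p G) {i j : Fin n} (hij : i ≠ j)
    {u : E n} (h : 0 < u i * u j) {d : ℝ} (hd : 0 < d) :
    G d u = G (u i / (u i + u j) * d) (mergeCoord i j u) +
      G (u j / (u i + u j) * d) (mergeCoord j i u) := by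
  have hne : u i + u j ≠ 0 := by
    intro h0
    have : u i = -u j := by linarith
    rw [this] at h
    nlinarith [mul_self_nonneg (u j)]
  have hs : 0 < u i / (u i + u j) := by
    rw [← mul_div_mul_right _ _ hne]
    exact div_pos (by nlinarith [mul_self_nonneg (u i)]) (mul_self_pos.2 hne)
  have ht : 0 < u j / (u i + u j) := by
    rw [← mul_div_mul_right _ _ hne]
    exact div_pos (by nlinarith [mul_self_nonneg (u j)]) (mul_self_pos.2 hne)
  refine hG.eq d _ _ hd hs ht (by field_simp) i j hij u _ _ ?_ ?_
  · have : mergeCoord i j u i = u i + u j := by simp [mergeCoord_apply, hij]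
    rw [this, div_mul_cancel₀ _ hne, mergeCoord, add_assoc, ← smul_add]
    simp
  · have : mergeCoord j i u j = u i + u j := by simp [mergeCoord_apply, hij.symm, add_comm]
    rw [this, div_mul_cancel₀ _ hne, mergeCoord, add_assoc, ← smul_add]
    simp

/-- The equation is used backwards: u is the coordinate vector, in one half of a larger simplex, of
the merged point. That point has i-th coordinate 0, so its coordinates do not change in the other
half. The condition |u i| < |u j| makes both cutting ratios positive. -/
theorem BisectionEquation.opposite_sign (hG : BisectionEquation p G) {i j : Fin n} (hij : i ≠ j)
    {u : E n} (h : u i * u j < 0) (hlt : |u i| < |u j|) {d : ℝ} (hd : 0 < d) :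
    G d u = G (u j / (u i + u j) * d) (mergeCoord j i u) -
      G (-u i / (u i + u j) * d) (mergeCoord j i u) := by
  have hj : u j ≠ 0 := by
    intro h0
    simp [h0] at h
  have hsq := sq_lt_sq.2 hlt
  have hjj : 0 < u j * u j := mul_self_pos.2 hj
  have ht : 0 < (u i + u j) / u j := by
    rw [← mul_div_mul_right _ _ hj]
    refine div_pos ?_ hjj
    by_contra hcon
    push Not at hcon
    have h1 : u j * u j ≤ -(u i * u j) := by nlinarith
    have h2 : |u j| * |u j| ≤ |u i| * |u j| := by
      rw [abs_mul_abs_self, ← abs_mul, abs_of_neg h]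
      exact h1
    exact absurd (le_of_mul_le_mul_right h2 (abs_pos.2 hj)) (not_le.2 hlt)
  have hne : u i + u j ≠ 0 := fun h0 => by simp [h0] at ht
  have hs : 0 < -u i / u j := by
    rw [← mul_div_mul_right _ _ hj]
    exact div_pos (by linarith) hjj
  have hw : mergeCoord j i u i = 0 := by simp [mergeCoord_apply, hij]
  have h1 := hG.eq (u j / (u i + u j) * d) (-u i / u j) ((u i + u j) / u j)
    (mul_pos (by rw [← inv_div]; exact inv_pos.2 ht) hd) hs ht (by field_simp; ring) i j hij
    (mergeCoord j i u) (mergeCoord j i u) u (by simp [hw]) (by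
      rw [div_mul_cancel₀ _ hj, mergeCoord, neg_smul, ← smul_neg, neg_sub])
  have h2 : -u i / u j * (u j / (u i + u j) * d) = -u i / (u i + u j) * d := by
    field_simp
  have h3 : (u i + u j) / u j * (u j / (u i + u j) * d) = d := by
    field_simp
  rw [h2, h3] at h1
  linarith

theorem BisectionEquation.apply_single (hG : BisectionEquation p G)
    (hlin : ∀ d, 0 < d → ∀ i (ε : ℝ), |ε| = 1 →
      G d (EuclideanSpace.single i ε) = d * G 1 (EuclideanSpace.single i ε))
    {d : ℝ} (hd : 0 < d) (i : Fin n) {ε : ℝ} (hε : |ε| = 1) {r : ℝ} (hr : 0 < r) :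
    G d (EuclideanSpace.single i (r * ε)) = d * r ^ p * G 1 (EuclideanSpace.single i ε) := by
  have : EuclideanSpace.single i (r * ε) = r • EuclideanSpace.single i ε := by
    ext k
    simp
  rw [this, hG.homog d hd r _ hr, hlin d hd i ε hε]
  ring

/-- A third index k allows two evaluations at the vector with entries 2ε, 2ε, -ε at i, j, k. Merging
k into j gives the values at e_i and e_j the weights 2/3 and 1/3; merging k into i exchanges the
weights. -/
theorem BisectionEquation.eq_single (hG : BisectionEquation p G) (hn : 3 ≤ n)
    (hlin : ∀ d, 0 < d → ∀ i (ε : ℝ), |ε| = 1 →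
      G d (EuclideanSpace.single i ε) = d * G 1 (EuclideanSpace.single i ε))
    (i j : Fin n) {ε : ℝ} (hε : |ε| = 1) :
    G 1 (EuclideanSpace.single i ε) = G 1 (EuclideanSpace.single j ε) := by
  rcases eq_or_ne i j with rfl | hij
  · rfl
  obtain ⟨k, hki, hkj⟩ : ∃ k, k ≠ i ∧ k ≠ j := by
    have : ({i, j} : Finset (Fin n)).card < (Finset.univ : Finset (Fin n)).card := by
      rw [Finset.card_univ, Fintype.card_fin]
      exact lt_of_le_of_lt Finset.card_le_two (by omega)
    obtain ⟨k, -, hk⟩ := Finset.exists_mem_notMem_of_card_lt_card this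
    simp only [Finset.mem_insert, Finset.mem_singleton, not_or] at hk
    exact ⟨k, hk.1, hk.2⟩
  have hε2 : ε * ε = 1 := by rw [← abs_mul_abs_self, hε, one_mul]
  have hε0 : ε ≠ 0 := by
    rintro rfl
    simp at hε2
  set w : Fin n → Fin n → E n := fun a b =>
    EuclideanSpace.single a (2 * ε) + EuclideanSpace.single b (1 * ε) with hw
  have h1 : ∀ a b : Fin n, a ≠ b → ∀ d, 0 < d → G d (w a b) = d * 3 ^ p *
      (2 / 3 * G 1 (EuclideanSpace.single a ε) + 1 / 3 * G 1 (EuclideanSpace.single b ε)) := by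
    intro a b hab d hd
    have ha : w a b a = 2 * ε := by simp [hw, hab]
    have hb : w a b b = ε := by simp [hw, hab.symm]
    have hm : mergeCoord a b (w a b) = EuclideanSpace.single a (3 * ε) := by
      ext l
      rw [mergeCoord_apply, hb]
      by_cases hla : l = a
      · subst hla
        simp [hw, hab]
        ring
      · by_cases hlb : l = b
        · subst hlb
          simp [hw, hab.symm]
        · simp [hw, hla, hlb]
    have hm' : mergeCoord b a (w a b) = EuclideanSpace.single b (3 * ε) := by
      ext l
      rw [mergeCoord_apply, ha]
      by_cases hla : l = a
      · subst hla
        simp [hw, hab]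
      · by_cases hlb : l = b
        · subst hlb
          simp [hw, hab.symm]
          ring
        · simp [hw, hla, hlb]
    have hfrac : 2 * ε / (2 * ε + ε) = 2 / 3 := by field_simp; ring
    have hfrac' : ε / (2 * ε + ε) = 1 / 3 := by field_simp; ring
    rw [hG.same_sign hab (by rw [ha, hb]; nlinarith) hd, hm, hm', ha, hb, hfrac, hfrac',
      hG.apply_single hlin (by positivity) a hε three_pos,
      hG.apply_single hlin (by positivity) b hε three_pos]
    ring
  have h2 : ∀ a b : Fin n, a ≠ b → k ≠ a → k ≠ b → G 1 (EuclideanSpace.single a (2 * ε) +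
      EuclideanSpace.single b (2 * ε) + EuclideanSpace.single k (-ε)) = 3 ^ p *
      (2 / 3 * G 1 (EuclideanSpace.single a ε) + 1 / 3 * G 1 (EuclideanSpace.single b ε)) := by
    intro a b hab hka hkb
    set v : E n := EuclideanSpace.single a (2 * ε) +
      EuclideanSpace.single b (2 * ε) + EuclideanSpace.single k (-ε) with hv
    have hvk : v k = -ε := by simp [hv, hka, hkb]
    have hvb : v b = 2 * ε := by simp [hv, hab.symm, hkb.symm]
    have hm : mergeCoord b k v = w a b := by
      ext l
      rw [mergeCoord_apply, hvk]
      by_cases hlk : l = k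
      · subst hlk
        simp [hw, hv, hka, hkb]
      · by_cases hlb : l = b
        · subst hlb
          simp [hw, hv, hlk, hab.symm]
          ring
        · simp [hw, hv, hlk, hlb]
    have hfrac : 2 * ε / (-ε + 2 * ε) = 2 := by
      rw [div_eq_iff (by intro h; apply hε0; linarith)]; ring
    have hfrac' : - -ε / (-ε + 2 * ε) = 1 := by
      rw [div_eq_iff (by intro h; apply hε0; linarith)]; ring
    rw [hG.opposite_sign hkb (by rw [hvk, hvb]; nlinarith) (by
      rw [hvk, hvb, abs_neg, abs_mul, hε]; norm_num) one_pos, hm, hvk, hvb, hfrac, hfrac',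
      h1 a b hab _ (by norm_num), h1 a b hab _ (by norm_num)]
    ring
  have h3 := h2 i j hij hki hkj
  have h4 := h2 j i hij.symm hkj hki
  rw [add_comm (EuclideanSpace.single j (2 * ε)), h3] at h4
  have h5 := mul_left_cancel₀ (Real.rpow_pos_of_pos three_pos p).ne' h4
  linarith

/-- The solutions of the bisection equation. -/
theorem BisectionEquation.exists_eq (hG : BisectionEquation p G) (hn : 3 ≤ n) (hp : 1 < p)
    (hlin : ∀ d, 0 < d → ∀ i (ε : ℝ), |ε| = 1 →
      G d (EuclideanSpace.single i ε) = d * G 1 (EuclideanSpace.single i ε)) :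
    ∃ a b : ℝ, ∀ d, 0 < d → ∀ u,
      G d u = d * (a * max (∑ k, u k) 0 ^ p + b * max (-∑ k, u k) 0 ^ p) := by
  have hp0 : p ≠ 0 := by linarith
  let i₀ : Fin n := ⟨0, by omega⟩
  refine ⟨G 1 (EuclideanSpace.single i₀ 1), G 1 (EuclideanSpace.single i₀ (-1)), ?_⟩
  set a := G 1 (EuclideanSpace.single i₀ 1) with ha
  set b := G 1 (EuclideanSpace.single i₀ (-1)) with hb
  set h : E n → ℝ := fun u => a * max (∑ k, u k) 0 ^ p + b * max (-∑ k, u k) 0 ^ p with hh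
  have hcont : Continuous h := by
    have h1 : Continuous fun u : E n => ∑ k, u k := by fun_prop
    exact (continuous_const.mul ((h1.max continuous_const).rpow_const fun _ => Or.inr (by linarith))).add
      (continuous_const.mul ((h1.neg.max continuous_const).rpow_const fun _ => Or.inr (by linarith)))
  have hmerge : ∀ i j u, h (mergeCoord i j u) = h u := fun i j u => by
    simp only [hh, sum_mergeCoord]
  -- Induction on the number of nonzero coordinates: merging two of them lowers this number and
  -- preserves the coordinate sum, hence h.
  suffices H : ∀ (N : ℕ) (u : E n), (Finset.univ.filter fun k => u k ≠ 0).card ≤ N →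
      ∀ d, 0 < d → G d u = d * h u from fun d hd u => H _ u le_rfl d hd
  intro N
  induction N with
  | zero =>
    intro u hu d hd
    have hu0 : u = 0 := by
      ext k
      by_contra hk
      rw [PiLp.zero_apply] at hk
      have hmem : k ∈ Finset.univ.filter fun k => u k ≠ 0 := by simpa using hk
      rw [Finset.card_eq_zero.1 (Nat.le_zero.1 hu)] at hmem
      exact Finset.notMem_empty k hmem
    have h1 := hG.homog d hd 2 0 two_pos
    rw [smul_zero] at h1
    have h2 := rpow_ne_one_of_pos one_lt_two (by linarith : 0 < p)
    have h3 : ((2 : ℝ) ^ p - 1) * G d 0 = 0 := by linarith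
    rw [hu0, (mul_eq_zero.1 h3).resolve_left (sub_ne_zero.2 h2)]
    simp [hh, hp0]
  | succ N ih =>
    intro u hu d hd
    by_cases hpair : ∃ i j, i ≠ j ∧ u i ≠ 0 ∧ u j ≠ 0
    swap
    · by_cases hu0 : ∃ i, u i ≠ 0
      swap
      · push Not at hu0
        exact ih u (by simp [hu0]) d hd
      obtain ⟨i, hi⟩ := hu0
      have hrest : ∀ k, k ≠ i → u k = 0 := fun k hk => by
        by_contra hne
        exact hpair ⟨k, i, hk, hne, hi⟩
      have hsum : ∑ k, u k = u i := Fintype.sum_eq_single i hrest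
      have hui : u = EuclideanSpace.single i (u i) := by
        ext k
        rcases eq_or_ne k i with rfl | hk
        · simp
        · simp [hk, hrest k hk]
      have hval : h u = a * max (u i) 0 ^ p + b * max (-u i) 0 ^ p := by simp only [hh, hsum]
      rcases lt_or_gt_of_ne hi with hneg | hpos
      · have h1 := hG.apply_single hlin hd i (ε := -1) (by simp) (neg_pos.2 hneg)
        rw [mul_neg_one, neg_neg, ← hui, hG.eq_single hn hlin i i₀ (by simp)] at h1
        rw [h1, hval, max_eq_right hneg.le, max_eq_left (neg_pos.2 hneg).le, Real.zero_rpow hp0]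
        ring
      · have h1 := hG.apply_single hlin hd i (ε := 1) (by simp) hpos
        rw [mul_one, ← hui, hG.eq_single hn hlin i i₀ (by simp)] at h1
        rw [h1, hval, max_eq_left hpos.le, max_eq_right (neg_neg_of_pos hpos).le,
          Real.zero_rpow hp0]
        ring
    have hopp : ∀ (u : E n), (Finset.univ.filter fun k => u k ≠ 0).card ≤ N + 1 →
        ∀ i j, i ≠ j → u i * u j < 0 → |u i| < |u j| → G d u = d * h u := by
      intro u hu i j hij hneg hlt
      have hi : u i ≠ 0 := fun h0 => by simp [h0] at hneg
      have hj : u j ≠ 0 := fun h0 => by simp [h0] at hneg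
      have hc := card_support_mergeCoord_lt hij.symm hj hi
      have hjj : 0 < u j * u j := mul_self_pos.2 hj
      have hne : 0 < (u i + u j) * u j := by
        have h2 : |u i| * |u j| < |u j| * |u j| := mul_lt_mul_of_pos_right hlt (abs_pos.2 hj)
        rw [abs_mul_abs_self, ← abs_mul, abs_of_neg hneg] at h2
        linarith
      have hne0 : u i + u j ≠ 0 := fun h0 => by simp [h0] at hne
      have hp1 : 0 < u j / (u i + u j) := by
        rw [← mul_div_mul_right _ _ hj]
        exact div_pos hjj hne
      have hp2 : 0 < -u i / (u i + u j) := by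
        rw [← mul_div_mul_right _ _ hj]
        exact div_pos (by linarith) hne
      rw [hG.opposite_sign hij hneg hlt hd, ih _ (by omega) _ (mul_pos hp1 hd),
        ih _ (by omega) _ (mul_pos hp2 hd), hmerge]
      have : u j / (u i + u j) - -u i / (u i + u j) = 1 := by
        rw [← sub_div, sub_neg_eq_add, add_comm, div_self hne0]
      linear_combination d * h u * this
    obtain ⟨i, j, hij, hi, hj⟩ := hpair
    rcases lt_or_gt_of_ne (mul_ne_zero hi hj) with hneg | hpos
    · rcases lt_trichotomy |u i| |u j| with hlt | heq | hlt
      · exact hopp u hu i j hij hneg hlt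
      -- Here u i = -u j, so the merged coordinate would vanish and the backward cut is unavailable.
      -- Stretching u j slightly avoids this, and continuity recovers u.
      · set v : ℕ → E n := fun m =>
          u + EuclideanSpace.single j (u j * (1 / ((m : ℝ) + 1))) with hv
        have hvi : ∀ m, v m i = u i := fun m => by simp [hv, hij]
        have hvj : ∀ m : ℕ, v m j = u j * (1 + 1 / ((m : ℝ) + 1)) := fun m => by
          simp [hv]
          ring
        have hvlim : Filter.Tendsto v Filter.atTop (nhds u) := by
          have h1 : Filter.Tendsto (fun m : ℕ => (1 / ((m : ℝ) + 1))) Filter.atTop (nhds 0) :=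
            tendsto_one_div_add_atTop_nhds_zero_nat
          have h2 : Continuous fun r : ℝ => u + r • EuclideanSpace.single j (u j) := by fun_prop
          have h3 := (h2.tendsto 0).comp h1
          rw [zero_smul, add_zero] at h3
          refine h3.congr fun m => ?_
          simp only [hv, Function.comp_apply]
          congr 1
          ext k
          simp [mul_comm]
        have hm0 : ∀ m : ℕ, 0 < 1 / ((m : ℝ) + 1) := fun m => by positivity
        have hvG : ∀ m, G d (v m) = d * h (v m) := by
          intro m
          refine hopp (v m) ?_ i j hij ?_ ?_
          · refine le_trans (Finset.card_le_card fun k hk => ?_) hu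
            simp only [Finset.mem_filter, Finset.mem_univ, true_and] at hk ⊢
            by_cases hkj : k = j
            · rwa [hkj]
            · simpa [hv, hkj] using hk
          · rw [hvi, hvj, ← mul_assoc]
            exact mul_neg_of_neg_of_pos hneg (by linarith [hm0 m])
          · rw [hvi, hvj, heq, abs_mul, abs_of_pos (by linarith [hm0 m] : 0 < 1 + 1 / ((m : ℝ) + 1))]
            have := mul_pos (abs_pos.2 hj) (hm0 m)
            linarith
        have l1 := ((hG.cont d hd).tendsto u).comp hvlim
        have l2 := ((continuous_const.mul hcont : Continuous fun u => d * h u).tendsto u).comp hvlim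
        refine tendsto_nhds_unique l1 (l2.congr fun m => (hvG m).symm)
      · exact hopp u hu j i hij.symm (by rwa [mul_comm]) hlt
    · have hc := card_support_mergeCoord_lt hij hi hj
      have hc' := card_support_mergeCoord_lt hij.symm hj hi
      have hne : u i + u j ≠ 0 := by
        intro h0
        have : u i = -u j := by linarith
        rw [this] at hpos
        nlinarith [mul_self_nonneg (u j)]
      have hs : 0 < u i / (u i + u j) := by
        rw [← mul_div_mul_right _ _ hne]
        exact div_pos (by nlinarith [mul_self_nonneg (u i)]) (mul_self_pos.2 hne)
      have ht : 0 < u j / (u i + u j) := by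
        rw [← mul_div_mul_right _ _ hne]
        exact div_pos (by nlinarith [mul_self_nonneg (u j)]) (mul_self_pos.2 hne)
      rw [hG.same_sign hij hpos hd, ih _ (by omega) _ (mul_pos hs hd),
        ih _ (by omega) _ (mul_pos ht hd), hmerge, hmerge]
      have : u i / (u i + u j) + u j / (u i + u j) = 1 := by rw [← add_div, div_self hne]
      linear_combination d * h u * this

end FunctionalEquation

/-! ### Cauchy's functional equation -/

section Cauchy

/-- The graph of a nonzero additive function that vanishes at `1` is dense. -/
theorem AddMonoidHom.exists_near_of_map_one_eq_zero {h : ℝ →+ ℝ} (h1 : h 1 = 0) {x₀ : ℝ}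
    (hx₀ : h x₀ ≠ 0) (x v : ℝ) {δ : ℝ} (hδ : 0 < δ) : ∃ d, |d - x| < δ ∧ |h d - v| < δ := by
  have hrat : ∀ (q : ℚ) (y : ℝ), h ((q : ℝ) * y) = q * h y := fun q y => by
    have := map_ratCast_smul h ℝ ℝ q y
    simpa using this
  have hc : 0 < |h x₀| := abs_pos.2 hx₀
  -- The rational multiple r x₀ gets the value right; adding a rational q then moves the argument
  -- near x without changing the value, since h q = 0.
  obtain ⟨r, hr⟩ := exists_rat_near (v / h x₀) (div_pos hδ hc)
  obtain ⟨q, hq⟩ := exists_rat_near (x - r * x₀) hδ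
  refine ⟨r * x₀ + q, ?_, ?_⟩
  · rw [abs_sub_comm]
    rwa [show x - (r * x₀ + q) = x - r * x₀ - q by ring]
  · have h2 : h q = 0 := by
      have := hrat q 1
      rwa [mul_one, h1, mul_zero] at this
    rw [map_add, hrat, h2, add_zero, abs_sub_comm]
    have : v - r * h x₀ = (v / h x₀ - r) * h x₀ := by field_simp
    rw [this, abs_mul]
    exact (lt_div_iff₀ hc).1 hr

/-- An additive function on the positive reals extends to an additive function. -/
theorem exists_addMonoidHom_of_additive_on_pos {f : ℝ → ℝ}
    (hf : ∀ a b, 0 < a → 0 < b → f (a + b) = f a + f b) :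
    ∃ h : ℝ →+ ℝ, ∀ a, 0 < a → h a = f a := by
  have key : ∀ a b c d, 0 < a → 0 < b → 0 < c → 0 < d → a - b = c - d → f a - f b = f c - f d := by
    intro a b c d ha hb hc hd heq
    have h1 := hf a d ha hd
    have h2 := hf c b hc hb
    rw [show c + b = a + d by linarith] at h2
    linarith
  have hpos : ∀ x : ℝ, 0 < |x| + 1 := fun x => by positivity
  have hpos' : ∀ x : ℝ, 0 < |x| + 1 + x := fun x => by linarith [neg_abs_le x]
  -- Each real x is a difference of two positive numbers, and by `key` the difference of the values
  -- does not depend on the choice.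
  refine ⟨AddMonoidHom.mk' (fun x => f (|x| + 1 + x) - f (|x| + 1)) fun x y => ?_, fun a ha => ?_⟩
  · have h1 := hf _ _ (hpos' x) (hpos' y)
    have h2 := hf _ _ (hpos x) (hpos y)
    have h3 := key _ _ _ _ (hpos' (x + y)) (hpos (x + y)) (add_pos (hpos' x) (hpos' y))
      (add_pos (hpos x) (hpos y)) (by ring)
    linarith
  · have := hf _ _ (hpos a) ha
    simp only [AddMonoidHom.mk'_apply]
    linarith

/-- If f is not linear, subtracting its linear part leaves a function g with dense graph. With D =
sᵐ, the value φ s is a continuous function of the pair (D, g D), so near a point of the interval it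
comes arbitrarily close to any prescribed τ. -/
theorem eq_mul_of_not_dense {p : ℝ} {m : ℕ} (hm : m ≠ 0) {f φ : ℝ → ℝ}
    (hf : ∀ a b, 0 < a → 0 < b → f (a + b) = f a + f b)
    (hφ : ∀ s, 0 < s → f (s ^ m) = s ^ p * φ s) {a b : ℝ} (ha : 0 ≤ a) (hab : a < b)
    (hd : ¬ Dense (φ '' Ioo a b)) {d : ℝ} (hd0 : 0 < d) : f d = d * f 1 := by
  obtain ⟨h, hh⟩ := exists_addMonoidHom_of_additive_on_pos hf
  by_contra hne
  apply hd
  set g : ℝ →+ ℝ := h - (AddMonoidHom.mulRight (h 1)) with hg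
  have hg1 : g 1 = 0 := by simp [hg]
  have hgd : g d ≠ 0 := by
    simp only [hg, AddMonoidHom.sub_apply, AddMonoidHom.mulRight_apply, hh _ hd0, hh _ one_pos]
    exact sub_ne_zero.2 hne
  rw [Metric.dense_iff]
  intro τ ε hε
  set s₀ := (a + b) / 2 with hs₀
  have hs₀0 : 0 < s₀ := by rw [hs₀]; linarith
  set r : ℝ → ℝ := fun D => D ^ ((1 : ℝ) / m) with hr
  have hroot : r (s₀ ^ m) = s₀ := by
    simp only [hr, one_div]
    exact Real.pow_rpow_inv_natCast hs₀0.le hm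
  have hD : 0 < s₀ ^ m := by positivity
  -- The value that g would need at s₀ ^ m for φ s₀ to equal τ.
  set v₀ := τ * s₀ ^ p - s₀ ^ m * h 1 with hv₀
  have hrc : ContinuousAt r (s₀ ^ m) := Real.continuousAt_rpow_const _ _ (Or.inl hD.ne')
  have hψ : ContinuousAt (fun q : ℝ × ℝ => (r q.1) ^ (-p) * (q.2 + q.1 * h 1)) (s₀ ^ m, v₀) := by
    have h1 : ContinuousAt (fun q : ℝ × ℝ => r q.1) (s₀ ^ m, v₀) :=
      ContinuousAt.comp (f := Prod.fst) (g := r) hrc continuousAt_fst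
    refine (h1.rpow_const (Or.inl ?_)).mul (by fun_prop)
    simp only [hroot]
    exact hs₀0.ne'
  have hψ0 : (r (s₀ ^ m)) ^ (-p) * (v₀ + s₀ ^ m * h 1) = τ := by
    rw [hroot, hv₀, Real.rpow_neg hs₀0.le]
    have := (Real.rpow_pos_of_pos hs₀0 p).ne'
    field_simp
    ring
  obtain ⟨δ₁, hδ₁, H1⟩ := Metric.continuousAt_iff.1 hψ ε hε
  have hnear : ∀ᶠ D in nhds (s₀ ^ m), 0 < D ∧ r D ∈ Ioo a b := by
    refine (lt_mem_nhds hD).and (hrc.eventually_mem ?_)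
    rw [hroot]
    exact Ioo_mem_nhds (by rw [hs₀]; linarith) (by rw [hs₀]; linarith)
  obtain ⟨δ₂, hδ₂, H2⟩ := Metric.eventually_nhds_iff.1 hnear
  obtain ⟨D, hD1, hD2⟩ := AddMonoidHom.exists_near_of_map_one_eq_zero hg1 hgd (s₀ ^ m) v₀
    (lt_min hδ₁ hδ₂)
  obtain ⟨hDpos, hDmem⟩ := H2 (y := D) (lt_of_lt_of_le hD1 (min_le_right _ _))
  refine ⟨φ (r D), ?_, ⟨r D, hDmem, rfl⟩⟩
  have hrD : 0 < r D := Real.rpow_pos_of_pos hDpos _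
  have h3 := H1 (x := (D, g D)) (by
    rw [Prod.dist_eq]
    exact max_lt (lt_of_lt_of_le hD1 (min_le_left _ _)) (lt_of_lt_of_le hD2 (min_le_left _ _)))
  rw [hψ0] at h3
  have h4 : g D + D * h 1 = f D := by
    simp [hg, hh _ hDpos]
  have h5 : (r D) ^ m = D := by
    simp only [hr, one_div]
    exact Real.rpow_inv_natCast_pow hDpos.le hm
  have h6 := hφ (r D) hrD
  rw [h5] at h6
  simp only [h4, h6, Real.rpow_neg hrD.le] at h3
  rwa [inv_mul_cancel_left₀ (Real.rpow_pos_of_pos hrD p).ne'] at h3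

end Cauchy

/-! ### Values at n-dimensional families: from bisections to the functional equation. -/

section Standard

variable {n : ℕ} {p : ℝ} {F : Polytope n → E n → ℝ}

/-- The value at a linear image depends only on the determinant. -/
theorem ContraValuation.map_eq (hF : ContraValuation p F) (hn : n ≠ 0) (P : Polytope n)
    {A : E n →ₗ[ℝ] E n} (hA : 0 < LinearMap.det A) (u : E n) :
    F (P.map A) (A u) = ((LinearMap.det A) ^ ((1 : ℝ) / n)) ^ p *
      F (P.scale ((LinearMap.det A) ^ ((1 : ℝ) / n))) u := by
  set s := (LinearMap.det A) ^ ((1 : ℝ) / n) with hs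
  have hs0 : 0 < s := Real.rpow_pos_of_pos hA _
  have hsn : s ^ n = LinearMap.det A := by
    rw [hs, one_div]
    exact Real.rpow_inv_natCast_pow hA.le hn
  have hdet : LinearMap.det (s⁻¹ • A) = 1 := by
    rw [LinearMap.det_smul, finrank_euclideanSpace_fin, inv_pow, hsn, inv_mul_cancel₀ hA.ne']
  have h1 := hF.contra _ hdet (P.scale s) (s • u)
  rw [hF.homog _ _ _ hs0] at h1
  rw [← h1]
  congr 1
  · apply Polytope.ext_carrier
    change A '' P.carrier = (s⁻¹ • A) '' ((s • LinearMap.id : E n →ₗ[ℝ] E n) '' P.carrier)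
    rw [← image_comp]
    refine image_congr fun x _ => ?_
    simp [hs0.ne']
  · simp [hs0.ne']

/-- By `ContraValuation.map_eq` this is the value at A u of the image of P under any A of
determinant d. The determinant is the natural parameter because a bisection splits it additively. -/
noncomputable def scaledValue (p : ℝ) (F : Polytope n → E n → ℝ) (P : Polytope n) (d : ℝ)
    (u : E n) : ℝ :=
  (d ^ ((1 : ℝ) / n)) ^ p * F (P.scale (d ^ ((1 : ℝ) / n))) u

theorem stdBasis_linearIndependent :
    LinearIndependent ℝ fun i : Fin n => EuclideanSpace.single i (1 : ℝ) := by
  convert! (EuclideanSpace.basisFun (Fin n) ℝ).toBasis.linearIndependent using 1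
  ext1 i
  simp

/-- The halves of a dilated standard simplex are its images under transvections, of total
determinants s * d and t * d. Their common facet lies in a hyperplane through the origin, where F
vanishes. -/
theorem bisectionEquation_scaledValue (hF : ContraValuation p F) (hn : 3 ≤ n) (hp : 1 < p)
    {O : Set (E n)} (hO : O ⊆ {0}) [Nonempty (Fin n)] :
    BisectionEquation p (scaledValue p F
      (pointedHull O hO fun i : Fin n => EuclideanSpace.single i (1 : ℝ))) where
  cont d _ := continuous_const.mul (hF.cont _)
  homog d _ s u hs := by
    simp only [scaledValue, hF.homog _ s u hs]
    ring
  eq d s t hd hs ht hst i j hij u u₁ u₂ h₁ h₂ := by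
    set e : Fin n → E n := fun i => EuclideanSpace.single i (1 : ℝ) with he
    have hn0 : n ≠ 0 := by omega
    set g : Fin n → E n →ₗ[ℝ] ℝ := fun i => (EuclideanSpace.proj i : E n →L[ℝ] ℝ).toLinearMap with hg
    have hge : ∀ i k, g i (e k) = if k = i then 1 else 0 := fun i k => by
      simp [hg, he, eq_comm]
    have hgu : ∀ i (u : E n), g i u = u i := fun i u => rfl
    set y := s • e i + t • e j with hy
    set r := d ^ ((1 : ℝ) / n) with hr
    have hr0 : 0 < r := Real.rpow_pos_of_pos hd _
    have hrn : r ^ n = d := by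
      rw [hr, one_div]
      exact Real.rpow_inv_natCast_pow hd.le hn0
    have hdr : LinearMap.det (r • LinearMap.id : E n →ₗ[ℝ] E n) = d := by
      rw [LinearMap.det_smul, LinearMap.det_id, finrank_euclideanSpace_fin, mul_one, hrn]
    have hre : LinearIndependent ℝ ((r • LinearMap.id : E n →ₗ[ℝ] E n) ∘ e) := by
      refine stdBasis_linearIndependent.map' _ ?_
      rw [LinearMap.ker_smul _ _ hr0.ne', LinearMap.ker_id]
    set R : E n →ₗ[ℝ] E n := r • LinearMap.id with hR
    have hRy : s • (R ∘ e) i + t • (R ∘ e) j = R y := by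
      simp only [hy, map_add, map_smul, Function.comp_apply]
    have hupd : ∀ k, Function.update (R ∘ e) k (R y) =
        (R ∘ₗ LinearMap.transvection (g k) (y - e k)) ∘ e := fun k => by
      rw [← Function.comp_update, ← transvection_comp_eq_update (hge k)]
      rfl
    have hval : ∀ (A : E n →ₗ[ℝ] E n) (D : ℝ), LinearMap.det A = D → 0 < D → ∀ v, A v = R u →
        F (pointedHull O hO (A ∘ e)) (R u) = scaledValue p F (pointedHull O hO e) D v := by
      rintro A _ rfl hD v hv
      rw [← hv, ← pointedHull_map, hF.map_eq hn0 _ hD, scaledValue]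
    have hdetk : ∀ k, LinearMap.det (R ∘ₗ LinearMap.transvection (g k) (y - e k)) =
        g k y * d := fun k => by
      rw [LinearMap.det_comp, LinearMap.transvection.det, map_sub, hge, if_pos rfl, hdr]
      ring
    have hgi : g i y = s := by simp [hy, hge, hij.symm]
    have hgj : g j y = t := by simp [hy, hge, hij]
    have hb := (hF.valuation (R u)).pointedHull_bisect (O := O) (hO := hO) hre hij hs ht hst hRy.symm
    have : Nonempty {k // k ≠ j} := ⟨⟨i, hij⟩⟩
    have hc1 : Fintype.card {k // k ≠ j} < n := by
      have := Fintype.card_subtype_lt (p := (· ≠ j)) (x := j) (by simp)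
      rwa [Fintype.card_fin] at this
    have hli : LinearIndependent ℝ (Function.update (R ∘ e) i (R y)) := by
      rw [hupd]
      have hne : LinearMap.det (R ∘ₗ LinearMap.transvection (g i) (y - e i)) ≠ 0 := by
        rw [hdetk, hgi]
        positivity
      exact stdBasis_linearIndependent.map' _ (LinearMap.equivOfDetNeZero _ hne).ker
    have hI := hF.pointedHull_eq_zero (O := O) (hO := hO) hn hp
      (hli.comp (Subtype.val : {k // k ≠ j} → Fin n) Subtype.val_injective) hc1 (R u)
    change _ + F (pointedHull O hO (Function.update (R ∘ e) i (R y) ∘ Subtype.val)) (R u) = _ at hb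
    rw [hI, add_zero, hupd, hupd, hval R d hdr hd u rfl,
      hval _ (s * d) (by rw [hdetk, hgi]) (by positivity) u₁ ?_,
      hval _ (t * d) (by rw [hdetk, hgj]) (by positivity) u₂ ?_] at hb
    · exact hb
    · rw [LinearMap.comp_apply, LinearMap.transvection.apply]
      congr 1
      conv_rhs => rw [h₂]
      rw [hgu, hy, show s = 1 - t by linarith]
      module
    · rw [LinearMap.comp_apply, LinearMap.transvection.apply]
      congr 1
      conv_rhs => rw [h₁]
      rw [hgu, hy, show s = 1 - t by linarith]
      module

/-- A multiple of e_i has two vanishing coordinates because n ≥ 3, so its value is additive in d,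
and the density hypothesis makes it linear. -/
theorem exists_scaledValue_eq (hF : ContraValuation p F) (hn : 3 ≤ n) (hp : 1 < p)
    {O : Set (E n)} (hO : O ⊆ {0}) [Nonempty (Fin n)]
    (hd : ∀ y : E n, ∃ a b : ℝ, 0 ≤ a ∧ a < b ∧ ¬ Dense ((fun s : ℝ =>
      F ((pointedHull O hO fun i : Fin n => EuclideanSpace.single i (1 : ℝ)).scale s) y) ''
        Ioo a b)) :
    ∃ a b : ℝ, ∀ d, 0 < d → ∀ u, scaledValue p F
      (pointedHull O hO fun i : Fin n => EuclideanSpace.single i (1 : ℝ)) d u =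
        d * (a * max (∑ k, u k) 0 ^ p + b * max (-∑ k, u k) 0 ^ p) := by
  have hG := bisectionEquation_scaledValue hF hn hp hO
  refine hG.exists_eq hn hp fun d hd0 i ε _ => ?_
  have hcard : ({i} : Finset (Fin n)).card + 1 < (Finset.univ : Finset (Fin n)).card := by
    rw [Finset.card_univ, Fintype.card_fin, Finset.card_singleton]
    omega
  obtain ⟨j, -, hj⟩ := Finset.exists_mem_notMem_of_card_lt_card ((Nat.lt_succ_self _).trans hcard)
  rw [Finset.mem_singleton] at hj
  obtain ⟨k, -, hk⟩ := Finset.exists_mem_notMem_of_card_lt_card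
    (s := {i, j}) (t := Finset.univ) (lt_of_le_of_lt Finset.card_le_two (by
      rw [Finset.card_univ, Fintype.card_fin]; omega))
  simp only [Finset.mem_insert, Finset.mem_singleton, not_or] at hk
  obtain ⟨a, b, ha, hab, hnd⟩ := hd (EuclideanSpace.single i ε)
  have hzj : (EuclideanSpace.single i ε : E n) j = 0 := by simp [hj]
  have hzk : (EuclideanSpace.single i ε : E n) k = 0 := by simp [hk.1]
  refine eq_mul_of_not_dense (m := n) (p := p) (f := fun d => scaledValue p F
    (pointedHull O hO fun i : Fin n => EuclideanSpace.single i (1 : ℝ)) d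
      (EuclideanSpace.single i ε)) (by omega)
    (fun x y hx hy => hG.additive (Ne.symm hk.2) hzj hzk hx hy)
    (fun s hs => ?_) ha hab hnd hd0
  simp only [scaledValue]
  rw [one_div, Real.pow_rpow_inv_natCast hs.le (by omega)]

theorem ContraValuation.exists_pointedHull_eq (hF : ContraValuation p F) (hn : 3 ≤ n) (hp : 1 < p)
    {O : Set (E n)} (hO : O ⊆ {0}) [Nonempty (Fin n)]
    (hd : ∀ y : E n, ∃ a b : ℝ, 0 ≤ a ∧ a < b ∧ ¬ Dense ((fun s : ℝ =>
      F ((pointedHull O hO fun i : Fin n => EuclideanSpace.single i (1 : ℝ)).scale s) y) ''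
        Ioo a b)) :
    ∃ a b : ℝ, ∀ A : E n →ₗ[ℝ] E n, 0 < LinearMap.det A → ∀ u,
      F (pointedHull O hO (A ∘ fun i : Fin n => EuclideanSpace.single i (1 : ℝ))) (A u) =
        LinearMap.det A * (a * max (∑ k, u k) 0 ^ p + b * max (-∑ k, u k) 0 ^ p) := by
  obtain ⟨a, b, h⟩ := exists_scaledValue_eq hF hn hp hO hd
  refine ⟨a, b, fun A hA u => ?_⟩
  rw [← h _ hA, ← pointedHull_map, hF.map_eq (by omega) _ hA, scaledValue]

/-- Only the set of vertices matters, so a negative determinant is repaired by exchanging two of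
them. -/
theorem exists_linearMap_range_eq (hn : 2 ≤ n) {ι : Type*} [Fintype ι] {x : ι → E n}
    (hx : LinearIndependent ℝ x) (hcard : Fintype.card ι = n) :
    ∃ A : E n →ₗ[ℝ] E n, 0 < LinearMap.det A ∧
      range (A ∘ fun i : Fin n => EuclideanSpace.single i (1 : ℝ)) = range x := by
  have : Nonempty ι := Fintype.card_pos_iff.1 (by omega)
  let b := basisOfLinearIndependentOfCardEqFinrank hx (by rw [hcard, finrank_euclideanSpace_fin])
  let σ : Fin n ≃ ι := Fintype.equivOfCardEq (by rw [Fintype.card_fin, hcard])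
  let B : E n ≃ₗ[ℝ] E n := (EuclideanSpace.basisFun (Fin n) ℝ).toBasis.equiv b σ
  have hB : ∀ i, B (EuclideanSpace.single i (1 : ℝ)) = x (σ i) := by
    intro i
    have h1 := (EuclideanSpace.basisFun (Fin n) ℝ).toBasis.equiv_apply i b σ
    simpa [b] using h1
  have hrange : range (B.toLinearMap ∘ fun i : Fin n => EuclideanSpace.single i (1 : ℝ)) =
      range x := by
    have : (B.toLinearMap ∘ fun i : Fin n => EuclideanSpace.single i (1 : ℝ)) = x ∘ σ :=
      funext hB
    rw [this, σ.surjective.range_comp]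
  have hdet : LinearMap.det B.toLinearMap ≠ 0 := (LinearEquiv.isUnit_det' B).ne_zero
  rcases lt_or_gt_of_ne hdet with hneg | hpos
  · let i : Fin n := ⟨0, by omega⟩
    let j : Fin n := ⟨1, by omega⟩
    have hij : i ≠ j := by simp [i, j]
    -- The exchange of e_i and e_j, written as a transvection: 1 + f(w) = -1 for f = x_i - x_j and w
    -- = e_j - e_i.
    let S := LinearMap.transvection
      ((EuclideanSpace.proj i - EuclideanSpace.proj j : E n →L[ℝ] ℝ).toLinearMap)
      (EuclideanSpace.single j (1 : ℝ) - EuclideanSpace.single i (1 : ℝ))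
    have hS : LinearMap.det S = -1 := by
      simp only [S, LinearMap.transvection.det]
      simp [hij, hij.symm]
    have hSe : (S ∘ fun i : Fin n => EuclideanSpace.single i (1 : ℝ)) =
        (fun i : Fin n => EuclideanSpace.single i (1 : ℝ)) ∘ Equiv.swap i j := by
      funext k
      simp only [S, Function.comp_apply, LinearMap.transvection.apply]
      rcases eq_or_ne k i with rfl | hki
      · simp [hij.symm]
      · rcases eq_or_ne k j with rfl | hkj
        · simp [hij]
        · simp [Equiv.swap_apply_of_ne_of_ne hki hkj, hki.symm, hkj.symm]
    refine ⟨B.toLinearMap ∘ₗ S, ?_, ?_⟩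
    · rw [LinearMap.det_comp, hS]
      linarith
    · rw [LinearMap.coe_comp, Function.comp_assoc, hSe, ← Function.comp_assoc,
        (Equiv.swap i j).surjective.range_comp, hrange]
  · exact ⟨B.toLinearMap, hpos, hrange⟩

end Standard

/-! ### Facet sums -/

section Prism

variable {n : ℕ}

/-- The prism over `F` with edge vector `w`. -/
def prism (F : Set (E n)) (w : E n) : Set (E n) :=
  (fun q : E n × ℝ => q.1 + q.2 • w) '' (F ×ˢ Icc 0 1)

theorem mem_prism {F : Set (E n)} {w z : E n} :
    z ∈ prism F w ↔ ∃ y ∈ F, ∃ t : ℝ, 0 ≤ t ∧ t ≤ 1 ∧ y + t • w = z := by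
  simp only [prism, mem_image, mem_prod, mem_Icc, Prod.exists]
  constructor
  · rintro ⟨y, t, ⟨hy, h0, h1⟩, rfl⟩
    exact ⟨y, hy, t, h0, h1, rfl⟩
  · rintro ⟨y, hy, t, h0, h1, rfl⟩
    exact ⟨y, t, ⟨hy, h0, h1⟩, rfl⟩

theorem isCompact_prism {F : Set (E n)} (hF : IsCompact F) (w : E n) : IsCompact (prism F w) :=
  (hF.prod isCompact_Icc).image (by fun_prop)

theorem image_prism (A : E n →ₗ[ℝ] E n) (F : Set (E n)) (w : E n) :
    A '' prism F w = prism (A '' F) (A w) := by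
  ext z
  simp only [mem_image, mem_prism]
  constructor
  · rintro ⟨_, ⟨y, hy, t, h0, h1, rfl⟩, rfl⟩
    exact ⟨A y, ⟨y, hy, rfl⟩, t, h0, h1, by rw [map_add, map_smul]⟩
  · rintro ⟨_, ⟨y, hy, rfl⟩, t, h0, h1, rfl⟩
    exact ⟨y + t • w, ⟨y, hy, t, h0, h1, rfl⟩, by rw [map_add, map_smul]⟩

/-- The volume of a prism. -/
theorem volume_prism {F : Set (E n)} (hF : IsCompact F) {v w : E n} (hv : ‖v‖ = 1) {c l : ℝ}
    (hc : ∀ y ∈ F, inner ℝ y v = c) (hl : 0 < l) (hw : inner ℝ w v = l) :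
    volume (prism F w) = ENNReal.ofReal l * (μHE[n - 1] : Measure (E n)) F := by
  have hv0 : v ≠ 0 := by
    rintro rfl
    simp at hv
  -- Fubini in the direction v: the slices at heights in [c, c + l] are translates of F, the others
  -- are empty.
  have h1 := EuclideanGeometry.euclideanHausdorffMeasure_eq_lintegral (P := E n) 0 hv0
    (isCompact_prism hF w).measurableSet
  rw [finrank_euclideanSpace_fin, EuclideanSpace.euclideanHausdorffMeasure_eq_volume] at h1
  have hmem : ∀ (x : ℝ) (z : E n), z ∈ AffineSubspace.mk' (x • v +ᵥ (0 : E n)) (Submodule.span ℝ {v})ᗮ ↔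
      inner ℝ z v = x := by
    intro x z
    rw [AffineSubspace.mem_mk', Submodule.mem_orthogonal_singleton_iff_inner_left]
    simp only [vadd_eq_add, add_zero, vsub_eq_sub]
    rw [inner_sub_left, real_inner_smul_left, real_inner_self_eq_norm_sq, hv, sub_eq_zero]
    norm_num
  have hslice : ∀ x : ℝ, (μHE[n - 1] : Measure (E n)) (prism F w ∩
      AffineSubspace.mk' (x • v +ᵥ (0 : E n)) (Submodule.span ℝ {v})ᗮ) =
        (Icc c (c + l)).indicator (fun _ => (μHE[n - 1] : Measure (E n)) F) x := by
    intro x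
    by_cases hx : x ∈ Icc c (c + l)
    · rw [indicator_of_mem hx, ← (isometry_add_left (((x - c) / l) • w)).euclideanHausdorffMeasure_image F]
      congr 1
      ext z
      simp only [mem_inter_iff, mem_prism, SetLike.mem_coe, hmem, mem_image]
      constructor
      · rintro ⟨⟨y, hy, t, h0, h1, rfl⟩, hz⟩
        rw [inner_add_left, real_inner_smul_left, hc y hy, hw] at hz
        refine ⟨y, hy, ?_⟩
        rw [← hz, add_sub_cancel_left, mul_div_cancel_right₀ _ hl.ne', add_comm]
      · rintro ⟨y, hy, rfl⟩
        refine ⟨⟨y, hy, (x - c) / l, div_nonneg (by linarith [hx.1]) hl.le,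
          (div_le_one hl).2 (by linarith [hx.2]), add_comm _ _⟩, ?_⟩
        rw [inner_add_left, real_inner_smul_left, hc y hy, hw, div_mul_cancel₀ _ hl.ne',
          sub_add_cancel]
    · rw [indicator_of_notMem hx]
      convert measure_empty (μ := (μHE[n - 1] : Measure (E n)))
      rw [eq_empty_iff_forall_notMem]
      rintro z ⟨hz, hz'⟩
      rw [SetLike.mem_coe, hmem] at hz'
      obtain ⟨y, hy, t, h0, h1, rfl⟩ := mem_prism.1 hz
      rw [inner_add_left, real_inner_smul_left, hc y hy, hw] at hz'
      refine hx ⟨?_, ?_⟩ <;> nlinarith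
  rw [h1]
  simp only [hslice]
  rw [lintegral_indicator measurableSet_Icc, setLIntegral_const, Real.volume_Icc, mul_comm,
    add_sub_cancel_left, ← ofReal_norm, hv, ENNReal.ofReal_one, mul_one, mul_comm]

/-- The prism of height 1 over F is compact, and its volume is the measure of F. -/
theorem hausdorffMeasure_ne_top_of_isCompact {F : Set (E n)} (hF : IsCompact F) {v : E n}
    (hv : ‖v‖ = 1) {c : ℝ} (hc : ∀ y ∈ F, inner ℝ y v = c) :
    (μHE[n - 1] : Measure (E n)) F ≠ ⊤ := by
  have h := volume_prism hF hv hc one_pos (w := v)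
    (by rw [real_inner_self_eq_norm_sq, hv]; norm_num)
  rw [ENNReal.ofReal_one, one_mul] at h
  rw [← h]
  exact (isCompact_prism hF v).measure_lt_top.ne

theorem vectorSpan_le_orthogonal {F : Set (E n)} {v : E n} {c : ℝ}
    (hc : ∀ y ∈ F, inner ℝ y v = c) : vectorSpan ℝ F ≤ (Submodule.span ℝ {v})ᗮ := by
  refine Submodule.span_le.2 ?_
  rintro _ ⟨x, hx, y, hy, rfl⟩
  rw [SetLike.mem_coe, Submodule.mem_orthogonal_singleton_iff_inner_left]
  change inner ℝ (x - y) v = 0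
  rw [inner_sub_left, hc x hx, hc y hy, sub_self]

theorem finrank_orthogonal_add_one {v : E n} (hv : v ≠ 0) :
    Module.finrank ℝ (Submodule.span ℝ {v})ᗮ + 1 = n := by
  have h1 := Submodule.finrank_add_finrank_orthogonal (Submodule.span ℝ {v})
  rw [finrank_span_singleton hv, finrank_euclideanSpace_fin] at h1
  omega

/-- The prism of height 1 over such an F lies in a proper affine subspace, so it has volume 0. -/
theorem hausdorffMeasure_eq_zero_of_finrank {F : Set (E n)} (hF : IsCompact F) {v : E n}
    (hv : ‖v‖ = 1) {c : ℝ} (hc : ∀ y ∈ F, inner ℝ y v = c)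
    (hdim : Module.finrank ℝ (vectorSpan ℝ F) + 1 ≠ n) :
    (μHE[n - 1] : Measure (E n)) F = 0 := by
  rcases F.eq_empty_or_nonempty with rfl | ⟨x₀, hx₀⟩
  · simp
  have hv0 : v ≠ 0 := by
    rintro rfl
    simp at hv
  have h := volume_prism hF hv hc one_pos (w := v)
    (by rw [real_inner_self_eq_norm_sq, hv]; norm_num)
  rw [ENNReal.ofReal_one, one_mul] at h
  rw [← h]
  have hle := Submodule.finrank_mono (vectorSpan_le_orthogonal hc)
  have h1 := finrank_orthogonal_add_one hv0
  set W := vectorSpan ℝ F ⊔ Submodule.span ℝ {v} with hW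
  have h2 : Module.finrank ℝ W < n := by
    have := Submodule.finrank_add_le_finrank_add_finrank (vectorSpan ℝ F) (Submodule.span ℝ {v})
    rw [finrank_span_singleton hv0, ← hW] at this
    omega
  refine measure_mono_null (t := (AffineSubspace.mk' x₀ W : Set (E n))) ?_
    (Measure.addHaar_affineSubspace _ _ ?_)
  · intro z hz
    obtain ⟨y, hy, t, -, -, rfl⟩ := mem_prism.1 hz
    rw [SetLike.mem_coe, AffineSubspace.mem_mk', vsub_eq_sub, add_sub_right_comm]
    exact add_mem (Submodule.mem_sup_left (vsub_mem_vectorSpan ℝ hy hx₀))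
      (Submodule.mem_sup_right (Submodule.smul_mem _ _ (Submodule.mem_span_singleton_self v)))
  · intro htop
    have h3 := congrArg AffineSubspace.direction htop
    rw [AffineSubspace.direction_mk', AffineSubspace.direction_top] at h3
    rw [h3, finrank_top, finrank_euclideanSpace_fin] at h2
    exact lt_irrefl _ h2

end Prism

/-! ### Weighted facet sums are valuations. -/

section SupportFn

variable {n : ℕ}

theorem Polytope.exists_isMax (P : Polytope n) (v : E n) :
    ∃ x ∈ P.carrier, inner ℝ x v = supportFn P.carrier v ∧
      ∀ y ∈ P.carrier, inner ℝ y v ≤ supportFn P.carrier v := by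
  have hc : IsCompact ((fun x : E n => inner ℝ x v) '' P.carrier) :=
    P.isCompact.image (continuous_id.inner continuous_const)
  obtain ⟨x, hx, hxv⟩ := hc.sSup_mem (P.nonempty.image _)
  exact ⟨x, hx, hxv, fun y hy => le_csSup hc.bddAbove ⟨y, hy, rfl⟩⟩

theorem Polytope.inner_le (P : Polytope n) (v : E n) {y : E n} (hy : y ∈ P.carrier) :
    inner ℝ y v ≤ supportFn P.carrier v := by
  obtain ⟨-, -, -, h⟩ := P.exists_isMax v
  exact h y hy

theorem Polytope.supportFn_eq (P : Polytope n) {v x : E n} {c : ℝ} (hx : x ∈ P.carrier)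
    (hxv : inner ℝ x v = c) (h : ∀ y ∈ P.carrier, inner ℝ y v ≤ c) :
    supportFn P.carrier v = c := by
  obtain ⟨z, hz, hzv, -⟩ := P.exists_isMax v
  exact le_antisymm (hzv ▸ h z hz) (hxv ▸ P.inner_le v hx)

theorem Polytope.isCompact_face (P : Polytope n) (v : E n) : IsCompact (face P.carrier v) :=
  P.isCompact.inter_right (isClosed_eq (continuous_id.inner continuous_const) continuous_const)

theorem Polytope.face_nonempty (P : Polytope n) (v : E n) : (face P.carrier v).Nonempty := by
  obtain ⟨x, hx, hxv, -⟩ := P.exists_isMax v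
  exact ⟨x, hx, hxv⟩

theorem Polytope.faceVol_eq_zero (P : Polytope n) {v : E n} (hv : ‖v‖ = 1)
    (h : v ∉ facetNormals P.carrier) : faceVol P.carrier v = 0 := by
  have h1 : Module.finrank ℝ (vectorSpan ℝ (face P.carrier v)) + 1 ≠ n := fun h1 => h ⟨hv, h1⟩
  rw [faceVol, measureReal_def, hausdorffMeasure_eq_zero_of_finrank (P.isCompact_face v) hv
    (fun y hy => hy.2) h1, ENNReal.toReal_zero]

/-- If `K ∪ L` is convex and `h(K, v) < h(L, v)`, then `F(K, v) ⊆ L`. -/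
theorem Polytope.face_subset_of_supportFn_lt {K L : Polytope n}
    (hconv : Convex ℝ (K.carrier ∪ L.carrier)) {v : E n}
    (hlt : supportFn K.carrier v < supportFn L.carrier v) :
    face K.carrier v ⊆ L.carrier := by
  rintro x ⟨hx, hxv⟩
  rw [mem_ofPred_eq] at hxv
  obtain ⟨y, hy, hyv, -⟩ := L.exists_isMax v
  -- Points on the way from x to a maximizer y in L exceed the support number of K, so they belong
  -- to L; they converge to x.
  have hlim : Filter.Tendsto (fun m : ℕ => (1 - 1 / ((m : ℝ) + 1)) • x + (1 / ((m : ℝ) + 1)) • y)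
      Filter.atTop (nhds x) := by
    have h1 : Filter.Tendsto (fun m : ℕ => (1 / ((m : ℝ) + 1))) Filter.atTop (nhds 0) :=
      tendsto_one_div_add_atTop_nhds_zero_nat
    have h2 : Continuous fun r : ℝ => (1 - r) • x + r • y := by fun_prop
    have h3 := (h2.tendsto 0).comp h1
    simpa [Function.comp_def] using h3
  refine L.isCompact.isClosed.mem_of_tendsto hlim (Filter.Eventually.of_forall fun m => ?_)
  have hm0 : 0 < 1 / ((m : ℝ) + 1) := by positivity
  have hm1 : 1 / ((m : ℝ) + 1) ≤ 1 := by
    rw [div_le_one (by positivity)]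
    linarith [(Nat.cast_nonneg m : (0 : ℝ) ≤ m)]
  rcases hconv (Or.inl hx) (Or.inr hy) (sub_nonneg.2 hm1) hm0.le (by ring) with h | h
  · exfalso
    have := K.inner_le v h
    rw [inner_add_left, real_inner_smul_left, real_inner_smul_left, hxv, hyv] at this
    nlinarith
  · exact h

/-- The contribution of the normal `v` to a weighted facet sum. -/
noncomputable def facetTerm (ω : ℝ → E n → ℝ) (P : Polytope n) : E n → ℝ :=
  {v : E n | ‖v‖ = 1}.indicator fun v =>
    faceVol P.carrier v * ω (supportFn P.carrier v) v

/-- A weighted sum over the facets. -/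
noncomputable def weightedFacetSum (ω : ℝ → E n → ℝ) (P : Polytope n) : ℝ :=
  ∑ᶠ v, facetTerm ω P v

theorem facetTerm_of_norm_eq_one (ω : ℝ → E n → ℝ) (P : Polytope n) {v : E n} (hv : ‖v‖ = 1) :
    facetTerm ω P v = faceVol P.carrier v * ω (supportFn P.carrier v) v :=
  indicator_of_mem (s := {v : E n | ‖v‖ = 1}) hv _

/-- Faces of lower dimension have measure 0, so summing over all unit vectors adds nothing. The
valuation property can then be checked for each v separately. -/
theorem facetTerm_eq_zero (ω : ℝ → E n → ℝ) (P : Polytope n) {v : E n}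
    (hv : v ∈ facetNormals P.carrier → ω (supportFn P.carrier v) v = 0) : facetTerm ω P v = 0 := by
  by_cases h1 : ‖v‖ = 1
  · rw [facetTerm_of_norm_eq_one ω P h1]
    by_cases h2 : v ∈ facetNormals P.carrier
    · rw [hv h2, mul_zero]
    · rw [P.faceVol_eq_zero h1 h2, zero_mul]
  · exact indicator_of_notMem (s := {v : E n | ‖v‖ = 1}) h1 _

theorem finite_support_facetTerm (ω : ℝ → E n → ℝ) (P : Polytope n) :
    (Function.support (facetTerm ω P)).Finite := by
  refine (facetNormals_finite P).subset fun v hv => ?_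
  by_contra h
  exact hv (facetTerm_eq_zero ω P fun h' => absurd h' h)

/-- If the support numbers of K and L at v differ, the union has the face of the higher body and the
intersection that of the lower one. If they agree, the faces themselves are united and intersected,
and the measure is additive. -/
theorem facetTerm_union_add_inter (ω : ℝ → E n → ℝ) {K L U I : Polytope n}
    (hU : U.carrier = K.carrier ∪ L.carrier) (hI : I.carrier = K.carrier ∩ L.carrier) (v : E n) :
    facetTerm ω U v + facetTerm ω I v = facetTerm ω K v + facetTerm ω L v := by
  by_cases hv : ‖v‖ = 1
  swap
  · simp only [facetTerm, indicator_of_notMem (show v ∉ {v : E n | ‖v‖ = 1} from hv), add_zero]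
  have hconv : Convex ℝ (K.carrier ∪ L.carrier) := hU ▸ U.convex
  have key : ∀ {K L : Polytope n}, U.carrier = K.carrier ∪ L.carrier →
      I.carrier = K.carrier ∩ L.carrier → supportFn K.carrier v < supportFn L.carrier v →
      facetTerm ω U v = facetTerm ω L v ∧ facetTerm ω I v = facetTerm ω K v := by
    intro K L hU hI hlt
    have hconv : Convex ℝ (K.carrier ∪ L.carrier) := hU ▸ U.convex
    simp only [facetTerm_of_norm_eq_one _ _ hv]
    have hsub := Polytope.face_subset_of_supportFn_lt hconv hlt
    obtain ⟨x, hx, hxv, hmax⟩ := L.exists_isMax v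
    have hUs : supportFn U.carrier v = supportFn L.carrier v :=
      U.supportFn_eq (hU ▸ Or.inr hx) hxv fun y hy => by
        rw [hU] at hy
        rcases hy with hy | hy
        exacts [(K.inner_le v hy).trans hlt.le, hmax y hy]
    obtain ⟨z, hz, hzv⟩ := K.face_nonempty v
    have hIs : supportFn I.carrier v = supportFn K.carrier v :=
      I.supportFn_eq (hI ▸ ⟨hz, hsub ⟨hz, hzv⟩⟩) hzv fun y hy => by
        rw [hI] at hy
        exact K.inner_le v hy.1
    have hUf : face U.carrier v = face L.carrier v := by
      ext y
      simp only [face, hU, ← hUs]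
      simp only [mem_inter_iff, mem_union, mem_ofPred_eq]
      refine ⟨fun h => ⟨h.1.resolve_left fun hy => ?_, h.2⟩, fun h => ⟨Or.inr h.1, h.2⟩⟩
      have := K.inner_le v hy
      rw [h.2, ← hU, hUs] at this
      exact absurd this (not_le.2 hlt)
    have hIf : face I.carrier v = face K.carrier v := by
      apply Subset.antisymm
      · rintro y ⟨hy, hyv⟩
        rw [mem_ofPred_eq, hIs] at hyv
        rw [hI] at hy
        exact ⟨hy.1, hyv⟩
      · rintro y ⟨hy, hyv⟩
        refine ⟨?_, ?_⟩
        · rw [hI]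
          exact ⟨hy, hsub ⟨hy, hyv⟩⟩
        · rw [mem_ofPred_eq, hIs]
          exact hyv
    simp only [faceVol, hUf, hIf, hUs, hIs, and_self]
  rcases lt_trichotomy (supportFn K.carrier v) (supportFn L.carrier v) with hlt | heq | hlt
  · obtain ⟨h1, h2⟩ := key hU hI hlt
    rw [h1, h2, add_comm]
  · simp only [facetTerm_of_norm_eq_one _ _ hv]
    obtain ⟨x, hx, hxv, hmax⟩ := L.exists_isMax v
    have hUs : supportFn U.carrier v = supportFn L.carrier v :=
      U.supportFn_eq (hU ▸ Or.inr hx) hxv fun y hy => by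
        rw [hU] at hy
        rcases hy with hy | hy
        exacts [(K.inner_le v hy).trans heq.le, hmax y hy]
    have hIs : supportFn I.carrier v = supportFn L.carrier v := by
      obtain ⟨z, hz, hzv, -⟩ := K.exists_isMax v
      -- The segment between maximizers of K and of L stays at maximal height and is connected, so
      -- it meets K ∩ L.
      have hne : ∃ y ∈ K.carrier ∩ L.carrier, inner ℝ y v = supportFn L.carrier v := by
        obtain ⟨y, hyU, hy⟩ := isPreconnected_closed_iff.1
          (convex_segment z x).isPreconnected K.carrier L.carrier K.isCompact.isClosed
          L.isCompact.isClosed (hconv.segment_subset (Or.inl hz) (Or.inr hx))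
          ⟨z, left_mem_segment _ _ _, hz⟩ ⟨x, right_mem_segment _ _ _, hx⟩
        refine ⟨y, hy, ?_⟩
        obtain ⟨a, b, -, -, hab, rfl⟩ := hyU
        rw [inner_add_left, real_inner_smul_left, real_inner_smul_left, hxv, hzv, heq, ← add_mul,
          hab, one_mul]
      obtain ⟨y, hy, hyv⟩ := hne
      exact I.supportFn_eq (hI ▸ hy) hyv fun y hy => by
        rw [hI] at hy
        exact L.inner_le v hy.2
    have hUf : face U.carrier v = face K.carrier v ∪ face L.carrier v := by
      simp only [face, hUs, heq, ← union_inter_distrib_right, ← hU]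
    have hIf : face I.carrier v = face K.carrier v ∩ face L.carrier v := by
      simp only [face, hIs, heq, ← inter_inter_distrib_right, ← hI]
    have hm := measureReal_union_add_inter (μ := (μHE[n - 1] : Measure (E n)))
      (s := face K.carrier v) (L.isCompact_face v).measurableSet
      (hausdorffMeasure_ne_top_of_isCompact (K.isCompact_face v) hv fun y hy => hy.2)
      (hausdorffMeasure_ne_top_of_isCompact (L.isCompact_face v) hv fun y hy => hy.2)
    rw [← hUf, ← hIf] at hm
    simp only [faceVol, hUs, hIs, heq]
    rw [← add_mul, ← add_mul, hm]
  · obtain ⟨h1, h2⟩ := key (K := L) (L := K) (by rw [hU, union_comm]) (by rw [hI, inter_comm]) hlt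
    rw [h1, h2]

theorem isValuation_weightedFacetSum (ω : ℝ → E n → ℝ) :
    IsValuation (weightedFacetSum (n := n) ω) := by
  intro K L U I hU hI
  simp only [weightedFacetSum]
  rw [← finsum_add_distrib (finite_support_facetTerm ω U) (finite_support_facetTerm ω I),
    ← finsum_add_distrib (finite_support_facetTerm ω K) (finite_support_facetTerm ω L)]
  exact finsum_congr fun v => facetTerm_union_add_inter ω hU hI v

open Classical in
theorem facetSum_eq_weightedFacetSum (p : ℝ) (J : Set ℝ) (g : E n → E n → ℝ) (P : Polytope n)
    (u : E n) : facetSum p {v | supportFn P.carrier v ∈ J} g P u =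
      weightedFacetSum (fun h v => if h ∈ J then |h| ^ (1 - p) * g v u ^ p else 0) P := by
  rw [facetSum, finsum_mem_def, weightedFacetSum]
  refine finsum_congr fun v => ?_
  by_cases hv : v ∈ facetNormals P.carrier ∩ {v | supportFn P.carrier v ∈ J}
  · rw [indicator_of_mem hv, facetTerm_of_norm_eq_one _ _ hv.1.1, if_pos (show supportFn P.carrier v ∈ J from hv.2),
      mul_assoc]
  · rw [indicator_of_notMem hv, facetTerm_eq_zero]
    intro h1
    exact if_neg fun h2 => hv ⟨h1, h2⟩

/-- Facet sums vanish at polytopes in hyperplanes through the origin. -/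
theorem weightedFacetSum_eq_zero {ω : ℝ → E n → ℝ} (hω : ∀ v, ω 0 v = 0) (P : Polytope n)
    {L : Submodule ℝ (E n)} (hL : Module.finrank ℝ L < n) (hP : P.carrier ⊆ L) :
    weightedFacetSum ω P = 0 := by
  refine finsum_eq_zero_of_forall_eq_zero fun v => facetTerm_eq_zero ω P fun hv => ?_
  have hle : vectorSpan ℝ (face P.carrier v) ≤ L := by
    refine Submodule.span_le.2 ?_
    -- A facet inside L has all of L as its direction space, so v is orthogonal to L and the support
    -- number is 0.
    rintro _ ⟨x, hx, y, hy, rfl⟩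
    exact L.sub_mem (hP hx.1) (hP hy.1)
  have heq : vectorSpan ℝ (face P.carrier v) = L :=
    Submodule.eq_of_le_of_finrank_le hle (by have := hv.2; omega)
  obtain ⟨x, hx, hxv⟩ := P.face_nonempty v
  have h1 : x ∈ (Submodule.span ℝ {v})ᗮ :=
    vectorSpan_le_orthogonal (F := face P.carrier v) (fun y hy => hy.2) (heq ▸ hP hx)
  rw [Submodule.mem_orthogonal_singleton_iff_inner_left] at h1
  rw [← (show inner ℝ x v = supportFn P.carrier v from hxv), h1, hω]

end SupportFn

/-! ### Facet sums of simplices -/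

section SimplexValues

variable {n : ℕ}

/-- Normalizing the functional A u ↦ ∑ u k gives the unit normal v of the hyperplane through the
vectors A e_k; h is its distance from the origin. -/
theorem exists_unit_normal [Nonempty (Fin n)] {A : E n →ₗ[ℝ] E n} (hA : 0 < LinearMap.det A) :
    ∃ (v : E n) (h : ℝ), ‖v‖ = 1 ∧ 0 < h ∧ ∀ u, inner ℝ (A u) v = h * ∑ k, u k := by
  let B := LinearMap.equivOfDetNeZero A hA.ne'
  let s : E n →ₗ[ℝ] ℝ := ∑ k, (EuclideanSpace.proj k : E n →L[ℝ] ℝ).toLinearMap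
  have hs : ∀ u : E n, s u = ∑ k, u k := fun u => by
    simp [s, LinearMap.sum_apply]
  set a : E n := (InnerProductSpace.toDual ℝ (E n)).symm
    (LinearMap.toContinuousLinearMap (s ∘ₗ B.symm.toLinearMap)) with ha
  have hau : ∀ u, inner ℝ (A u) a = ∑ k, u k := by
    intro u
    rw [real_inner_comm, ha, InnerProductSpace.toDual_symm_apply, ← hs]
    change s (B.symm (B u)) = s u
    rw [B.symm_apply_apply]
  have ha0 : a ≠ 0 := by
    intro h0
    have := hau (EuclideanSpace.single (Classical.arbitrary _) 1)
    rw [h0, inner_zero_right] at this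
    simp at this
  have hn : 0 < ‖a‖ := norm_pos_iff.2 ha0
  refine ⟨‖a‖⁻¹ • a, ‖a‖⁻¹, norm_smul_inv_norm ha0, inv_pos.2 hn, fun u => ?_⟩
  rw [real_inner_smul_right, hau]

/-- The standard prism, whose volume normalizes the facet sums of simplices. -/
def stdPrism (n : ℕ) [Nonempty (Fin n)] : Set (E n) :=
  prism (convexHull ℝ (range fun i : Fin n => EuclideanSpace.single i (1 : ℝ)))
    (EuclideanSpace.single (Classical.arbitrary _) (1 : ℝ))

theorem isCompact_stdSimplex : IsCompact (convexHull ℝ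
    (range fun i : Fin n => EuclideanSpace.single i (1 : ℝ)) : Set (E n)) :=
  (finite_range _).isCompact_convexHull ℝ

theorem volume_stdPrism_pos [Nonempty (Fin n)] : 0 < volume.real (stdPrism n) := by
  have hfin : volume (stdPrism n) ≠ ⊤ := (isCompact_prism isCompact_stdSimplex _).measure_lt_top.ne
  refine ENNReal.toReal_pos (Measure.measure_pos_of_nonempty_interior _ ?_).ne' hfin
  have hconv : Convex ℝ (stdPrism n) := by
    have := ((convex_convexHull ℝ (range fun i : Fin n => EuclideanSpace.single i (1 : ℝ))).prod
      (convex_Icc (0 : ℝ) 1)).linear_image (LinearMap.fst ℝ (E n) ℝ +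
        (LinearMap.snd ℝ (E n) ℝ).smulRight
          (EuclideanSpace.single (Classical.arbitrary (Fin n)) (1 : ℝ)))
    exact this
  rw [hconv.interior_nonempty_iff_affineSpan_eq_top]
  set e : Fin n → E n := fun i => EuclideanSpace.single i (1 : ℝ) with he
  set i₀ : Fin n := Classical.arbitrary _
  have hmem : ∀ (i : Fin n) (t : ℝ), 0 ≤ t → t ≤ 1 →
      e i + t • e i₀ ∈ affineSpan ℝ (stdPrism n) := fun i t h0 h1 =>
    subset_affineSpan ℝ _ (mem_prism.2 ⟨e i, subset_convexHull ℝ _ ⟨i, rfl⟩, t, h0, h1, rfl⟩)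
  -- The origin is found by extending the edge from e_{i₀} to 2 e_{i₀} backwards by its own length.
  have h0 : (0 : E n) ∈ affineSpan ℝ (stdPrism n) := by
    have h1 := hmem i₀ 0 le_rfl zero_le_one
    have h2 := hmem i₀ 1 zero_le_one le_rfl
    have h3 := AffineMap.lineMap_mem (-1 : ℝ) h1 h2
    have h4 : (AffineMap.lineMap (e i₀ + (0 : ℝ) • e i₀) (e i₀ + (1 : ℝ) • e i₀) (-1 : ℝ) : E n) = 0 := by
      rw [AffineMap.lineMap_apply_module]
      module
    rwa [h4] at h3
  rw [← AffineSubspace.direction_eq_top_iff_of_nonempty ⟨0, h0⟩, eq_top_iff,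
    ← (EuclideanSpace.basisFun (Fin n) ℝ).toBasis.span_eq, Submodule.span_le]
  rintro _ ⟨i, rfl⟩
  have h1 := AffineSubspace.vsub_mem_direction (hmem i 0 le_rfl zero_le_one) h0
  simpa [he] using h1

variable {A : E n →ₗ[ℝ] E n} {v : E n} {h : ℝ}

theorem inner_eq_of_mem_convexHull (hAv : ∀ u, inner ℝ (A u) v = h * ∑ k, u k) {y : E n}
    (hy : y ∈ convexHull ℝ (range (A ∘ fun i : Fin n => EuclideanSpace.single i (1 : ℝ)))) :
    inner ℝ y v = h := by
  have hcv : Convex ℝ {x : E n | inner ℝ x v = h} := by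
    intro x hx y hy a b _ _ hab
    simp only [mem_ofPred_eq] at hx hy ⊢
    rw [inner_add_left, real_inner_smul_left, real_inner_smul_left, hx, hy, ← add_mul, hab, one_mul]
  refine convexHull_min ?_ hcv hy
  rintro _ ⟨i, rfl⟩
  rw [mem_ofPred_eq, Function.comp_apply, hAv]
  simp

variable [Nonempty (Fin n)]

/-- The prism over the simplex with edge vector A e_{i₀} has height h, and it is the image of
`stdPrism` under A. -/
theorem hausdorffMeasure_simplex (hA : 0 < LinearMap.det A) (hv : ‖v‖ = 1) (hh : 0 < h)
    (hAv : ∀ u, inner ℝ (A u) v = h * ∑ k, u k) :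
    h * (μHE[n - 1] : Measure (E n)).real
      (convexHull ℝ (range (A ∘ fun i : Fin n => EuclideanSpace.single i (1 : ℝ)))) =
      LinearMap.det A * volume.real (stdPrism n) := by
  have himg : convexHull ℝ (range (A ∘ fun i : Fin n => EuclideanSpace.single i (1 : ℝ))) =
      A '' convexHull ℝ (range fun i : Fin n => EuclideanSpace.single i (1 : ℝ)) := by
    rw [LinearMap.image_convexHull, range_comp]
  have h1 := volume_prism (F := convexHull ℝ (range (A ∘ fun i : Fin n =>
    EuclideanSpace.single i (1 : ℝ)))) ((finite_range _).isCompact_convexHull ℝ) hv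
    (fun y hy => inner_eq_of_mem_convexHull hAv hy) hh
    (w := A (EuclideanSpace.single (Classical.arbitrary _) (1 : ℝ))) (by rw [hAv]; simp)
  rw [himg, ← image_prism, Measure.addHaar_image_linearMap, ← himg] at h1
  have h2 := congrArg ENNReal.toReal h1
  rw [ENNReal.toReal_mul, ENNReal.toReal_mul, ENNReal.toReal_ofReal (abs_nonneg _),
    ENNReal.toReal_ofReal hh.le, abs_of_pos hA] at h2
  exact h2.symm

theorem mem_pointedHull {O : Set (E n)} {hO : O ⊆ {0}} {x : Fin n → E n} {z : E n}
    (hz : z ∈ (pointedHull O hO x).carrier) :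
    ∃ y ∈ convexHull ℝ (range x), ∃ r : ℝ, 0 ≤ r ∧ r ≤ 1 ∧ z = r • y ∧ (O = ∅ → r = 1) := by
  rw [pointedHull_carrier] at hz
  rcases subset_singleton_iff_eq.1 hO with rfl | rfl
  · rw [empty_union] at hz
    exact ⟨z, hz, 1, zero_le_one, le_rfl, (one_smul ℝ z).symm, fun _ => rfl⟩
  · rw [singleton_union, convexHull_insert (range_nonempty _), convexJoin_singleton_left] at hz
    simp only [mem_iUnion] at hz
    obtain ⟨y, hy, a, b, ha, hb, hab, rfl⟩ := hz
    exact ⟨y, hy, b, hb, by linarith, by rw [smul_zero, zero_add],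
      fun h0 => absurd h0 (singleton_ne_empty _)⟩

/-- The facets of a simplex that do not contain the origin. -/
theorem eq_or_eq_neg_of_mem_facetNormals {O : Set (E n)} {hO : O ⊆ {0}} (hv : ‖v‖ = 1)
    (hAv : ∀ u, inner ℝ (A u) v = h * ∑ k, u k) {w : E n}
    (hw : w ∈ facetNormals (pointedHull O hO
      (A ∘ fun i : Fin n => EuclideanSpace.single i (1 : ℝ))).carrier)
    (hw0 : supportFn (pointedHull O hO
      (A ∘ fun i : Fin n => EuclideanSpace.single i (1 : ℝ))).carrier w ≠ 0) :
    w = v ∨ w = -v := by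
  set P := pointedHull O hO (A ∘ fun i : Fin n => EuclideanSpace.single i (1 : ℝ)) with hP
  -- If the origin is a vertex, a nonzero support number is positive, so a point r • y with r < 1
  -- cannot attain it. The face thus lies in the hyperplane with normal v, and comparing dimensions
  -- makes w parallel to v.
  have hface : ∀ z ∈ face P.carrier w, inner ℝ z v = h := by
    rintro z ⟨hz, hzw⟩
    rw [mem_ofPred_eq] at hzw
    obtain ⟨y, hy, r, hr0, hr1, rfl, hrO⟩ := mem_pointedHull hz
    suffices r = 1 by
      rw [this, one_smul]
      exact inner_eq_of_mem_convexHull hAv hy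
    rcases subset_singleton_iff_eq.1 hO with hO' | hO'
    · exact hrO hO'
    · have h0 : (0 : E n) ∈ P.carrier := subset_convexHull ℝ _ (Or.inl (by rw [hO']; rfl))
      have hyP : y ∈ P.carrier := convexHull_mono subset_union_right hy
      have h1 := P.inner_le w h0
      have h2 := P.inner_le w hyP
      rw [inner_zero_left] at h1
      have hpos : 0 < supportFn P.carrier w := lt_of_le_of_ne h1 (Ne.symm hw0)
      rw [real_inner_smul_left] at hzw
      by_contra hne
      have hlt : r < 1 := lt_of_le_of_ne hr1 hne
      nlinarith
  have hle := vectorSpan_le_orthogonal hface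
  have hle' := vectorSpan_le_orthogonal (F := face P.carrier w) (v := w) fun y hy => hy.2
  have hv0 : v ≠ 0 := by
    rintro rfl
    simp at hv
  have hw0' : w ≠ 0 := by
    rintro rfl
    simpa using hw.1
  have hd := finrank_orthogonal_add_one hv0
  have hd' := finrank_orthogonal_add_one hw0'
  have hdim := hw.2
  have e1 := Submodule.eq_of_le_of_finrank_eq hle (by omega)
  have e2 := Submodule.eq_of_le_of_finrank_eq hle' (by omega)
  have e3 : Submodule.span ℝ {v} = Submodule.span ℝ {w} := by
    have := congrArg (fun W : Submodule ℝ (E n) => Wᗮ) (e1.symm.trans e2)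
    simpa only [Submodule.orthogonal_orthogonal] using this
  obtain ⟨t, ht⟩ := Submodule.mem_span_singleton.1
    (e3 ▸ Submodule.mem_span_singleton_self w : w ∈ Submodule.span ℝ {v})
  have habs : |t| = 1 := by
    have := hw.1
    rwa [← ht, norm_smul, hv, mul_one] at this
  rcases (abs_eq (by norm_num)).1 habs with h1 | h1
  · left; rw [← ht, h1, one_smul]
  · right; rw [← ht, h1, neg_one_smul]

theorem weightedFacetSum_simplex {ω : ℝ → E n → ℝ} (hω : ∀ w, ω 0 w = 0) {O : Set (E n)}
    {hO : O ⊆ {0}} (hv : ‖v‖ = 1) (hAv : ∀ u, inner ℝ (A u) v = h * ∑ k, u k) :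
    weightedFacetSum ω (pointedHull O hO
      (A ∘ fun i : Fin n => EuclideanSpace.single i (1 : ℝ))) =
    facetTerm ω (pointedHull O hO (A ∘ fun i : Fin n => EuclideanSpace.single i (1 : ℝ))) v +
    facetTerm ω (pointedHull O hO (A ∘ fun i : Fin n => EuclideanSpace.single i (1 : ℝ))) (-v) := by
  classical
  have hne : v ≠ -v := by
    intro h0
    have h1 : (2 : ℝ) • v = 0 := by
      rw [two_smul]
      nth_rewrite 2 [h0]
      exact add_neg_cancel v
    rw [(smul_eq_zero.1 h1).resolve_left two_ne_zero, norm_zero] at hv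
    exact zero_ne_one hv
  rw [weightedFacetSum, finsum_eq_sum_of_support_subset (s := {v, -v}), Finset.sum_pair hne]
  intro w hw
  simp only [Finset.coe_insert, Finset.coe_singleton, mem_insert_iff, mem_singleton_iff]
  by_contra hcon
  refine hw (facetTerm_eq_zero _ _ fun hwN => ?_)
  by_cases h0 : supportFn (pointedHull O hO
      (A ∘ fun i : Fin n => EuclideanSpace.single i (1 : ℝ))).carrier w = 0
  · rw [h0, hω]
  · exact absurd (eq_or_eq_neg_of_mem_facetNormals hv hAv hwN h0) hcon

theorem facetTerm_simplex (ω : ℝ → E n → ℝ) {O : Set (E n)} {hO : O ⊆ {0}} (hv : ‖v‖ = 1)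
    (hh : 0 < h) (hAv : ∀ u, inner ℝ (A u) v = h * ∑ k, u k) :
    facetTerm ω (pointedHull O hO (A ∘ fun i : Fin n => EuclideanSpace.single i (1 : ℝ))) v =
      (μHE[n - 1] : Measure (E n)).real
        (convexHull ℝ (range (A ∘ fun i : Fin n => EuclideanSpace.single i (1 : ℝ)))) * ω h v := by
  set P := pointedHull O hO (A ∘ fun i : Fin n => EuclideanSpace.single i (1 : ℝ)) with hP
  have hsub : convexHull ℝ (range (A ∘ fun i : Fin n => EuclideanSpace.single i (1 : ℝ))) ⊆
      P.carrier := convexHull_mono subset_union_right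
  obtain ⟨y, hy⟩ := (range_nonempty
    (A ∘ fun i : Fin n => EuclideanSpace.single i (1 : ℝ))).convexHull (𝕜 := ℝ)
  have hs : supportFn P.carrier v = h := by
    refine P.supportFn_eq (hsub hy) (inner_eq_of_mem_convexHull hAv hy) fun z hz => ?_
    obtain ⟨x, hx, r, -, hr, rfl, -⟩ := mem_pointedHull hz
    rw [real_inner_smul_left, inner_eq_of_mem_convexHull hAv hx]
    nlinarith
  have hf : face P.carrier v =
      convexHull ℝ (range (A ∘ fun i : Fin n => EuclideanSpace.single i (1 : ℝ))) := by
    apply Subset.antisymm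
    · rintro z ⟨hz, hzv⟩
      rw [mem_ofPred_eq, hs] at hzv
      obtain ⟨x, hx, r, -, hr, rfl, -⟩ := mem_pointedHull hz
      rw [real_inner_smul_left, inner_eq_of_mem_convexHull hAv hx] at hzv
      rw [(mul_eq_right₀ hh.ne').1 hzv, one_smul]
      exact hx
    · intro z hz
      refine ⟨hsub hz, ?_⟩
      rw [mem_ofPred_eq, hs]
      exact inner_eq_of_mem_convexHull hAv hz
  rw [facetTerm_of_norm_eq_one _ _ hv, faceVol, hf, hs]

/-- In direction -v the maximum is 0, attained at the origin, where the weight vanishes. -/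
theorem facetTerm_neg_simplex_zero {ω : ℝ → E n → ℝ} (hω : ∀ w, ω 0 w = 0)
    (hh : 0 < h) (hAv : ∀ u, inner ℝ (A u) v = h * ∑ k, u k) :
    facetTerm ω (pointedHull {0} Subset.rfl
      (A ∘ fun i : Fin n => EuclideanSpace.single i (1 : ℝ))) (-v) = 0 := by
  refine facetTerm_eq_zero _ _ fun _ => ?_
  have h0 : (0 : E n) ∈ (pointedHull {0} Subset.rfl
      (A ∘ fun i : Fin n => EuclideanSpace.single i (1 : ℝ))).carrier :=
    subset_convexHull ℝ _ (Or.inl rfl)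
  rw [Polytope.supportFn_eq _ h0 (inner_zero_left _) fun z hz => ?_, hω]
  obtain ⟨x, hx, r, hr, -, rfl, -⟩ := mem_pointedHull hz
  rw [inner_neg_right, real_inner_smul_left, inner_eq_of_mem_convexHull hAv hx]
  nlinarith

/-- Without the origin the simplex is (n - 1)-dimensional and is its own face for both normals. -/
theorem facetTerm_neg_simplex_empty (ω : ℝ → E n → ℝ) (hv : ‖v‖ = 1)
    (hAv : ∀ u, inner ℝ (A u) v = h * ∑ k, u k) :
    facetTerm ω (pointedHull ∅ (empty_subset _)
      (A ∘ fun i : Fin n => EuclideanSpace.single i (1 : ℝ))) (-v) =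
      (μHE[n - 1] : Measure (E n)).real
        (convexHull ℝ (range (A ∘ fun i : Fin n => EuclideanSpace.single i (1 : ℝ)))) *
          ω (-h) (-v) := by
  set P := pointedHull ∅ (empty_subset _)
    (A ∘ fun i : Fin n => EuclideanSpace.single i (1 : ℝ)) with hP
  have hc : P.carrier =
      convexHull ℝ (range (A ∘ fun i : Fin n => EuclideanSpace.single i (1 : ℝ))) := by
    rw [hP, pointedHull_carrier, empty_union]
  have hin : ∀ z ∈ P.carrier, inner ℝ z (-v) = -h := fun z hz => by
    rw [inner_neg_right, inner_eq_of_mem_convexHull hAv (hc ▸ hz)]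
  obtain ⟨y, hy⟩ := P.nonempty
  have hs : supportFn P.carrier (-v) = -h :=
    P.supportFn_eq hy (hin y hy) fun z hz => (hin z hz).le
  have hf : face P.carrier (-v) = P.carrier := by
    refine inter_eq_left.2 fun z hz => ?_
    rw [mem_ofPred_eq, hs]
    exact hin z hz
  rw [facetTerm_of_norm_eq_one _ _ (by rwa [norm_neg]), faceVol, hf, hs, hc]

end SimplexValues

/-! ### The classification -/

section Classification

variable {n : ℕ} {p : ℝ}

open Classical in
/-- The weight of the facet sum over the facets with `h(P, v) ∈ J`. -/
noncomputable def lpWeight (p : ℝ) (J : Set ℝ) (g : E n → E n → ℝ) (u : E n) (h : ℝ) (v : E n) :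
    ℝ :=
  if h ∈ J then |h| ^ (1 - p) * g v u ^ p else 0

theorem lpWeight_zero {J : Set ℝ} (hJ : (0 : ℝ) ∉ J) (g : E n → E n → ℝ) (u v : E n) :
    lpWeight p J g u 0 v = 0 :=
  if_neg hJ

theorem lpWeight_of_mem {J : Set ℝ} {h : ℝ} (hJ : h ∈ J) (g : E n → E n → ℝ) (u v : E n) :
    lpWeight p J g u h v = |h| ^ (1 - p) * g v u ^ p :=
  if_pos hJ

theorem lpWeight_of_notMem {J : Set ℝ} {h : ℝ} (hJ : h ∉ J) (g : E n → E n → ℝ) (u v : E n) :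
    lpWeight p J g u h v = 0 :=
  if_neg hJ

theorem supportFn_projBodyPosGt_rpow (hp : 1 < p) (P : Polytope n) (u : E n) :
    supportFn (projBodyPosGt hp P : Set (E n)) u ^ p =
      weightedFacetSum (lpWeight p (Ioi 0) innerPos u) P :=
  (supportFn_facetSumBody_rpow ..).trans (facetSum_eq_weightedFacetSum p (Ioi 0) innerPos P u)

theorem supportFn_projBodyNegGt_rpow (hp : 1 < p) (P : Polytope n) (u : E n) :
    supportFn (projBodyNegGt hp P : Set (E n)) u ^ p =
      weightedFacetSum (lpWeight p (Ioi 0) innerNeg u) P :=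
  (supportFn_facetSumBody_rpow ..).trans (facetSum_eq_weightedFacetSum p (Ioi 0) innerNeg P u)

theorem supportFn_projBodyPosLt_rpow (hp : 1 < p) (P : Polytope n) (u : E n) :
    supportFn (projBodyPosLt hp P : Set (E n)) u ^ p =
      weightedFacetSum (lpWeight p (Iio 0) innerPos u) P :=
  (supportFn_facetSumBody_rpow ..).trans (facetSum_eq_weightedFacetSum p (Iio 0) innerPos P u)

theorem supportFn_projBodyNegLt_rpow (hp : 1 < p) (P : Polytope n) (u : E n) :
    supportFn (projBodyNegLt hp P : Set (E n)) u ^ p =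
      weightedFacetSum (lpWeight p (Iio 0) innerNeg u) P :=
  (supportFn_facetSumBody_rpow ..).trans (facetSum_eq_weightedFacetSum p (Iio 0) innerNeg P u)

section Values

variable [Nonempty (Fin n)] {A : E n →ₗ[ℝ] E n}

/-- The exponents 1 - p and p leave a single factor h, which combines with the facet measure μ to
the shape-independent quantity d. -/
theorem mul_rpow_one_sub_mul_rpow {μ h d m : ℝ} (hh : 0 < h) (hm : 0 ≤ m) (hd : h * μ = d) :
    μ * (|h| ^ (1 - p) * (h * m) ^ p) = d * m ^ p := by
  rw [abs_of_pos hh, Real.mul_rpow hh.le hm, ← mul_assoc (h ^ (1 - p)), ← Real.rpow_add hh,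
    sub_add_cancel, Real.rpow_one, ← hd]
  ring

/-- Facet sums over the facets with positive support number, at simplices. -/
theorem weightedFacetSum_simplex_Ioi (hA : 0 < LinearMap.det A) {O : Set (E n)} {hO : O ⊆ {0}}
    {g : E n → E n → ℝ} {ε : ℝ} (hg : ∀ v u, g v u = max (ε * inner ℝ v u) 0) (w : E n) :
    weightedFacetSum (lpWeight p (Ioi 0) g (A w)) (pointedHull O hO
      (A ∘ fun i : Fin n => EuclideanSpace.single i (1 : ℝ))) =
      LinearMap.det A * volume.real (stdPrism n) * max (ε * ∑ k, w k) 0 ^ p := by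
  obtain ⟨v, h, hv, hh, hAv⟩ := exists_unit_normal hA
  have hω : ∀ v, lpWeight p (Ioi 0) g (A w) 0 v = 0 := lpWeight_zero self_notMem_Ioi g _
  have h2 : facetTerm (lpWeight p (Ioi 0) g (A w)) (pointedHull O hO
      (A ∘ fun i : Fin n => EuclideanSpace.single i (1 : ℝ))) (-v) = 0 := by
    rcases subset_singleton_iff_eq.1 hO with rfl | rfl
    · rw [facetTerm_neg_simplex_empty _ hv hAv,
        lpWeight_of_notMem (by simpa using hh.le), mul_zero]
    · exact facetTerm_neg_simplex_zero hω hh hAv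
  rw [weightedFacetSum_simplex hω hv hAv, h2, add_zero, facetTerm_simplex _ hv hh hAv,
    lpWeight_of_mem (mem_Ioi.2 hh), hg, real_inner_comm, hAv, mul_left_comm ε, ← mul_zero h,
    ← mul_max_of_nonneg _ _ hh.le, mul_zero]
  exact mul_rpow_one_sub_mul_rpow hh (le_max_right _ _) (hausdorffMeasure_simplex hA hv hh hAv)

/-- Facet sums over the facets with negative support number vanish at simplices with the
origin as a vertex. -/
theorem weightedFacetSum_simplex_Iio_zero (hA : 0 < LinearMap.det A)
    (g : E n → E n → ℝ) (u : E n) :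
    weightedFacetSum (lpWeight p (Iio 0) g u) (pointedHull {0} Subset.rfl
      (A ∘ fun i : Fin n => EuclideanSpace.single i (1 : ℝ))) = 0 := by
  obtain ⟨v, h, hv, hh, hAv⟩ := exists_unit_normal hA
  have hω : ∀ v, lpWeight p (Iio 0) g u 0 v = 0 := lpWeight_zero self_notMem_Iio g _
  rw [weightedFacetSum_simplex hω hv hAv, facetTerm_neg_simplex_zero hω hh hAv, add_zero,
    facetTerm_simplex _ hv hh hAv, lpWeight_of_notMem (by simpa using hh.le), mul_zero]

/-- Facet sums over the facets with negative support number, at simplices that do not contain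
the origin. -/
theorem weightedFacetSum_simplex_Iio_empty (hA : 0 < LinearMap.det A)
    {g : E n → E n → ℝ} {ε : ℝ} (hg : ∀ v u, g v u = max (ε * inner ℝ v u) 0) (w : E n) :
    weightedFacetSum (lpWeight p (Iio 0) g (A w)) (pointedHull ∅ (empty_subset _)
      (A ∘ fun i : Fin n => EuclideanSpace.single i (1 : ℝ))) =
      LinearMap.det A * volume.real (stdPrism n) * max (-ε * ∑ k, w k) 0 ^ p := by
  obtain ⟨v, h, hv, hh, hAv⟩ := exists_unit_normal hA
  have hω : ∀ v, lpWeight p (Iio 0) g (A w) 0 v = 0 := lpWeight_zero self_notMem_Iio g _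
  rw [weightedFacetSum_simplex hω hv hAv, facetTerm_simplex _ hv hh hAv,
    lpWeight_of_notMem (by simpa using hh.le), mul_zero, zero_add,
    facetTerm_neg_simplex_empty _ hv hAv, lpWeight_of_mem (by simpa using hh), hg, inner_neg_left,
    real_inner_comm, hAv, mul_neg, ← neg_mul, mul_left_comm (-ε), ← mul_zero h,
    ← mul_max_of_nonneg _ _ hh.le, mul_zero, abs_neg]
  exact mul_rpow_one_sub_mul_rpow hh (le_max_right _ _) (hausdorffMeasure_simplex hA hv hh hAv)

end Values

theorem innerPos_eq (v u : E n) : innerPos v u = max (1 * inner ℝ v u) 0 := by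
  rw [one_mul, innerPos]

theorem innerNeg_eq (v u : E n) : innerNeg v u = max (-1 * inner ℝ v u) 0 := by
  rw [neg_one_mul, innerNeg]

/-- A linear combination of the four facet sums. -/
noncomputable def facetCombination (p c₁ c₂ c₃ c₄ : ℝ) (P : Polytope n) (u : E n) : ℝ :=
  c₁ * weightedFacetSum (lpWeight p (Ioi 0) innerPos u) P +
  c₂ * weightedFacetSum (lpWeight p (Ioi 0) innerNeg u) P +
  c₃ * weightedFacetSum (lpWeight p (Iio 0) innerPos u) P +
  c₄ * weightedFacetSum (lpWeight p (Iio 0) innerNeg u) P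

theorem isValuation_facetCombination (p c₁ c₂ c₃ c₄ : ℝ) (u : E n) :
    IsValuation fun P : Polytope n => facetCombination p c₁ c₂ c₃ c₄ P u := by
  intro K L U I hU hI
  have h := fun J g => isValuation_weightedFacetSum (lpWeight p J g u) K L U I hU hI
  simp only [facetCombination]
  linear_combination c₁ * h (Ioi 0) innerPos + c₂ * h (Ioi 0) innerNeg +
    c₃ * h (Iio 0) innerPos + c₄ * h (Iio 0) innerNeg

theorem facetCombination_eq_zero (p c₁ c₂ c₃ c₄ : ℝ) (P : Polytope n) {L : Submodule ℝ (E n)}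
    (hL : Module.finrank ℝ L < n) (hP : P.carrier ⊆ L) (u : E n) :
    facetCombination p c₁ c₂ c₃ c₄ P u = 0 := by
  have h := fun (J : Set ℝ) (hJ : (0 : ℝ) ∉ J) (g : E n → E n → ℝ) =>
    weightedFacetSum_eq_zero (lpWeight_zero (p := p) hJ g u) P hL hP
  simp only [facetCombination, h (Ioi 0) self_notMem_Ioi, h (Iio 0) self_notMem_Iio, mul_zero, add_zero]

/-- A contravariant valuation that agrees with a combination of the facet sums at the full
dimensional pointed simplices agrees with it everywhere. -/
theorem ContraValuation.eq_facetCombination {F : Polytope n → E n → ℝ} (hF : ContraValuation p F)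
    (hn : 3 ≤ n) (hp : 1 < p) [Nonempty (Fin n)] {c₁ c₂ c₃ c₄ : ℝ}
    (h : ∀ (O : Set (E n)) (hO : O ⊆ {0}) (A : E n →ₗ[ℝ] E n), 0 < LinearMap.det A → ∀ w,
      F (pointedHull O hO (A ∘ fun i : Fin n => EuclideanSpace.single i (1 : ℝ))) (A w) =
        facetCombination p c₁ c₂ c₃ c₄
          (pointedHull O hO (A ∘ fun i : Fin n => EuclideanSpace.single i (1 : ℝ))) (A w))
    (P : Polytope n) (u : E n) : F P u = facetCombination p c₁ c₂ c₃ c₄ P u := by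
  rw [← sub_eq_zero]
  refine IsValuation.eq_zero_of_linearIndependent
    (Z := fun P => F P u - facetCombination p c₁ c₂ c₃ c₄ P u) (fun K L U I hU hI => ?_)
    (fun ι _ x hx O hO => ?_) P
  · linear_combination hF.valuation u K L U I hU hI -
      isValuation_facetCombination p c₁ c₂ c₃ c₄ u K L U I hU hI
  have hspan : ∀ {ι : Type} [Fintype ι] [Nonempty ι] (x : ι → E n), Fintype.card ι < n →
      facetCombination p c₁ c₂ c₃ c₄ (pointedHull O hO x) u = 0 := fun {ι} _ _ x hcard =>
    facetCombination_eq_zero _ _ _ _ _ _ ((finrank_range_le_card (R := ℝ) x).trans_lt hcard)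
      (convexHull_min (union_subset
        (fun z hz => (hO hz : z = 0) ▸ Submodule.zero_mem _) Submodule.subset_span)
          (Submodule.convex _)) u
  rcases isEmpty_or_nonempty ι with hι | hι
  · rcases subset_singleton_iff_eq.1 hO with rfl | hO'
    · exact Or.inl (by rw [range_eq_empty, union_empty, convexHull_empty])
    -- `pointedHull` needs a nonempty index type, so the one-point polytope {0} is presented by a
    -- single zero vector.
    · refine Or.inr ⟨pointedHull O hO fun _ : Unit => 0, ?_, ?_⟩
      · rw [pointedHull_carrier, range_const, range_eq_empty, hO', union_self, union_empty]
      · simp only []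
        rw [hspan _ (by rw [Fintype.card_unit]; omega),
          hF.pointedHull_eq_zero_of_card_add_one_lt hp _ (by rw [Fintype.card_unit]; omega),
          sub_zero]
  have hle := hx.fintype_card_le_finrank
  rw [finrank_euclideanSpace_fin] at hle
  refine Or.inr ?_
  rcases hle.lt_or_eq with hlt | heq
  · refine ⟨pointedHull O hO x, rfl, ?_⟩
    simp only []
    rw [hspan x hlt, hF.pointedHull_eq_zero hn hp hx hlt, sub_zero]
  · obtain ⟨A, hA, hAx⟩ := exists_linearMap_range_eq (by omega) hx heq
    refine ⟨pointedHull O hO (A ∘ fun i : Fin n => EuclideanSpace.single i (1 : ℝ)), ?_, ?_⟩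
    · rw [pointedHull_carrier, hAx]
    · obtain ⟨w, rfl⟩ := (LinearMap.equivOfDetNeZero A hA.ne').surjective u
      exact sub_eq_zero.2 (h O hO A hA w)

theorem pointedHull_zero_eq_cornerSimplex [Nonempty (Fin n)] :
    (pointedHull {0} Subset.rfl fun i : Fin n => EuclideanSpace.single i (1 : ℝ)) =
      cornerSimplex n :=
  Polytope.ext_carrier (by rw [pointedHull_carrier, singleton_union]; rfl)

theorem pointedHull_empty_eq_faceSimplex [Nonempty (Fin n)] (hn : 0 < n) :
    (pointedHull ∅ (empty_subset _) fun i : Fin n => EuclideanSpace.single i (1 : ℝ)) =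
      faceSimplex n hn :=
  Polytope.ext_carrier (by rw [pointedHull_carrier, empty_union]; rfl)

end Classification

end LpVal

/-! ### The main theorem. -/

theorem mainTheorem4 (n : ℕ) (hn : 3 ≤ n) (p : ℝ) (hp : 1 < p)
    (Φ : Polytope n → Cp n p) (hval : IsValuation Φ) (hcontra : IsSLContravariant Φ)
    (hT : ∀ y : E n, ∃ a b : ℝ, 0 ≤ a ∧ a < b ∧
      ¬ Dense ((fun s : ℝ => (Φ ((cornerSimplex n).scale s) : C(E n, ℝ)) y) '' Set.Ioo a b))
    (hF : ∀ y : E n, ∃ a b : ℝ, 0 ≤ a ∧ a < b ∧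
      ¬ Dense ((fun s : ℝ => (Φ ((faceSimplex n (by omega)).scale s) : C(E n, ℝ)) y) ''
        Set.Ioo a b)) :
    ∃ c₁ c₂ c₃ c₄ : ℝ, ∀ (P : Polytope n) (u : E n),
      (Φ P : C(E n, ℝ)) u =
        c₁ * supportFn (projBodyPosGt hp P : Set (E n)) u ^ p +
        c₂ * supportFn (projBodyNegGt hp P : Set (E n)) u ^ p +
        c₃ * supportFn (projBodyPosLt hp P : Set (E n)) u ^ p +
        c₄ * supportFn (projBodyNegLt hp P : Set (E n)) u ^ p := by
  have hne : Nonempty (Fin n) := ⟨⟨0, by omega⟩⟩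
  have hΦ := contraValuation_of_isSLContravariant hval hcontra
  obtain ⟨a, b, hab⟩ := hΦ.exists_pointedHull_eq hn hp (O := {0}) Subset.rfl
    (by rw [pointedHull_zero_eq_cornerSimplex]; exact hT)
  obtain ⟨a', b', hab'⟩ := hΦ.exists_pointedHull_eq hn hp (O := ∅) (empty_subset _)
    (by rw [pointedHull_empty_eq_faceSimplex (by omega)]; exact hF)
  have hκ : volume.real (stdPrism n) ≠ 0 := volume_stdPrism_pos.ne'
  set κ := volume.real (stdPrism n)
  -- Pointed simplices see only c₁ and c₂, so a = κ c₁ and b = κ c₂. For the others the normal -v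
  -- contributes too and exchanges positive and negative parts, so a' = κ (c₁ + c₄) and b' = κ (c₂ +
  -- c₃).
  refine ⟨a / κ, b / κ, (b' - b) / κ, (a' - a) / κ, fun P u => ?_⟩
  rw [supportFn_projBodyPosGt_rpow, supportFn_projBodyNegGt_rpow, supportFn_projBodyPosLt_rpow,
    supportFn_projBodyNegLt_rpow]
  refine hΦ.eq_facetCombination hn hp (fun O hO A hA w => ?_) P u
  rw [facetCombination, weightedFacetSum_simplex_Ioi hA innerPos_eq,
    weightedFacetSum_simplex_Ioi hA innerNeg_eq]
  rcases subset_singleton_iff_eq.1 hO with rfl | rfl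
  · rw [hab' A hA, weightedFacetSum_simplex_Iio_empty hA innerPos_eq,
      weightedFacetSum_simplex_Iio_empty hA innerNeg_eq]
    simp only [neg_neg, one_mul, neg_one_mul]
    field_simp
    ring
  · rw [hab A hA, weightedFacetSum_simplex_Iio_zero hA, weightedFacetSum_simplex_Iio_zero hA]
    simp only [one_mul, neg_one_mul]
    field_simp
    ring
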